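/- Work in the smooth category over $\mathbb{R}$ or in the holomorphic category over $\mathbb{C}$; manifolds are Hausdorff, second countable, finite-dimensional and of constant dimension. Conventions. A Lie groupoid $\mathcal{G}\rightrightarrows M$ has source $s$, target $t$, unit map $u$ and multiplication $m$ (with $gh$ defined when $s(g)=t(h)$). Its Lie algebroid is $A_{\mathcal{G}}=\ker s_*$ along the units, with anchor $\rho=t_*$. A quasi-symplectic groupoid $(\mathcal{G},\omega,\phi)$ is a Lie groupoid $\mathcal{G}\rightrightarrows M$ with a multiplicative 2-form $\omega$ on $\mathcal{G}$ (that is, $m^*\omega=\mathrm{pr}_1^*\omega+\mathrm{pr}_2^*\omega$) and a closed 3-form $\phi$ on $M$ such that $d\omega=s^*\phi-t^*\phi$, $\dim\mathcal{G}=2\dim M$, and $\ker\omega_{u(x)}\cap\ker s_*\cap\ker t_*=0$ for all $x\in M$. It is a symplectic groupoid if $\phi=0$ and $\omega$ is non-degenerate. Its IM-form is $\sigma_\omega:A_{\mathcal{G}}\to T^*M$, $a\mapsto u^*(i_a\omega)$. A groupoid is abelian if $s=t$ and all its isotropy groups are abelian. A Morita morphism is a Lie groupoid morphism $\mathcal{H}\to\mathcal{G}$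 whose map on objects $p:\mathcal{H}^0\to M$ is a surjective submersion and for which the induced morphism $\mathcal{H}\to p^*\mathcal{G}$ to the pullback groupoid is an isomorphism of Lie groupoids. A symplectic Morita equivalence from $(\mathcal{G}_1,\omega_1,\phi_1)$ to $(\mathcal{G}_2,\omega_2,\phi_2)$ consists of a Lie groupoid $\mathcal{H}$, Morita morphisms $f_i:\mathcal{H}\to\mathcal{G}_i$ with maps on objects $p_i$ ($i=1,2$), and a 2-form $\delta$ on $\mathcal{H}^0$ such that $f_1^*\omega_1-f_2^*\omega_2=t^*\delta-s^*\delta$, $p_1^*\phi_1-p_2^*\phi_2=-d\delta$, and for every $x\in\mathcal{H}^0$ the map $b\mapsto(\rho(b),f_{1*}b,f_{2*}b)$ is an isomorphism from $(A_{\mathcal{H}})_x$ onto the space of all $(v,a_1,a_2)\in T_x\mathcal{H}^0\oplus (A_{\mathcal{G}_1})_{p_1(x)}\oplus (A_{\mathcal{G}_2})_{p_2(x)}$ with $p_{1*}v=\rho(a_1)$, $p_{2*}v=\rho(a_2)$ and $i_v\delta=p_1^*\sigma_{\omega_1}(a_1)-p_2^*\sigma_{\omega_2}(a_2)$. An abelianization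 of a quasi-symplectic groupoid $\mathcal{G}$ is an abelian symplectic groupoid $\mathcal{A}$ together with a symplectic Morita equivalence from $\mathcal{A}$ to $\mathcal{G}$. An admissible global slice of $\mathcal{G}\rightrightarrows M$ is an embedded submanifold $S\subseteq M$ that meets every orbit in exactly one point and transversely (that is, $T_xM=T_xS+\rho((A_{\mathcal{G}})_x)$ for all $x\in S$), and such that the isotropy group $\mathcal{G}_x$ is abelian for all $x\in S$. Proposition. Let $(\mathcal{G},\omega,\phi)$ be a quasi-symplectic groupoid over $M$, let $S\subseteq M$ be an admissible global slice with inclusion $i:S\to M$, and let $\gamma$ be a 2-form on $S$ with $i^*\phi=d\gamma$. Then $\mathcal{A}:=\mathcal{G}|_S=s^{-1}(S)\cap t^{-1}(S)$ is an embedded submanifold of $\mathcal{G}$ and a Lie groupoid over $S$; and, with $j:\mathcal{A}\to\mathcal{G}$ the inclusion, $(\mathcal{A},\,j^*\omega-s^*\gamma+t^*\gamma)$ is an abelianization of $(\mathcal{G},\omega,\phi)$: it is an abelian symplectic groupoid, and there is a symplectic Morita equivalence from it to $(\mathcal{G},\omega,\phi)$. -/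

import Mathlib

open scoped Manifold ContDiff

universe v u

/-! ## Manifolds

All manifolds are Hausdorff, second countable, finite-dimensional, without boundary, and of class
`C^∞` over `𝕜`, where `𝕜` is `ℝ` (the smooth category) or `ℂ` (the holomorphic category: a map
between open subsets of finite-dimensional complex spaces is `C^∞` over `ℂ` if and only if it is
holomorphic). The dimension of a manifold is that of its model space.  -/

/-- A bundled manifold, for quantifying over manifolds. -/
structure Mfld (𝕜 : Type v) [RCLike 𝕜] where
  carrier : Type u
  model : Type u
  [normedAddCommGroup : NormedAddCommGroup model]
  [normedSpace : NormedSpace 𝕜 model]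
  [finiteDimensional : FiniteDimensional 𝕜 model]
  [topologicalSpace : TopologicalSpace carrier]
  [t2Space : T2Space carrier]
  [secondCountable : SecondCountableTopology carrier]
  [chartedSpace : ChartedSpace model carrier]
  [isManifold : IsManifold 𝓘(𝕜, model) ∞ carrier]

attribute [instance] Mfld.normedAddCommGroup Mfld.normedSpace Mfld.finiteDimensional
  Mfld.topologicalSpace Mfld.t2Space Mfld.secondCountable Mfld.chartedSpace Mfld.isManifold

instance (𝕜 : Type v) [RCLike 𝕜] : CoeSort (Mfld.{v, u} 𝕜) (Type u) := ⟨Mfld.carrier⟩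

/-- A submersion: a smooth map with surjective differential at every point. -/
def IsSubmersionMap (𝕜 : Type v) [RCLike 𝕜] (E E' : Type u)
    [NormedAddCommGroup E] [NormedSpace 𝕜 E] [NormedAddCommGroup E'] [NormedSpace 𝕜 E']
    {M N : Type u} [TopologicalSpace M] [ChartedSpace E M] [TopologicalSpace N]
    [ChartedSpace E' N] (f : M → N) : Prop :=
  ContMDiff 𝓘(𝕜, E) 𝓘(𝕜, E') ∞ f ∧
    ∀ x, Function.Surjective (mfderiv 𝓘(𝕜, E) 𝓘(𝕜, E') f x)

/-! ## Differential forms -/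

/-- A (not necessarily smooth) differential `k`-form on `M`, with values in `𝕜`. -/
abbrev DForm (𝕜 : Type v) [RCLike 𝕜] (E : Type u) [NormedAddCommGroup E] [NormedSpace 𝕜 E]
    (M : Type u) [TopologicalSpace M] [ChartedSpace E M] (k : ℕ) :=
  (x : M) → ContinuousAlternatingMap 𝕜 (TangentSpace 𝓘(𝕜, E) x) 𝕜 (Fin k)

namespace DForm

variable {𝕜 : Type v} [RCLike 𝕜] {E E' : Type u}
  [NormedAddCommGroup E] [NormedSpace 𝕜 E] [NormedAddCommGroup E'] [NormedSpace 𝕜 E']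
  {M N : Type u} [TopologicalSpace M] [ChartedSpace E M] [TopologicalSpace N] [ChartedSpace E' N]
  {k : ℕ}

/-- The pullback `f^* Ω`. -/
noncomputable def pullback (f : M → N) (Ω : DForm 𝕜 E' N k) : DForm 𝕜 E M k :=
  fun x => (Ω (f x)).compContinuousLinearMap (mfderiv 𝓘(𝕜, E) 𝓘(𝕜, E') f x)

/-- The expression of `Ω` in the chart at `x₀`: the pullback of `Ω` by the inverse of that chart
(meaningful on the target of the chart). -/
noncomputable def localRep (Ω : DForm 𝕜 E M k) (x₀ : M) :
    E → ContinuousAlternatingMap 𝕜 E 𝕜 (Fin k) :=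
  fun y => (Ω ((chartAt E x₀).symm y)).compContinuousLinearMap
    (mfderiv 𝓘(𝕜, E) 𝓘(𝕜, E) (chartAt E x₀).symm y)

/-- A form is smooth if its expressions in charts are. -/
def IsSmooth (Ω : DForm 𝕜 E M k) : Prop :=
  ∀ x₀ : M, ContDiffOn 𝕜 ∞ (Ω.localRep x₀) (chartAt E x₀).target

/-- The exterior derivative, computed at `x` in the chart at `x`. -/
noncomputable def d (Ω : DForm 𝕜 E M k) : DForm 𝕜 E M (k + 1) :=
  fun x => (extDeriv (Ω.localRep x) (chartAt E x x)).compContinuousLinearMap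
    (mfderiv 𝓘(𝕜, E) 𝓘(𝕜, E) (chartAt E x) x)

end DForm

/-! ## Groupoids -/

/-- A groupoid with set of arrows `G` and set of objects `M`. The product `mul g h` is meaningful
only for composable pairs, that is, when `src g = tgt h`. -/
structure Grpd (G M : Type u) where
  src : G → M
  tgt : G → M
  unit : M → G
  inv : G → G
  mul : G → G → G
  src_unit : ∀ x, src (unit x) = x
  tgt_unit : ∀ x, tgt (unit x) = x
  src_inv : ∀ g, src (inv g) = tgt g
  tgt_inv : ∀ g, tgt (inv g) = src g
  src_mul : ∀ g h, src g = tgt h → src (mul g h) = src h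
  tgt_mul : ∀ g h, src g = tgt h → tgt (mul g h) = tgt g
  mul_assoc : ∀ g h k, src g = tgt h → src h = tgt k → mul (mul g h) k = mul g (mul h k)
  mul_unit : ∀ g, mul g (unit (src g)) = g
  unit_mul : ∀ g, mul (unit (tgt g)) g = g
  mul_inv : ∀ g, mul g (inv g) = unit (tgt g)
  inv_mul : ∀ g, mul (inv g) g = unit (src g)

namespace Grpd

section Algebra

variable {G M : Type u} (𝒢 : Grpd G M)

/-- The isotropy group at `x` is abelian. -/
def AbelianIsotropyAt (x : M) : Prop :=
  ∀ g h, 𝒢.src g = x → 𝒢.tgt g = x → 𝒢.src h = x → 𝒢.tgt h = x → 𝒢.mul g h = 𝒢.mul h g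

/-- A groupoid is abelian if source and target agree and all isotropy groups are abelian. -/
def IsAbelian : Prop := 𝒢.src = 𝒢.tgt ∧ ∀ x, 𝒢.AbelianIsotropyAt x

/-- The arrows of the restriction to `S`, namely `s⁻¹(S) ∩ t⁻¹(S)`. -/
abbrev RestrictArrows (S : Set M) : Type u := {g : G // 𝒢.src g ∈ S ∧ 𝒢.tgt g ∈ S}

open Classical in
/-- The restriction of a groupoid to a set `S` of objects. -/
noncomputable def restrict (S : Set M) : Grpd (𝒢.RestrictArrows S) S where
  src g := ⟨𝒢.src g.1, g.2.1⟩
  tgt g := ⟨𝒢.tgt g.1, g.2.2⟩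
  unit x := ⟨𝒢.unit x.1, by rw [𝒢.src_unit]; exact x.2, by rw [𝒢.tgt_unit]; exact x.2⟩
  inv g := ⟨𝒢.inv g.1, by rw [𝒢.src_inv]; exact g.2.2, by rw [𝒢.tgt_inv]; exact g.2.1⟩
  mul g h := if c : 𝒢.src g.1 = 𝒢.tgt h.1 then
    ⟨𝒢.mul g.1 h.1, by rw [𝒢.src_mul _ _ c]; exact h.2.1,
      by rw [𝒢.tgt_mul _ _ c]; exact g.2.2⟩ else g
  src_unit x := Subtype.ext (𝒢.src_unit x.1)
  tgt_unit x := Subtype.ext (𝒢.tgt_unit x.1)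
  src_inv g := Subtype.ext (𝒢.src_inv g.1)
  tgt_inv g := Subtype.ext (𝒢.tgt_inv g.1)
  src_mul g h c := by
    have c' : 𝒢.src g.1 = 𝒢.tgt h.1 := congrArg Subtype.val c
    apply Subtype.ext
    simp only [dif_pos c']
    exact 𝒢.src_mul _ _ c'
  tgt_mul g h c := by
    have c' : 𝒢.src g.1 = 𝒢.tgt h.1 := congrArg Subtype.val c
    apply Subtype.ext
    simp only [dif_pos c']
    exact 𝒢.tgt_mul _ _ c'
  mul_assoc g h k c₁ c₂ := by
    have c₁' : 𝒢.src g.1 = 𝒢.tgt h.1 := congrArg Subtype.val c₁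
    have c₂' : 𝒢.src h.1 = 𝒢.tgt k.1 := congrArg Subtype.val c₂
    have e₁ : 𝒢.src (𝒢.mul g.1 h.1) = 𝒢.tgt k.1 := (𝒢.src_mul _ _ c₁').trans c₂'
    have e₂ : 𝒢.src g.1 = 𝒢.tgt (𝒢.mul h.1 k.1) := c₁'.trans (𝒢.tgt_mul _ _ c₂').symm
    apply Subtype.ext
    simp only [dif_pos c₁', dif_pos c₂', dif_pos e₁, dif_pos e₂]
    exact 𝒢.mul_assoc _ _ _ c₁' c₂'
  mul_unit g := by
    have c : 𝒢.src g.1 = 𝒢.tgt (𝒢.unit (𝒢.src g.1)) := (𝒢.tgt_unit _).symm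
    apply Subtype.ext
    simp only [dif_pos c]
    exact 𝒢.mul_unit _
  unit_mul g := by
    have c : 𝒢.src (𝒢.unit (𝒢.tgt g.1)) = 𝒢.tgt g.1 := 𝒢.src_unit _
    apply Subtype.ext
    simp only [dif_pos c]
    exact 𝒢.unit_mul _
  mul_inv g := by
    have c : 𝒢.src g.1 = 𝒢.tgt (𝒢.inv g.1) := (𝒢.tgt_inv _).symm
    apply Subtype.ext
    simp only [dif_pos c]
    exact 𝒢.mul_inv _
  inv_mul g := by
    have c : 𝒢.src (𝒢.inv g.1) = 𝒢.tgt g.1 := 𝒢.src_inv _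
    apply Subtype.ext
    simp only [dif_pos c]
    exact 𝒢.inv_mul _

end Algebra

/-! ## Lie groupoids and quasi-symplectic groupoids

In Mathlib the tangent space at a point is a copy of the model space, identified through the
preferred chart at that point. Hence tangent spaces at points that are equal, but not by
definition, such as `t (u x)` and `x`, are the same type with the same meaning, and equations
between their elements are written without transport. -/

variable {𝕜 : Type v} [RCLike 𝕜]

section Lie

variable {E₁ E₀ : Type u}
  [NormedAddCommGroup E₁] [NormedSpace 𝕜 E₁] [NormedAddCommGroup E₀] [NormedSpace 𝕜 E₀]
  {G M : Type u} [TopologicalSpace G] [ChartedSpace E₁ G] [TopologicalSpace M] [ChartedSpace E₀ M]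

variable (𝕜 E₁ E₀) in
/-- A Lie groupoid. The manifold of composable pairs is an embedded submanifold of `G × G`, and a
map on an embedded submanifold is smooth if and only if it is smooth in the sense of `ContMDiffOn`
on the underlying set. -/
structure IsLie (𝒢 : Grpd G M) : Prop where
  src_submersion : IsSubmersionMap 𝕜 E₁ E₀ 𝒢.src
  tgt_submersion : IsSubmersionMap 𝕜 E₁ E₀ 𝒢.tgt
  unit_smooth : ContMDiff 𝓘(𝕜, E₀) 𝓘(𝕜, E₁) ∞ 𝒢.unit
  inv_smooth : ContMDiff 𝓘(𝕜, E₁) 𝓘(𝕜, E₁) ∞ 𝒢.inv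
  mul_smooth : ContMDiffOn (𝓘(𝕜, E₁).prod 𝓘(𝕜, E₁)) 𝓘(𝕜, E₁) ∞
    (fun p : G × G => 𝒢.mul p.1 p.2) {p | 𝒢.src p.1 = 𝒢.tgt p.2}

/-- The 2-form `Ω` is multiplicative: `m^* Ω = pr₁^* Ω + pr₂^* Ω` on the manifold of composable
pairs. The identity is stated after pullback along any smooth map `(a, b)` from a manifold `N` to
the manifold of composable pairs; the identity map of the latter is one of these. -/
def IsMultiplicative (𝒢 : Grpd G M) (Ω : DForm 𝕜 E₁ G 2) : Prop :=
  ∀ (N : Mfld.{v, u} 𝕜) (a b : N → G),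
    ContMDiff 𝓘(𝕜, N.model) 𝓘(𝕜, E₁) ∞ a → ContMDiff 𝓘(𝕜, N.model) 𝓘(𝕜, E₁) ∞ b →
    (∀ n, 𝒢.src (a n) = 𝒢.tgt (b n)) →
    (DForm.pullback (fun n => 𝒢.mul (a n) (b n)) Ω : DForm 𝕜 N.model N 2) =
      DForm.pullback a Ω + DForm.pullback b Ω

/-- A quasi-symplectic groupoid `(𝒢, Ω, φ)`. -/
structure IsQuasiSymplectic (𝒢 : Grpd G M) (Ω : DForm 𝕜 E₁ G 2) (φ : DForm 𝕜 E₀ M 3) : Prop where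
  isLie : 𝒢.IsLie 𝕜 E₁ E₀
  smooth_two : Ω.IsSmooth
  smooth_three : φ.IsSmooth
  multiplicative : 𝒢.IsMultiplicative Ω
  d_two : Ω.d = DForm.pullback 𝒢.src φ - DForm.pullback 𝒢.tgt φ
  d_three : φ.d = 0
  dim_eq : Module.finrank 𝕜 E₁ = 2 * Module.finrank 𝕜 E₀
  nondegenerate : ∀ (x : M) (a : TangentSpace 𝓘(𝕜, E₁) (𝒢.unit x)),
    (∀ b, Ω (𝒢.unit x) ![a, b] = 0) →
    mfderiv 𝓘(𝕜, E₁) 𝓘(𝕜, E₀) 𝒢.src (𝒢.unit x) a = 0 →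
    mfderiv 𝓘(𝕜, E₁) 𝓘(𝕜, E₀) 𝒢.tgt (𝒢.unit x) a = 0 → a = 0

variable (E₀) in
/-- A symplectic groupoid: a quasi-symplectic groupoid with non-degenerate 2-form and trivial
3-form. -/
structure IsSymplectic (𝒢 : Grpd G M) (Ω : DForm 𝕜 E₁ G 2) : Prop where
  quasi : 𝒢.IsQuasiSymplectic Ω (0 : DForm 𝕜 E₀ M 3)
  nondegenerate : ∀ (g : G) (a : TangentSpace 𝓘(𝕜, E₁) g), (∀ b, Ω g ![a, b] = 0) → a = 0

variable (E₀) in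
/-- The fibre at `x` of the Lie algebroid `A_𝒢`, the kernel of `s_*` along the units, as a
predicate. -/
def InAlgebroid (𝒢 : Grpd G M) (x : M) (a : TangentSpace 𝓘(𝕜, E₁) (𝒢.unit x)) : Prop :=
  mfderiv 𝓘(𝕜, E₁) 𝓘(𝕜, E₀) 𝒢.src (𝒢.unit x) a = 0

/-- The anchor of the Lie algebroid, that is, `t_*` at the units. -/
noncomputable def anchor (𝒢 : Grpd G M) (x : M) (a : TangentSpace 𝓘(𝕜, E₁) (𝒢.unit x)) :
    TangentSpace 𝓘(𝕜, E₀) x :=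
  (mfderiv 𝓘(𝕜, E₁) 𝓘(𝕜, E₀) 𝒢.tgt (𝒢.unit x) a : E₀)

/-- The IM-form of `Ω`: the covector `u^*(i_a Ω)` at `x`. -/
noncomputable def imForm (𝒢 : Grpd G M) (Ω : DForm 𝕜 E₁ G 2) (x : M)
    (a : TangentSpace 𝓘(𝕜, E₁) (𝒢.unit x)) (w : TangentSpace 𝓘(𝕜, E₀) x) : 𝕜 :=
  Ω (𝒢.unit x) ![a, mfderiv 𝓘(𝕜, E₀) 𝓘(𝕜, E₁) 𝒢.unit x w]

variable (𝕜 E₁ E₀) in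
/-- The subset `S` of `M`, endowed with a manifold structure, is an admissible global slice: it is
an embedded submanifold that meets every orbit exactly once, transversely (the tangent space of
the orbit through `x` is the image of the anchor at `x`), and the isotropy groups at its points are
abelian. -/
structure IsAdmissibleGlobalSlice (𝒢 : Grpd G M) (E_S : Type u) [NormedAddCommGroup E_S]
    [NormedSpace 𝕜 E_S] (S : Set M) [ChartedSpace E_S S] : Prop where
  embedded : Manifold.IsSmoothEmbedding 𝓘(𝕜, E_S) 𝓘(𝕜, E₀) ∞ (Subtype.val : S → M)
  meets_once : ∀ y : M, ∃! x : M, x ∈ S ∧ ∃ g : G, 𝒢.src g = y ∧ 𝒢.tgt g = x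
  transverse : ∀ (x : S) (w : TangentSpace 𝓘(𝕜, E₀) x.1),
    ∃ (y : TangentSpace 𝓘(𝕜, E_S) x) (a : TangentSpace 𝓘(𝕜, E₁) (𝒢.unit x.1)),
      𝒢.InAlgebroid E₀ x.1 a ∧
      w = mfderiv 𝓘(𝕜, E_S) 𝓘(𝕜, E₀) (Subtype.val : S → M) x y + 𝒢.anchor x.1 a
  abelian : ∀ x ∈ S, 𝒢.AbelianIsotropyAt x

end Lie

/-! ## Symplectic Morita equivalence -/

section Morita

variable {F₁ F₀ E₁ E₀ D₁ D₀ : Type u}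
  [NormedAddCommGroup F₁] [NormedSpace 𝕜 F₁] [NormedAddCommGroup F₀] [NormedSpace 𝕜 F₀]
  [NormedAddCommGroup E₁] [NormedSpace 𝕜 E₁] [NormedAddCommGroup E₀] [NormedSpace 𝕜 E₀]
  [NormedAddCommGroup D₁] [NormedSpace 𝕜 D₁] [NormedAddCommGroup D₀] [NormedSpace 𝕜 D₀]
  {H H₀ G M K L : Type u}
  [TopologicalSpace H] [ChartedSpace F₁ H] [TopologicalSpace H₀] [ChartedSpace F₀ H₀]
  [TopologicalSpace G] [ChartedSpace E₁ G] [TopologicalSpace M] [ChartedSpace E₀ M]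
  [TopologicalSpace K] [ChartedSpace D₁ K] [TopologicalSpace L] [ChartedSpace D₀ L]

variable (𝕜 F₁ F₀ E₁ E₀) in
/-- A morphism of Lie groupoids, given by `f` on arrows and `p` on objects. -/
structure IsLieMorphism (ℋ : Grpd H H₀) (𝒢 : Grpd G M) (f : H → G) (p : H₀ → M) : Prop where
  arrows_smooth : ContMDiff 𝓘(𝕜, F₁) 𝓘(𝕜, E₁) ∞ f
  objects_smooth : ContMDiff 𝓘(𝕜, F₀) 𝓘(𝕜, E₀) ∞ p
  map_src : ∀ h, 𝒢.src (f h) = p (ℋ.src h)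
  map_tgt : ∀ h, 𝒢.tgt (f h) = p (ℋ.tgt h)
  map_mul : ∀ h k, ℋ.src h = ℋ.tgt k → f (ℋ.mul h k) = 𝒢.mul (f h) (f k)

/-- The set of arrows of the pullback groupoid `p^* 𝒢`, as a subset of `H₀ × G × H₀`. It is an
embedded submanifold if `p` is a submersion. -/
def pullbackArrows (𝒢 : Grpd G M) (p : H₀ → M) : Set (H₀ × G × H₀) :=
  {q | p q.1 = 𝒢.src q.2.1 ∧ 𝒢.tgt q.2.1 = p q.2.2}

variable (𝕜 F₁ F₀ E₁ E₀) in
/-- A Morita morphism: a morphism of Lie groupoids that is a surjective submersion on objects and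
for which the induced smooth map `h ↦ (s h, f h, t h)` to the arrows of the pullback groupoid
has a smooth inverse `r`. -/
structure IsMoritaMorphism (ℋ : Grpd H H₀) (𝒢 : Grpd G M) (f : H → G) (p : H₀ → M) : Prop where
  morphism : IsLieMorphism 𝕜 F₁ F₀ E₁ E₀ ℋ 𝒢 f p
  surjective : Function.Surjective p
  submersion : IsSubmersionMap 𝕜 F₀ E₀ p
  pullback_iso : ∃ r : H₀ × G × H₀ → H,
    ContMDiffOn (𝓘(𝕜, F₀).prod (𝓘(𝕜, E₁).prod 𝓘(𝕜, F₀))) 𝓘(𝕜, F₁) ∞ r (𝒢.pullbackArrows p) ∧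
    (∀ h, r (ℋ.src h, f h, ℋ.tgt h) = h) ∧
    ∀ q ∈ 𝒢.pullbackArrows p, (ℋ.src (r q), f (r q), ℋ.tgt (r q)) = q

variable (F₁) in
/-- The span `𝒢₁ ← ℋ → 𝒢₂` of Lie groupoid morphisms `(f₁, p₁)` and `(f₂, p₂)` together with the
2-form `δ` on the objects of `ℋ` is a 1-shifted Lagrangian correspondence, that is, a 1-shifted
Lagrangian on `𝒢₁ × 𝒢₂⁻`, the product of `(𝒢₁, Ω₁, φ₁)` and `(𝒢₂, -Ω₂, -φ₂)`. The last condition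
says that `b ↦ (ρ b, f₁_* b, f₂_* b)` is a bijection from the fibre of the Lie algebroid of `ℋ` at
`x` to the space of all `(y, a₁, a₂)` with `p₁_* y = ρ a₁`, `p₂_* y = ρ a₂` and
`i_y δ = p₁^* σ_{Ω₁}(a₁) - p₂^* σ_{Ω₂}(a₂)`. -/
structure IsLagrangianCorrespondence (ℋ : Grpd H H₀)
    (𝒢₁ : Grpd K L) (Ω₁ : DForm 𝕜 D₁ K 2) (φ₁ : DForm 𝕜 D₀ L 3)
    (𝒢₂ : Grpd G M) (Ω₂ : DForm 𝕜 E₁ G 2) (φ₂ : DForm 𝕜 E₀ M 3)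
    (f₁ : H → K) (p₁ : H₀ → L) (f₂ : H → G) (p₂ : H₀ → M)
    (δ : DForm 𝕜 F₀ H₀ 2) : Prop where
  isLie : ℋ.IsLie 𝕜 F₁ F₀
  morphism₁ : IsLieMorphism 𝕜 F₁ F₀ D₁ D₀ ℋ 𝒢₁ f₁ p₁
  morphism₂ : IsLieMorphism 𝕜 F₁ F₀ E₁ E₀ ℋ 𝒢₂ f₂ p₂
  smooth : δ.IsSmooth
  pullback_two : (DForm.pullback f₁ Ω₁ - DForm.pullback f₂ Ω₂ : DForm 𝕜 F₁ H 2) =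
    DForm.pullback ℋ.tgt δ - DForm.pullback ℋ.src δ
  pullback_three : (DForm.pullback p₁ φ₁ - DForm.pullback p₂ φ₂ : DForm 𝕜 F₀ H₀ 3) = -δ.d
  nondegenerate : ∀ (x : H₀) (y : TangentSpace 𝓘(𝕜, F₀) x)
    (a₁ : TangentSpace 𝓘(𝕜, D₁) (𝒢₁.unit (p₁ x))) (a₂ : TangentSpace 𝓘(𝕜, E₁) (𝒢₂.unit (p₂ x))),
    𝒢₁.InAlgebroid D₀ (p₁ x) a₁ → 𝒢₂.InAlgebroid E₀ (p₂ x) a₂ →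
    mfderiv 𝓘(𝕜, F₀) 𝓘(𝕜, D₀) p₁ x y = 𝒢₁.anchor (p₁ x) a₁ →
    mfderiv 𝓘(𝕜, F₀) 𝓘(𝕜, E₀) p₂ x y = 𝒢₂.anchor (p₂ x) a₂ →
    (∀ w : TangentSpace 𝓘(𝕜, F₀) x, δ x ![y, w] =
      𝒢₁.imForm Ω₁ (p₁ x) a₁ (mfderiv 𝓘(𝕜, F₀) 𝓘(𝕜, D₀) p₁ x w) -
      𝒢₂.imForm Ω₂ (p₂ x) a₂ (mfderiv 𝓘(𝕜, F₀) 𝓘(𝕜, E₀) p₂ x w)) →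
    ∃! b : TangentSpace 𝓘(𝕜, F₁) (ℋ.unit x), ℋ.InAlgebroid F₀ x b ∧ ℋ.anchor x b = y ∧
      (mfderiv 𝓘(𝕜, F₁) 𝓘(𝕜, D₁) f₁ (ℋ.unit x) b : D₁) = a₁ ∧
      (mfderiv 𝓘(𝕜, F₁) 𝓘(𝕜, E₁) f₂ (ℋ.unit x) b : E₁) = a₂

/-- There is a symplectic Morita equivalence `𝒢₁ ← ℋ → 𝒢₂`: a Morita equivalence that is also a
1-shifted Lagrangian correspondence. -/
def SymplecticMoritaEquivalent
    (𝒢₁ : Grpd K L) (Ω₁ : DForm 𝕜 D₁ K 2) (φ₁ : DForm 𝕜 D₀ L 3)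
    (𝒢₂ : Grpd G M) (Ω₂ : DForm 𝕜 E₁ G 2) (φ₂ : DForm 𝕜 E₀ M 3) : Prop :=
  ∃ (H H₀ : Mfld.{v, u} 𝕜) (ℋ : Grpd H H₀)
    (f₁ : H → K) (p₁ : H₀ → L) (f₂ : H → G) (p₂ : H₀ → M) (δ : DForm 𝕜 H₀.model H₀ 2),
    IsMoritaMorphism 𝕜 H.model H₀.model D₁ D₀ ℋ 𝒢₁ f₁ p₁ ∧
    IsMoritaMorphism 𝕜 H.model H₀.model E₁ E₀ ℋ 𝒢₂ f₂ p₂ ∧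
    IsLagrangianCorrespondence H.model ℋ 𝒢₁ Ω₁ φ₁ 𝒢₂ Ω₂ φ₂ f₁ p₁ f₂ p₂ δ

variable (D₀) in
/-- `(𝒜, η)` is an abelianization of the quasi-symplectic groupoid `(𝒢, Ω, φ)`: an abelian
symplectic groupoid with a symplectic Morita equivalence from it to `𝒢`. -/
structure IsAbelianization (𝒜 : Grpd K L) (η : DForm 𝕜 D₁ K 2)
    (𝒢 : Grpd G M) (Ω : DForm 𝕜 E₁ G 2) (φ : DForm 𝕜 E₀ M 3) : Prop where
  symplectic : 𝒜.IsSymplectic D₀ η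
  abelian : 𝒜.IsAbelian
  morita : SymplecticMoritaEquivalent 𝒜 η (0 : DForm 𝕜 D₀ L 3) 𝒢 Ω φ

end Morita

end Grpd

/-! The restriction. Each orbit meets `S` once, so source and target agree on `𝒜 = 𝒢|_S`. Hence the
two `γ`-terms cancel, and `j^*ω` is closed because `d(j^*ω) = j^*(s^*φ - t^*φ)`. Transversality
holds at units by hypothesis and is carried to other arrows by right translation
(`exists_right_translation`, `exists_tangent`). It shows that local equations of `S`, composed with
`s` and with `t`, form a submersion along `𝒜`. So `𝒜` is embedded, of dimension `2 dim M - 2 codim S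
= 2 dim S`.

Non-degeneracy. Multiplicativity gives `ω(R_g a, b) = σ_ω(a)(t_* b)` for `a` in the algebroid. Let
`a` be tangent to `𝒜` with `s_* a = 0`; then also `t_* a = 0`. If `σ_ω(a)` vanishes on `TS`, it
vanishes on the image of the anchor too, since `ω(a, c) = -σ_ω(c)(t_* a) = 0` for `c` in the
algebroid. By transversality `a` is in the kernel of `ω`, so `a = 0` (`imForm_restrict_injective`).
By dimension the IM-form of `𝒜` is an isomorphism onto `T^*S`, and the translation formula spreads
non-degeneracy from the units to all arrows (`IsMultiplicative.nondegenerate`).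

The equivalence. If there were a global section `σ` of `s` with targets in `S`, conjugation `g ↦ σ(t
g) g σ(s g)⁻¹` would retract `𝒢` onto `𝒜`. Such sections exist locally, hence globally on the
disjoint union `X` of a countable open cover, with étale projection `p : X → M`
(`exists_etale_section`). Take `ℋ = p^*𝒢`, with the projection to `𝒢`, the conjugation morphism to
`𝒜`, and `δ = σ^*ω + (t ∘ σ)^*γ`. Multiplicativity of `ω` yields the identity of 2-forms
(`pullback_arrow`), and `i^*φ = dγ` yields `dδ = p^*φ`. Since `p` is étale, a vector of the
algebroid of `ℋ` is determined by its image in that of `𝒢`; its image in that of `𝒜` is then forced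
by injectivity of the IM-form. -/

open Set Filter Topology

set_option linter.unusedSectionVars false

/-! ## Tangent maps as maps between model spaces -/

section TangentMaps

variable {𝕜 : Type*} [RCLike 𝕜] {E E' E'' : Type*}
  [NormedAddCommGroup E] [NormedSpace 𝕜 E] [NormedAddCommGroup E'] [NormedSpace 𝕜 E']
  [NormedAddCommGroup E''] [NormedSpace 𝕜 E'']
  {M N P : Type*} [TopologicalSpace M] [ChartedSpace E M] [TopologicalSpace N]
  [ChartedSpace E' N] [TopologicalSpace P] [ChartedSpace E'' P]

variable (𝕜 E E') in
/-- The differential of `f` at `x`, as a map between the model spaces. -/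
noncomputable def tmap (f : M → N) (x : M) : E →L[𝕜] E' :=
  mfderiv 𝓘(𝕜, E) 𝓘(𝕜, E') f x

/-- The base point of `g` is a separate variable `y` with a proof of `f x = y`, so that
differentials compose at points such as `t (u x)` and `x` that are equal but not by definition. -/
theorem tmap_comp {g : N → P} {f : M → N} {x : M} {y : N} (hy : f x = y)
    (hg : MDifferentiableAt 𝓘(𝕜, E') 𝓘(𝕜, E'') g y)
    (hf : MDifferentiableAt 𝓘(𝕜, E) 𝓘(𝕜, E') f x) :
    tmap 𝕜 E E'' (g ∘ f) x = (tmap 𝕜 E' E'' g y).comp (tmap 𝕜 E E' f x) := by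
  subst hy
  exact mfderiv_comp x hg hf

theorem tmap_comp_apply {g : N → P} {f : M → N} {x : M} {y : N} (hy : f x = y)
    (hg : MDifferentiableAt 𝓘(𝕜, E') 𝓘(𝕜, E'') g y)
    (hf : MDifferentiableAt 𝓘(𝕜, E) 𝓘(𝕜, E') f x) (a : E) :
    tmap 𝕜 E E'' (fun z => g (f z)) x a = tmap 𝕜 E' E'' g y (tmap 𝕜 E E' f x a) := by
  change tmap 𝕜 E E'' (g ∘ f) x a = _
  rw [tmap_comp hy hg hf]; rfl

theorem tmap_congr {f g : M → N} {x : M} (h : f =ᶠ[𝓝 x] g) :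
    tmap 𝕜 E E' f x = tmap 𝕜 E E' g x :=
  h.mfderiv_eq

theorem tmap_id (x : M) : tmap 𝕜 E E (fun y : M => y) x = ContinuousLinearMap.id 𝕜 E :=
  mfderiv_id

theorem tmap_const (x : M) (y : N) : tmap 𝕜 E E' (fun _ : M => y) x = 0 :=
  mfderiv_const

theorem tmap_eq_fderiv {f : E → E'} {x : E} : tmap 𝕜 E E' f x = fderiv 𝕜 f x :=
  mfderiv_eq_fderiv

/-- The differential of a map with a local left inverse. -/
theorem tmap_leftInverse {f : M → N} {g : N → M} {x : M} {y : N} (hy : f x = y)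
    (hf : MDifferentiableAt 𝓘(𝕜, E) 𝓘(𝕜, E') f x)
    (hg : MDifferentiableAt 𝓘(𝕜, E') 𝓘(𝕜, E) g y)
    (h : ∀ᶠ z in 𝓝 x, g (f z) = z) (a : E) :
    tmap 𝕜 E' E g y (tmap 𝕜 E E' f x a) = a := by
  have h1 : tmap 𝕜 E E (g ∘ f) x = ContinuousLinearMap.id 𝕜 E :=
    (tmap_congr h).trans (tmap_id x)
  rw [tmap_comp hy hg hf] at h1
  exact DFunLike.congr_fun h1 a

end TangentMaps

section ChartSmooth

variable {𝕜 : Type*} [RCLike 𝕜] {E : Type*} [NormedAddCommGroup E] [NormedSpace 𝕜 E]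
  {M : Type*} [TopologicalSpace M] [ChartedSpace E M] [IsManifold 𝓘(𝕜, E) ∞ M]

theorem mdifferentiableAt_chartAt {x₀ x : M} (hx : x ∈ (chartAt E x₀).source) :
    MDifferentiableAt 𝓘(𝕜, E) 𝓘(𝕜, E) (chartAt E x₀) x :=
  haveI : IsManifold 𝓘(𝕜, E) 1 M := .of_le (n := ∞) (by simp)
  mdifferentiableAt_atlas (chart_mem_atlas E x₀) hx

theorem mdifferentiableAt_chartAt_symm {x₀ : M} {y : E} (hy : y ∈ (chartAt E x₀).target) :
    MDifferentiableAt 𝓘(𝕜, E) 𝓘(𝕜, E) (chartAt E x₀).symm y :=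
  haveI : IsManifold 𝓘(𝕜, E) 1 M := .of_le (n := ∞) (by simp)
  mdifferentiableAt_atlas_symm (chart_mem_atlas E x₀) hy

theorem tmap_chartAt_symm_tmap_chartAt {x₀ x : M} (hx : x ∈ (chartAt E x₀).source) (a : E) :
    tmap 𝕜 E E (chartAt E x₀).symm (chartAt E x₀ x) (tmap 𝕜 E E (chartAt E x₀) x a) = a :=
  tmap_leftInverse rfl (mdifferentiableAt_chartAt hx)
    (mdifferentiableAt_chartAt_symm ((chartAt E x₀).map_source hx))
    ((chartAt E x₀).eventually_left_inverse hx) a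

theorem tmap_chartAt_tmap_chartAt_symm {x₀ : M} {y : E} (hy : y ∈ (chartAt E x₀).target) (a : E) :
    tmap 𝕜 E E (chartAt E x₀) ((chartAt E x₀).symm y) (tmap 𝕜 E E (chartAt E x₀).symm y a) = a :=
  tmap_leftInverse rfl (mdifferentiableAt_chartAt_symm hy)
    (mdifferentiableAt_chartAt ((chartAt E x₀).map_target hy))
    ((chartAt E x₀).eventually_right_inverse hy) a

end ChartSmooth

/-! ## Alternating forms in two variables -/

section Alternating

variable {𝕜 : Type*} [RCLike 𝕜] {E F : Type*}
  [NormedAddCommGroup E] [NormedSpace 𝕜 E] [NormedAddCommGroup F] [NormedSpace 𝕜 F]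

theorem ContinuousAlternatingMap.map_pair_add_left (α : E [⋀^Fin 2]→L[𝕜] 𝕜) (a a' b : E) :
    α ![a + a', b] = α ![a, b] + α ![a', b] := by
  have hu : ∀ c : E, Function.update ![0, b] 0 c = ![c, b] := fun c => by
    ext i; fin_cases i <;> rfl
  simpa only [hu] using α.map_update_add ![0, b] 0 a a'

theorem ContinuousAlternatingMap.map_pair_smul_left (α : E [⋀^Fin 2]→L[𝕜] 𝕜) (c : 𝕜) (a b : E) :
    α ![c • a, b] = c * α ![a, b] := by
  have hu : ∀ c : E, Function.update ![0, b] 0 c = ![c, b] := fun c => by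
    ext i; fin_cases i <;> rfl
  simpa only [hu, smul_eq_mul] using α.map_update_smul ![0, b] 0 c a

theorem ContinuousAlternatingMap.map_pair_swap (α : E [⋀^Fin 2]→L[𝕜] 𝕜) (a b : E) :
    α ![a, b] = - α ![b, a] := by
  have : α (![b, a] ∘ Equiv.swap 0 1) = -α ![b, a] :=
    α.toAlternatingMap.map_swap ![b, a] (i := 0) (j := 1) (by simp)
  rw [← this]
  congr 1
  ext i; fin_cases i <;> rfl

/-- The bilinear map of an alternating form in two variables. -/
def ContinuousAlternatingMap.pairing (α : E [⋀^Fin 2]→L[𝕜] 𝕜) : E →ₗ[𝕜] E →ₗ[𝕜] 𝕜 :=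
  LinearMap.mk₂ 𝕜 (fun a b => α ![a, b]) α.map_pair_add_left
    (fun c a b => α.map_pair_smul_left c a b)
    (fun a b b' => by
      rw [α.map_pair_swap, α.map_pair_add_left, α.map_pair_swap b, α.map_pair_swap b']; ring)
    (fun c a b => by
      rw [α.map_pair_swap, α.map_pair_smul_left, α.map_pair_swap b]; simp)

theorem ContinuousAlternatingMap.pairing_apply (α : E [⋀^Fin 2]→L[𝕜] 𝕜) (a b : E) :
    α.pairing a b = α ![a, b] := rfl

theorem ContinuousAlternatingMap.pairing_swap (α : E [⋀^Fin 2]→L[𝕜] 𝕜) (a b : E) :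
    α.pairing a b = - α.pairing b a := α.map_pair_swap a b

theorem ContinuousAlternatingMap.pairing_comp (α : F [⋀^Fin 2]→L[𝕜] 𝕜) (f : E →L[𝕜] F) (a b : E) :
    (α.compContinuousLinearMap f).pairing a b = α.pairing (f a) (f b) := by
  simp only [pairing_apply, ContinuousAlternatingMap.compContinuousLinearMap_apply]
  congr 1
  ext i; fin_cases i <;> rfl

/-- Pulling back alternating forms along linear maps is smooth. -/
theorem ContDiffAt.continuousAlternatingMap_comp {k : ℕ} {n : WithTop ℕ∞} {X : Type*}
    [NormedAddCommGroup X] [NormedSpace 𝕜 X]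
    {α : X → F [⋀^Fin k]→L[𝕜] 𝕜} {f : X → E →L[𝕜] F} {x : X}
    [FiniteDimensional 𝕜 E] (hα : ContDiffAt 𝕜 n α x) (hf : ContDiffAt 𝕜 n f x) :
    ContDiffAt 𝕜 n (fun y => (α y).compContinuousLinearMap (f y)) x := by
  have : FiniteDimensional 𝕜 (ContinuousMultilinearMap 𝕜 (fun _ : Fin k => E) 𝕜) :=
    Module.Finite.of_injective (ContinuousMultilinearMap.toMultilinearMapLinear (R' := 𝕜) (A := 𝕜)
      (M₁ := fun _ : Fin k => E) (M₂ := 𝕜)) ContinuousMultilinearMap.toMultilinearMap_injective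
  let ι := ContinuousAlternatingMap.toContinuousMultilinearMapCLM (E := E) (F := 𝕜)
    (ι := Fin k) (𝕜 := 𝕜) 𝕜
  have hι : Function.Injective ι.toLinearMap :=
    ContinuousAlternatingMap.toContinuousMultilinearMap_injective
  obtain ⟨r, hr⟩ := LinearMap.exists_leftInverse_of_injective _ (LinearMap.ker_eq_bot.2 hι)
  let ι' := ContinuousAlternatingMap.toContinuousMultilinearMapCLM (E := F) (F := 𝕜)
    (ι := Fin k) (𝕜 := 𝕜) 𝕜
  have h1 : ContDiffAt 𝕜 n (fun y =>
      ContinuousMultilinearMap.compContinuousLinearMapContinuousMultilinear 𝕜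
        (fun _ : Fin k => E) (fun _ => F) 𝕜 (fun _ => f y) (ι' (α y))) x :=
    ((ContinuousMultilinearMap.contDiff _).contDiffAt.comp x
      (contDiffAt_pi.2 fun _ => hf)).clm_apply (ι'.contDiff.contDiffAt.comp x hα)
  have h2 := (LinearMap.toContinuousLinearMap r).contDiff.contDiffAt.comp x h1
  refine h2.congr_of_eventuallyEq (Eventually.of_forall fun y => ?_)
  exact (LinearMap.congr_fun hr ((α y).compContinuousLinearMap (f y))).symm

end Alternating

/-! ## Pullback and exterior derivative of forms -/

namespace DForm

variable {𝕜 : Type v} [RCLike 𝕜] {E E' E'' : Type u}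
  [NormedAddCommGroup E] [NormedSpace 𝕜 E] [NormedAddCommGroup E'] [NormedSpace 𝕜 E']
  [NormedAddCommGroup E''] [NormedSpace 𝕜 E'']
  {M N P : Type u} [TopologicalSpace M] [ChartedSpace E M] [TopologicalSpace N]
  [ChartedSpace E' N] [TopologicalSpace P] [ChartedSpace E'' P] {k : ℕ}

/-- The form at a point, on the model space. -/
def at' (Ω : DForm 𝕜 E M k) (x : M) : E [⋀^Fin k]→L[𝕜] 𝕜 := Ω x

theorem ext_at {Ω Ω' : DForm 𝕜 E M k} (h : ∀ x, Ω.at' x = Ω'.at' x) : Ω = Ω' := funext h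

theorem pullback_at (f : M → N) (Ω : DForm 𝕜 E' N k) (x : M) :
    (pullback f Ω : DForm 𝕜 E M k).at' x =
      (Ω.at' (f x)).compContinuousLinearMap (tmap 𝕜 E E' f x) := rfl

theorem localRep_at (Ω : DForm 𝕜 E M k) (x₀ : M) (y : E) :
    Ω.localRep x₀ y = (Ω.at' ((chartAt E x₀).symm y)).compContinuousLinearMap
      (tmap 𝕜 E E (chartAt E x₀).symm y) := rfl

theorem d_at (Ω : DForm 𝕜 E M k) (x : M) :
    Ω.d.at' x = (extDeriv (Ω.localRep x) (chartAt E x x)).compContinuousLinearMap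
      (tmap 𝕜 E E (chartAt E x) x) := rfl

theorem comp_comp {A B C : Type*} [NormedAddCommGroup A] [NormedSpace 𝕜 A]
    [NormedAddCommGroup B] [NormedSpace 𝕜 B] [NormedAddCommGroup C] [NormedSpace 𝕜 C]
    (α : C [⋀^Fin k]→L[𝕜] 𝕜) (g : B →L[𝕜] C) (f : A →L[𝕜] B) :
    (α.compContinuousLinearMap g).compContinuousLinearMap f =
      α.compContinuousLinearMap (g.comp f) := rfl

theorem pullback_comp {g : N → P} {f : M → N} (Ω : DForm 𝕜 E'' P k)
    (hg : MDifferentiable 𝓘(𝕜, E') 𝓘(𝕜, E'') g) (hf : MDifferentiable 𝓘(𝕜, E) 𝓘(𝕜, E') f) :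
    (pullback (fun x => g (f x)) Ω : DForm 𝕜 E M k) =
      pullback f (pullback g Ω : DForm 𝕜 E' N k) := by
  refine ext_at fun x => ?_
  rw [pullback_at, pullback_at, pullback_at, comp_comp, ← tmap_comp rfl (hg _) (hf _)]
  rfl

theorem pullback_add (f : M → N) (Ω Ω' : DForm 𝕜 E' N k) :
    (pullback f (Ω + Ω') : DForm 𝕜 E M k) = pullback f Ω + pullback f Ω' := rfl

theorem pullback_sub (f : M → N) (Ω Ω' : DForm 𝕜 E' N k) :
    (pullback f (Ω - Ω') : DForm 𝕜 E M k) = pullback f Ω - pullback f Ω' := rfl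

theorem pullback_zero (f : M → N) :
    (pullback f (0 : DForm 𝕜 E' N k) : DForm 𝕜 E M k) = 0 := rfl

theorem localRep_add (Ω Ω' : DForm 𝕜 E M k) (x₀ : M) :
    (Ω + Ω').localRep x₀ = Ω.localRep x₀ + Ω'.localRep x₀ := rfl

theorem IsSmooth.add {Ω Ω' : DForm 𝕜 E M k} (h : Ω.IsSmooth) (h' : Ω'.IsSmooth) :
    (Ω + Ω').IsSmooth := fun x₀ => (h x₀).add (h' x₀)

theorem isSmooth_zero : (0 : DForm 𝕜 E M k).IsSmooth := fun _ =>
  contDiffOn_const (c := 0)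

theorem IsSmooth.contDiffAt {Ω : DForm 𝕜 E M k} (h : Ω.IsSmooth) {x₀ : M} {y : E}
    (hy : y ∈ (chartAt E x₀).target) : ContDiffAt 𝕜 ∞ (Ω.localRep x₀) y :=
  (h x₀).contDiffAt ((chartAt E x₀).open_target.mem_nhds hy)

theorem IsSmooth.differentiableAt {Ω : DForm 𝕜 E M k} (h : Ω.IsSmooth) (x : M) :
    DifferentiableAt 𝕜 (Ω.localRep x) (chartAt E x x) :=
  (h.contDiffAt (mem_chart_target E x)).differentiableAt (by simp)

theorem d_add {Ω Ω' : DForm 𝕜 E M k} (h : Ω.IsSmooth) (h' : Ω'.IsSmooth) :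
    (Ω + Ω').d = Ω.d + Ω'.d := by
  refine ext_at fun x => ?_
  rw [d_at, localRep_add, extDeriv_add (h.differentiableAt x) (h'.differentiableAt x)]
  rfl

theorem d_zero : (0 : DForm 𝕜 E M k).d = 0 := by
  have := d_add (isSmooth_zero (𝕜 := 𝕜) (E := E) (M := M) (k := k)) isSmooth_zero
  simpa using this

section

variable [IsManifold 𝓘(𝕜, E) ∞ M] [IsManifold 𝓘(𝕜, E') ∞ N]

/-- The expression of a pullback in charts. -/
theorem localRep_pullback {f : M → N} (hf : ContMDiff 𝓘(𝕜, E) 𝓘(𝕜, E') ∞ f)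
    (Ω : DForm 𝕜 E' N k) (x₀ : M) (z₀ : N) {y : E} (hy : y ∈ (chartAt E x₀).target)
    (hz : f ((chartAt E x₀).symm y) ∈ (chartAt E' z₀).source) :
    (pullback f Ω : DForm 𝕜 E M k).localRep x₀ y =
      (Ω.localRep z₀ (chartAt E' z₀ (f ((chartAt E x₀).symm y)))).compContinuousLinearMap
        (fderiv 𝕜 (fun y => chartAt E' z₀ (f ((chartAt E x₀).symm y))) y) := by
  have hfd : MDifferentiable 𝓘(𝕜, E) 𝓘(𝕜, E') f := hf.mdifferentiable (by simp)
  rw [localRep_at, pullback_at, localRep_at, comp_comp, comp_comp, ← tmap_eq_fderiv]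
  have h1 : tmap 𝕜 E E' (fun y => chartAt E' z₀ (f ((chartAt E x₀).symm y))) y =
      (tmap 𝕜 E' E' (chartAt E' z₀) (f ((chartAt E x₀).symm y))).comp
        ((tmap 𝕜 E E' f ((chartAt E x₀).symm y)).comp (tmap 𝕜 E E (chartAt E x₀).symm y)) := by
    rw [← tmap_comp rfl (hfd _) (mdifferentiableAt_chartAt_symm hy)]
    exact tmap_comp (f := f ∘ (chartAt E x₀).symm) rfl (mdifferentiableAt_chartAt hz)
      ((hfd _).comp _ (mdifferentiableAt_chartAt_symm hy))
  rw [h1, (chartAt E' z₀).left_inv hz]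
  congr 1
  ext a
  simp only [ContinuousLinearMap.comp_apply]
  rw [tmap_chartAt_symm_tmap_chartAt hz]

theorem contDiffAt_inChart {f : M → N} (hf : ContMDiff 𝓘(𝕜, E) 𝓘(𝕜, E') ∞ f)
    (x₀ : M) (z₀ : N) {y : E} (hy : y ∈ (chartAt E x₀).target)
    (hz : f ((chartAt E x₀).symm y) ∈ (chartAt E' z₀).source) :
    ContDiffAt 𝕜 ∞ (fun y => chartAt E' z₀ (f ((chartAt E x₀).symm y))) y := by
  rw [← contMDiffAt_iff_contDiffAt]
  have h1 : ContMDiffAt 𝓘(𝕜, E) 𝓘(𝕜, E) ∞ (chartAt E x₀).symm y :=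
    (contMDiffOn_chart_symm (I := 𝓘(𝕜, E)) (x := x₀)).contMDiffAt
      ((chartAt E x₀).open_target.mem_nhds hy)
  have h2 : ContMDiffAt 𝓘(𝕜, E') 𝓘(𝕜, E') ∞ (chartAt E' z₀) (f ((chartAt E x₀).symm y)) :=
    (contMDiffOn_chart (I := 𝓘(𝕜, E')) (x := z₀)).contMDiffAt
      ((chartAt E' z₀).open_source.mem_nhds hz)
  exact h2.comp y ((hf _).comp y h1)

theorem eventually_mem_chart {f : M → N} (hf : Continuous f)
    (x₀ : M) (z₀ : N) {y : E} (hy : y ∈ (chartAt E x₀).target)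
    (hz : f ((chartAt E x₀).symm y) ∈ (chartAt E' z₀).source) :
    ∀ᶠ y' in 𝓝 y, y' ∈ (chartAt E x₀).target ∧
      f ((chartAt E x₀).symm y') ∈ (chartAt E' z₀).source :=
  Filter.Eventually.and ((chartAt E x₀).open_target.mem_nhds hy)
    ((hf.continuousAt.comp ((chartAt E x₀).continuousAt_symm hy)).eventually
      ((chartAt E' z₀).open_source.mem_nhds hz))

theorem IsSmooth.pullback [FiniteDimensional 𝕜 E] {f : M → N}
    (hf : ContMDiff 𝓘(𝕜, E) 𝓘(𝕜, E') ∞ f) {Ω : DForm 𝕜 E' N k} (hΩ : Ω.IsSmooth) :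
    (DForm.pullback f Ω : DForm 𝕜 E M k).IsSmooth := by
  intro x₀ y hy
  refine ContDiffAt.contDiffWithinAt ?_
  set z₀ := f ((chartAt E x₀).symm y)
  have hz : f ((chartAt E x₀).symm y) ∈ (chartAt E' z₀).source := mem_chart_source E' z₀
  have hF := contDiffAt_inChart hf x₀ z₀ hy hz
  have hcomp := (hΩ.contDiffAt ((chartAt E' z₀).map_source hz)).comp y hF
  refine (ContDiffAt.continuousAlternatingMap_comp hcomp
    (hF.fderiv_right (m := ∞) (by simp))).congr_of_eventuallyEq ?_
  filter_upwards [eventually_mem_chart hf.continuous x₀ z₀ hy hz] with y' hy'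
  exact localRep_pullback hf Ω x₀ z₀ hy'.1 hy'.2

/-- The regularity at which second derivatives are symmetric, as `extDeriv_pullback` demands. -/
theorem two_le_infty : minSmoothness 𝕜 2 ≤ (∞ : WithTop ℕ∞) := by
  rw [minSmoothness_of_isRCLikeNormedField]
  exact WithTop.coe_le_coe.2 (le_top (a := (2 : ℕ∞)))

/-- Naturality of the exterior derivative on vector spaces, applied to `f` read in the charts at `x`
and `f x`. As `extDeriv` is local, the chart expression of the pullback may be replaced by its
formula near the point; the differentials of the charts then cancel by the chain rule. -/
theorem d_pullback {f : M → N} (hf : ContMDiff 𝓘(𝕜, E) 𝓘(𝕜, E') ∞ f)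
    {Ω : DForm 𝕜 E' N k} (hΩ : Ω.IsSmooth) :
    (DForm.pullback f Ω : DForm 𝕜 E M k).d = DForm.pullback f Ω.d := by
  have hfd : MDifferentiable 𝓘(𝕜, E) 𝓘(𝕜, E') f := hf.mdifferentiable (by simp)
  refine ext_at fun x => ?_
  rw [d_at, pullback_at, d_at]
  have hx := mem_chart_target E x
  have hz : f ((chartAt E x).symm (chartAt E x x)) ∈ (chartAt E' (f x)).source := by
    rw [(chartAt E x).left_inv (mem_chart_source E x)]; exact mem_chart_source E' (f x)
  have hev : (DForm.pullback f Ω : DForm 𝕜 E M k).localRep x =ᶠ[𝓝 (chartAt E x x)]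
      fun y => (Ω.localRep (f x) (chartAt E' (f x)
        (f ((chartAt E x).symm y)))).compContinuousLinearMap
        (fderiv 𝕜 (fun y => chartAt E' (f x) (f ((chartAt E x).symm y))) y) := by
    filter_upwards [eventually_mem_chart hf.continuous x (f x) hx hz] with y' hy'
    exact localRep_pullback hf Ω x (f x) hy'.1 hy'.2
  have hF := contDiffAt_inChart hf x (f x) hx hz
  rw [hev.extDeriv_eq, extDeriv_pullback (r := ∞)
    (f := fun y => chartAt E' (f x) (f ((chartAt E x).symm y)))
    ((hΩ.contDiffAt ((chartAt E' (f x)).map_source hz)).differentiableAt (by simp))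
    hF two_le_infty, comp_comp, comp_comp, ← tmap_eq_fderiv,
    ← tmap_comp rfl (hF.contMDiffAt.mdifferentiableAt (by simp))
      (mdifferentiableAt_chartAt (mem_chart_source E x)),
    ← tmap_comp rfl (mdifferentiableAt_chartAt (mem_chart_source E' (f x))) (hfd x),
    (chartAt E x).left_inv (mem_chart_source E x)]
  congr 1
  refine tmap_congr ?_
  filter_upwards [(chartAt E x).eventually_left_inverse (mem_chart_source E x)] with z hz'
  simp [hz']

end

end DForm

/-! ## Straightening submersions -/

section Straightening

variable {𝕜 : Type*} [RCLike 𝕜] {E V K : Type*}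
  [NormedAddCommGroup E] [NormedSpace 𝕜 E] [FiniteDimensional 𝕜 E]
  [NormedAddCommGroup V] [NormedSpace 𝕜 V] [FiniteDimensional 𝕜 V]
  [NormedAddCommGroup K] [NormedSpace 𝕜 K] [FiniteDimensional 𝕜 K]

/-- A surjective linear map is the first component of an isomorphism onto a product. -/
theorem exists_equiv_prod_of_surjective {L : E →L[𝕜] V} (hL : Function.Surjective L)
    (hK : Module.finrank 𝕜 V + Module.finrank 𝕜 K = Module.finrank 𝕜 E) :
    ∃ (A : E ≃L[𝕜] V × K) (B : E →L[𝕜] K), (A : E →L[𝕜] V × K) = L.prod B := by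
  have hker : Module.finrank 𝕜 (LinearMap.ker L.toLinearMap) = Module.finrank 𝕜 K := by
    have h1 := LinearMap.finrank_range_add_finrank_ker L.toLinearMap
    rw [LinearMap.range_eq_top.2 hL, finrank_top] at h1
    omega
  let κ := LinearEquiv.ofFinrankEq _ _ hker
  obtain ⟨P, hP⟩ := LinearMap.exists_leftInverse_of_injective
    (LinearMap.ker L.toLinearMap).subtype (Submodule.ker_subtype _)
  -- `B` is a projection onto the kernel of `L` followed by an identification of the kernel with
  -- `K`. So `(L, B)` is injective, and bijective by dimension.
  let B : E →ₗ[𝕜] K := κ.toLinearMap ∘ₗ P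
  have hinj : Function.Injective (L.toLinearMap.prod B) := by
    rw [← LinearMap.ker_eq_bot, LinearMap.ker_eq_bot']
    intro x hx
    have hx1 : L x = 0 := congrArg Prod.fst hx
    have hx2 : κ (P x) = 0 := congrArg Prod.snd hx
    have hPx : P x = ⟨x, hx1⟩ := LinearMap.congr_fun hP ⟨x, hx1⟩
    rw [LinearEquiv.map_eq_zero_iff, hPx] at hx2
    exact congrArg Subtype.val hx2
  let A := (LinearEquiv.ofInjectiveOfFinrankEq _ hinj
    (by rw [Module.finrank_prod, hK])).toContinuousLinearEquiv
  exact ⟨A, LinearMap.toContinuousLinearMap B, rfl⟩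

/-- The inverse function theorem for `x ↦ (f x, B x)`, where the linear map `B` completes the
differential of `f` at `a` to an isomorphism. -/
theorem exists_straightening {f : E → V} {O : Set E} (hO : IsOpen O) {a : E} (ha : a ∈ O)
    (hf : ContDiffOn 𝕜 ∞ f O) (hsurj : Function.Surjective (fderiv 𝕜 f a))
    (hK : Module.finrank 𝕜 V + Module.finrank 𝕜 K = Module.finrank 𝕜 E) :
    ∃ Φ : OpenPartialHomeomorph E (V × K), a ∈ Φ.source ∧ Φ.source ⊆ O ∧
      (∀ x, (Φ x).1 = f x) ∧ ContDiffOn 𝕜 ∞ Φ Φ.source ∧ ContDiffOn 𝕜 ∞ Φ.symm Φ.target := by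
  have : CompleteSpace E := FiniteDimensional.complete 𝕜 E
  obtain ⟨A, B, hAB⟩ := exists_equiv_prod_of_surjective hsurj hK
  let F : E → V × K := fun x => (f x, B x)
  have hF : ContDiffOn 𝕜 ∞ F O := hf.prodMk B.contDiff.contDiffOn
  have hFa : ContDiffAt 𝕜 ∞ F a := hF.contDiffAt (hO.mem_nhds ha)
  have hFd : HasFDerivAt F (A : E →L[𝕜] V × K) a := by
    rw [hAB]
    exact ((hf.contDiffAt (hO.mem_nhds ha)).differentiableAt (by simp)).hasFDerivAt.prodMk
      B.hasFDerivAt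
  let Φ₀ := hFa.toOpenPartialHomeomorph F hFd (by simp)
  -- The inverse function theorem gives smoothness of the inverse at one point; restricting to the
  -- open set where the differential is invertible gives it on the whole target.
  let U : Set E := O ∩ fderiv 𝕜 F ⁻¹' range ((↑) : (E ≃L[𝕜] V × K) → E →L[𝕜] V × K)
  have hU : IsOpen U := (hF.continuousOn_fderiv_of_isOpen hO (by simp)).isOpen_inter_preimage hO
    ContinuousLinearEquiv.isOpen
  have haU : a ∈ U := ⟨ha, A, hFd.fderiv.symm⟩
  refine ⟨Φ₀.restrOpen U hU, ⟨hFa.mem_toOpenPartialHomeomorph_source hFd (by simp), haU⟩,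
    fun x hx => hx.2.1, fun x => rfl, fun x hx => (hF.mono fun y hy => ?_) x hx, ?_⟩
  · exact hy.2.1
  · intro y hy
    have hx := (Φ₀.restrOpen U hU).map_target hy
    obtain ⟨A', hA'⟩ := hx.2.2
    refine ((Φ₀.restrOpen U hU).contDiffAt_symm (f₀' := A') hy ?_ ?_).contDiffWithinAt
    · rw [hA']
      exact ((hF.contDiffAt (hO.mem_nhds hx.2.1)).differentiableAt (by simp)).hasFDerivAt
    · exact hF.contDiffAt (hO.mem_nhds hx.2.1)

variable {G : Type*} [TopologicalSpace G] [ChartedSpace E G] [IsManifold 𝓘(𝕜, E) ∞ G]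

/-- A vector-valued map with surjective differential at `g` is the first component of a chart. -/
theorem exists_straightening_chart {f : G → V} {O : Set G} (hO : IsOpen O) {g : G} (hg : g ∈ O)
    (hf : ContMDiffOn 𝓘(𝕜, E) 𝓘(𝕜, V) ∞ f O) (hsurj : Function.Surjective (tmap 𝕜 E V f g))
    (hK : Module.finrank 𝕜 V + Module.finrank 𝕜 K = Module.finrank 𝕜 E) :
    ∃ e : OpenPartialHomeomorph G (V × K), g ∈ e.source ∧ e.source ⊆ O ∧
      (∀ x ∈ e.source, (e x).1 = f x) ∧ ContMDiffOn 𝓘(𝕜, E) 𝓘(𝕜, V × K) ∞ e e.source ∧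
      ContMDiffOn 𝓘(𝕜, V × K) 𝓘(𝕜, E) ∞ e.symm e.target := by
  let χ := chartAt E g
  have hgs : g ∈ χ.source := mem_chart_source E g
  have hgt : χ g ∈ χ.target := mem_chart_target E g
  have hsymm : χ.symm (χ g) = g := χ.left_inv hgs
  have hχs : ContMDiffOn 𝓘(𝕜, E) 𝓘(𝕜, E) ∞ χ.symm χ.target :=
    contMDiffOn_chart_symm (I := 𝓘(𝕜, E)) (x := g)
  have hχ : ContMDiffOn 𝓘(𝕜, E) 𝓘(𝕜, E) ∞ χ χ.source :=
    contMDiffOn_chart (I := 𝓘(𝕜, E)) (x := g)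
  have hO' : IsOpen (χ.target ∩ χ.symm ⁻¹' O) := χ.isOpen_inter_preimage_symm hO
  have hf' : ContDiffOn 𝕜 ∞ (f ∘ χ.symm) (χ.target ∩ χ.symm ⁻¹' O) := by
    rw [← contMDiffOn_iff_contDiffOn]
    exact hf.comp (hχs.mono inter_subset_left) fun y hy => hy.2
  have hs' : Function.Surjective (fderiv 𝕜 (f ∘ χ.symm) (χ g)) := by
    rw [← tmap_eq_fderiv, tmap_comp hsymm
      ((hf.contMDiffAt (hO.mem_nhds hg)).mdifferentiableAt (by simp))
      (mdifferentiableAt_chartAt_symm hgt)]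
    refine hsurj.comp fun w => ⟨tmap 𝕜 E E χ g w, tmap_chartAt_symm_tmap_chartAt hgs w⟩
  obtain ⟨Φ, h1, h2, h3, h4, h5⟩ := exists_straightening (K := K) hO'
    (a := χ g) ⟨hgt, by rw [mem_preimage, hsymm]; exact hg⟩ hf' hs' hK
  refine ⟨χ.trans Φ, ?_, ?_, ?_, ?_, ?_⟩
  · rw [OpenPartialHomeomorph.trans_source]
    exact ⟨hgs, h1⟩
  · intro x hx
    rw [OpenPartialHomeomorph.trans_source] at hx
    have := (h2 hx.2).2
    rwa [mem_preimage, χ.left_inv hx.1] at this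
  · intro x hx
    rw [OpenPartialHomeomorph.trans_source] at hx
    change (Φ (χ x)).1 = _
    rw [h3, Function.comp_apply, χ.left_inv hx.1]
  · rw [OpenPartialHomeomorph.trans_source]
    exact h4.contMDiffOn.comp (hχ.mono inter_subset_left) fun x hx => hx.2
  · rw [OpenPartialHomeomorph.trans_target]
    exact hχs.comp (h5.contMDiffOn.mono inter_subset_left) fun x hx => hx.2

end Straightening

/-! ## Smooth maps with local retractions -/

section Retractions

variable {𝕜 : Type*} [RCLike 𝕜] {E E' : Type*}
  [NormedAddCommGroup E] [NormedSpace 𝕜 E] [NormedAddCommGroup E'] [NormedSpace 𝕜 E']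
  {Z G : Type*} [TopologicalSpace Z] [ChartedSpace E Z] [TopologicalSpace G] [ChartedSpace E' G]

variable (𝕜 E E') in
/-- A smooth map with smooth local left inverses. -/
structure HasLocalRetractions (j : Z → G) : Prop where
  contMDiff : ContMDiff 𝓘(𝕜, E) 𝓘(𝕜, E') ∞ j
  exists_retraction : ∀ z, ∃ r : G → Z, ContMDiffAt 𝓘(𝕜, E') 𝓘(𝕜, E) ∞ r (j z) ∧
    ∀ᶠ z' in 𝓝 z, r (j z') = z'

variable (𝕜 E E') in
/-- A smooth map with smooth local inverses. -/
structure IsEtaleMap (p : Z → G) : Prop where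
  contMDiff : ContMDiff 𝓘(𝕜, E) 𝓘(𝕜, E') ∞ p
  exists_inverse : ∀ z, ∃ r : G → Z, ContMDiffAt 𝓘(𝕜, E') 𝓘(𝕜, E) ∞ r (p z) ∧
    (∀ᶠ z' in 𝓝 z, r (p z') = z') ∧ ∀ᶠ y in 𝓝 (p z), p (r y) = y

theorem IsEtaleMap.hasLocalRetractions {p : Z → G} (h : IsEtaleMap 𝕜 E E' p) :
    HasLocalRetractions 𝕜 E E' p :=
  ⟨h.contMDiff, fun z => let ⟨r, h1, h2, _⟩ := h.exists_inverse z; ⟨r, h1, h2⟩⟩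

theorem HasLocalRetractions.injective_tmap {j : Z → G} (h : HasLocalRetractions 𝕜 E E' j) (z : Z) :
    Function.Injective (tmap 𝕜 E E' j z) := by
  obtain ⟨r, h1, h2⟩ := h.exists_retraction z
  exact Function.LeftInverse.injective (g := tmap 𝕜 E' E r (j z))
    (tmap_leftInverse rfl ((h.contMDiff z).mdifferentiableAt (by simp))
      (h1.mdifferentiableAt (by simp)) h2)

theorem IsEtaleMap.bijective_tmap {p : Z → G} (h : IsEtaleMap 𝕜 E E' p) (z : Z) :
    Function.Bijective (tmap 𝕜 E E' p z) := by
  refine ⟨h.hasLocalRetractions.injective_tmap z, ?_⟩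
  obtain ⟨r, h1, h2, h3⟩ := h.exists_inverse z
  exact Function.RightInverse.surjective (g := tmap 𝕜 E' E r (p z))
    (tmap_leftInverse h2.self_of_nhds (h1.mdifferentiableAt (by simp))
      ((h.contMDiff z).mdifferentiableAt (by simp)) h3)

variable {F H : Type*} [NormedAddCommGroup F] [NormedSpace 𝕜 F] [TopologicalSpace H]
  {I : ModelWithCorners 𝕜 F H} {N : Type*} [TopologicalSpace N] [ChartedSpace H N]

/-- Near the point `f = r ∘ (j ∘ f)`; continuity of `f` keeps its values where `r` inverts `j`.
Smoothness of maps into `S`, into the restricted groupoid and into the pullback groupoid is tested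
in this way. -/
theorem HasLocalRetractions.contMDiffWithinAt {j : Z → G} (h : HasLocalRetractions 𝕜 E E' j)
    {f : N → Z} {s : Set N} {x : N} (hc : ContinuousWithinAt f s x)
    (hf : ContMDiffWithinAt I 𝓘(𝕜, E') ∞ (fun y => j (f y)) s x) :
    ContMDiffWithinAt I 𝓘(𝕜, E) ∞ f s x := by
  obtain ⟨r, h1, h2⟩ := h.exists_retraction (f x)
  refine (h1.comp_contMDiffWithinAt x hf).congr_of_eventuallyEq ?_ h2.self_of_nhds.symm
  filter_upwards [hc.eventually h2] with y hy using hy.symm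

theorem HasLocalRetractions.contMDiffOn {j : Z → G} (h : HasLocalRetractions 𝕜 E E' j)
    {f : N → Z} {s : Set N} (hc : ContinuousOn f s)
    (hf : ContMDiffOn I 𝓘(𝕜, E') ∞ (fun y => j (f y)) s) :
    ContMDiffOn I 𝓘(𝕜, E) ∞ f s :=
  fun x hx => h.contMDiffWithinAt (hc x hx) (hf x hx)

theorem HasLocalRetractions.contMDiff_of_comp {j : Z → G} (h : HasLocalRetractions 𝕜 E E' j)
    {f : N → Z} (hc : Continuous f) (hf : ContMDiff I 𝓘(𝕜, E') ∞ (fun y => j (f y))) :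
    ContMDiff I 𝓘(𝕜, E) ∞ f := by
  rw [← contMDiffOn_univ] at hf ⊢
  exact h.contMDiffOn hc.continuousOn hf

end Retractions

/-! ## Manifold structures induced by maps into a manifold -/

section InducedStructures

variable {𝕜 : Type*} [RCLike 𝕜] {E E' : Type*}
  [NormedAddCommGroup E] [NormedSpace 𝕜 E] [NormedAddCommGroup E'] [NormedSpace 𝕜 E']
  {Z G : Type*} [TopologicalSpace Z] [TopologicalSpace G] [ChartedSpace E' G]

variable (𝕜 E E') in
/-- A chart of `Z` whose inverse is smooth as a map to `G`, and which extends to a smooth map on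
an open subset of `G`. -/
structure AdaptedChart (j : Z → G) where
  chart : OpenPartialHomeomorph Z E
  extension : G → E
  domain : Set G
  isOpen_domain : IsOpen domain
  mapsTo : ∀ z ∈ chart.source, j z ∈ domain
  extension_eq : ∀ z ∈ chart.source, extension (j z) = chart z
  contMDiffOn_extension : ContMDiffOn 𝓘(𝕜, E') 𝓘(𝕜, E) ∞ extension domain
  contMDiffOn_symm : ContMDiffOn 𝓘(𝕜, E) 𝓘(𝕜, E') ∞ (fun y => j (chart.symm y)) chart.target

/-- The charted space structure given by adapted charts. -/
@[reducible]
def chartedSpaceOfAdaptedCharts {j : Z → G} (C : Z → AdaptedChart 𝕜 E E' j)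
    (hC : ∀ z, z ∈ (C z).chart.source) : ChartedSpace E Z where
  atlas := range fun z => (C z).chart
  chartAt z := (C z).chart
  mem_chart_source := hC
  chart_mem_atlas := mem_range_self

variable {j : Z → G} (C : Z → AdaptedChart 𝕜 E E' j) (hC : ∀ z, z ∈ (C z).chart.source)

/-- A transition map is the smooth extension of one chart composed with the inverse of another as a
map to `G`, so compatibility of adapted charts is automatic. -/
theorem isManifold_ofAdaptedCharts :
    letI := chartedSpaceOfAdaptedCharts C hC
    IsManifold 𝓘(𝕜, E) ∞ Z := by
  let := chartedSpaceOfAdaptedCharts C hC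
  refine isManifold_of_contDiffOn _ _ _ ?_
  rintro _ _ ⟨z, rfl⟩ ⟨z', rfl⟩
  simp only [modelWithCornersSelf_coe, modelWithCornersSelf_coe_symm, Function.comp_id,
    Function.id_comp, preimage_id, range_id, inter_univ]
  rw [← contMDiffOn_iff_contDiffOn]
  have h1 : ((C z).chart.symm.trans (C z').chart).source ⊆ (C z).chart.target :=
    fun y hy => by
      rw [OpenPartialHomeomorph.trans_source] at hy; exact hy.1
  have h2 : ∀ y ∈ ((C z).chart.symm.trans (C z').chart).source,
      (C z).chart.symm y ∈ (C z').chart.source := fun y hy => by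
    rw [OpenPartialHomeomorph.trans_source] at hy; exact hy.2
  refine ((C z').contMDiffOn_extension.comp ((C z).contMDiffOn_symm.mono h1)
    fun y hy => (C z').mapsTo _ (h2 y hy)).congr fun y hy => ?_
  exact ((C z').extension_eq _ (h2 y hy)).symm

theorem hasLocalRetractions_ofAdaptedCharts :
    letI := chartedSpaceOfAdaptedCharts C hC
    HasLocalRetractions 𝕜 E E' j := by
  let := chartedSpaceOfAdaptedCharts C hC
  have : IsManifold 𝓘(𝕜, E) ∞ Z := isManifold_ofAdaptedCharts C hC
  refine ⟨fun z => ?_, fun z => ⟨fun g => (C z).chart.symm ((C z).extension g), ?_, ?_⟩⟩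
  · have h1 : ContMDiffAt 𝓘(𝕜, E) 𝓘(𝕜, E) ∞ (C z).chart z :=
      (contMDiffOn_chart (I := 𝓘(𝕜, E)) (x := z)).contMDiffAt
        ((C z).chart.open_source.mem_nhds (hC z))
    have h2 := ((C z).contMDiffOn_symm.contMDiffAt
      ((C z).chart.open_target.mem_nhds ((C z).chart.map_source (hC z)))).comp z h1
    refine h2.congr_of_eventuallyEq ?_
    filter_upwards [(C z).chart.eventually_left_inverse (hC z)] with z' hz'
    simp [hz']
  · have h1 : ContMDiffAt 𝓘(𝕜, E') 𝓘(𝕜, E) ∞ (C z).extension (j z) :=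
      (C z).contMDiffOn_extension.contMDiffAt
        ((C z).isOpen_domain.mem_nhds ((C z).mapsTo z (hC z)))
    have h2 : ContMDiffAt 𝓘(𝕜, E) 𝓘(𝕜, E) ∞ (C z).chart.symm ((C z).extension (j z)) := by
      rw [(C z).extension_eq z (hC z)]
      exact (contMDiffOn_chart_symm (I := 𝓘(𝕜, E)) (x := z)).contMDiffAt
        ((C z).chart.open_target.mem_nhds ((C z).chart.map_source (hC z)))
    exact h2.comp (j z) h1
  · filter_upwards [(C z).chart.open_source.mem_nhds (hC z)] with z' hz'
    rw [(C z).extension_eq z' hz', (C z).chart.left_inv hz']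

variable [IsManifold 𝓘(𝕜, E') ∞ G]

/-- The adapted chart of a local homeomorphism. -/
noncomputable def adaptedChartOfLocalHomeomorph {p : Z → G} (hp : IsLocalHomeomorph p) (z : Z) :
    AdaptedChart 𝕜 E' E' p where
  chart := (Classical.choose (hp z)).trans (chartAt E' (p z))
  extension := chartAt E' (p z)
  domain := (chartAt E' (p z)).source
  isOpen_domain := (chartAt E' (p z)).open_source
  mapsTo z' hz' := by
    rw [OpenPartialHomeomorph.trans_source, (Classical.choose_spec (hp z)).2.symm] at hz'
    exact hz'.2
  extension_eq z' hz' := by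
    rw [OpenPartialHomeomorph.coe_trans, ← (Classical.choose_spec (hp z)).2]; rfl
  contMDiffOn_extension := contMDiffOn_chart (I := 𝓘(𝕜, E')) (x := p z)
  contMDiffOn_symm := by
    rw [OpenPartialHomeomorph.trans_target]
    refine ((contMDiffOn_chart_symm (I := 𝓘(𝕜, E')) (x := p z)).mono inter_subset_left).congr
      fun y hy => ?_
    have := (Classical.choose (hp z)).right_inv hy.2
    rw [← (Classical.choose_spec (hp z)).2] at this
    exact this

/-- The charts are those of `G` transported by local inverses of `p`. A local inverse of `p` is
smooth because it is continuous and its composite with `p` is locally the identity. -/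
theorem exists_manifold_of_isLocalHomeomorph {p : Z → G} (hp : IsLocalHomeomorph p) :
    ∃ (_ : ChartedSpace E' Z) (_ : IsManifold 𝓘(𝕜, E') ∞ Z), IsEtaleMap 𝕜 E' E' p := by
  have hC : ∀ z, z ∈ (adaptedChartOfLocalHomeomorph (𝕜 := 𝕜) (E' := E') hp z).chart.source := by
    intro z
    change z ∈ ((Classical.choose (hp z)).trans (chartAt E' (p z))).source
    rw [OpenPartialHomeomorph.trans_source, ← (Classical.choose_spec (hp z)).2]
    exact ⟨(Classical.choose_spec (hp z)).1, mem_chart_source E' (p z)⟩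
  let := chartedSpaceOfAdaptedCharts _ hC
  have h1 : HasLocalRetractions 𝕜 E' E' p := hasLocalRetractions_ofAdaptedCharts _ hC
  refine ⟨_, isManifold_ofAdaptedCharts _ hC, h1.contMDiff, fun z => ?_⟩
  obtain ⟨e, hz, he⟩ := hp z
  subst he
  refine ⟨e.symm, ?_, e.eventually_left_inverse hz,
    e.eventually_right_inverse (e.map_source hz)⟩
  rw [← contMDiffWithinAt_univ]
  refine h1.contMDiffWithinAt (e.continuousAt_symm (e.map_source hz)).continuousWithinAt ?_
  rw [contMDiffWithinAt_univ]
  refine contMDiffAt_id.congr_of_eventuallyEq ?_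
  exact e.eventually_right_inverse (e.map_source hz)

end InducedStructures

/-! ## Embedded submanifolds -/

section Submanifolds

variable {𝕜 : Type*} [RCLike 𝕜] {E : Type u} {V : Type u} {K : Type*}
  [NormedAddCommGroup E] [NormedSpace 𝕜 E] [FiniteDimensional 𝕜 E]
  [NormedAddCommGroup V] [NormedSpace 𝕜 V] [FiniteDimensional 𝕜 V]
  [NormedAddCommGroup K] [NormedSpace 𝕜 K] [FiniteDimensional 𝕜 K]
  {G : Type*} [TopologicalSpace G] [ChartedSpace E G]

open Classical in
/-- The adapted chart of a subset `{g // Q g}` given by a chart `e` of the ambient manifold in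
which the subset is `{0} × K`. -/
noncomputable def adaptedChartOfSlice {Q : G → Prop} (z : {g // Q g})
    (e : OpenPartialHomeomorph G (V × K)) (he : ContMDiffOn 𝓘(𝕜, E) 𝓘(𝕜, V × K) ∞ e e.source)
    (he' : ContMDiffOn 𝓘(𝕜, V × K) 𝓘(𝕜, E) ∞ e.symm e.target)
    (hQ : ∀ x ∈ e.source, Q x ↔ (e x).1 = 0) :
    AdaptedChart 𝕜 K E (Subtype.val : {g // Q g} → G) where
  chart :=
    { toFun := fun x => (e x.1).2
      -- The value `z` is a default, never taken on the chart target.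
      invFun := fun k => if h : Q (e.symm (0, k)) then ⟨e.symm (0, k), h⟩ else z
      source := Subtype.val ⁻¹' e.source
      target := {k | ((0 : V), k) ∈ e.target}
      map_source' := fun x hx => by
        have h1 : e x.1 = (0, (e x.1).2) := Prod.ext ((hQ x.1 hx).1 x.2) rfl
        have h2 := e.map_source hx
        rw [h1] at h2
        exact h2
      map_target' := fun k hk => by
        have h1 := e.map_target hk
        have h2 : Q (e.symm (0, k)) := (hQ _ h1).2 (by rw [e.right_inv hk])
        simpa [dif_pos h2] using h1
      left_inv' := fun x hx => by
        have h1 : (0, (e x.1).2) = e x.1 := Prod.ext ((hQ x.1 hx).1 x.2).symm rfl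
        have h2 : e.symm (0, (e x.1).2) = x.1 := by rw [h1, e.left_inv hx]
        have h3 : Q (e.symm (0, (e x.1).2)) := by rw [h2]; exact x.2
        apply Subtype.ext
        rw [dif_pos h3]
        exact h2
      right_inv' := fun k hk => by
        have h1 := e.map_target hk
        have h2 : Q (e.symm (0, k)) := (hQ _ h1).2 (by rw [e.right_inv hk])
        simp [dif_pos h2, e.right_inv hk]
      open_source := e.open_source.preimage continuous_subtype_val
      open_target := e.open_target.preimage (by fun_prop)
      continuousOn_toFun := continuous_snd.comp_continuousOn
        (e.continuousOn.comp continuous_subtype_val.continuousOn fun x hx => hx)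
      continuousOn_invFun := by
        refine (Topology.IsInducing.mk rfl :
          Topology.IsInducing (Subtype.val : {g // Q g} → G)).continuousOn_iff.2 ?_
        refine (e.continuousOn_symm.comp (Continuous.continuousOn (by fun_prop :
          Continuous fun k : K => ((0 : V), k))) fun k hk => hk).congr fun k hk => ?_
        have h2 : Q (e.symm (0, k)) := (hQ _ (e.map_target hk)).2 (by rw [e.right_inv hk])
        simp [dif_pos h2] }
  extension := fun g => (e g).2
  domain := e.source
  isOpen_domain := e.open_source
  mapsTo := fun _ hx => hx
  extension_eq := fun _ _ => rfl
  contMDiffOn_extension := contDiff_snd.contMDiff.comp_contMDiffOn he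
  contMDiffOn_symm := by
    refine (he'.comp (ContDiff.contMDiff (by fun_prop :
      ContDiff 𝕜 ∞ fun k : K => ((0 : V), k))).contMDiffOn fun k hk => hk).congr fun k hk => ?_
    have h2 : Q (e.symm (0, k)) := (hQ _ (e.map_target hk)).2 (by rw [e.right_inv hk])
    simp [dif_pos h2]

/-- A subset that is locally a coordinate subspace in suitable charts is an embedded
submanifold. -/
theorem exists_embedded_submanifold [IsManifold 𝓘(𝕜, E) ∞ G] {Q : G → Prop}
    (hQ : ∀ g, Q g → Module.finrank 𝕜 V + Module.finrank 𝕜 K = Module.finrank 𝕜 E ∧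
      ∃ e : OpenPartialHomeomorph G (V × K), g ∈ e.source ∧
      ContMDiffOn 𝓘(𝕜, E) 𝓘(𝕜, V × K) ∞ e e.source ∧
      ContMDiffOn 𝓘(𝕜, V × K) 𝓘(𝕜, E) ∞ e.symm e.target ∧
      ∀ x ∈ e.source, Q x ↔ (e x).1 = 0) :
    ∃ (_ : ChartedSpace K {g // Q g}) (_ : IsManifold 𝓘(𝕜, K) ∞ {g // Q g}),
      Manifold.IsSmoothEmbedding 𝓘(𝕜, K) 𝓘(𝕜, E) ∞ (Subtype.val : {g // Q g} → G) ∧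
      HasLocalRetractions 𝕜 K E (Subtype.val : {g // Q g} → G) := by
  choose hdim e hg he he' hs using hQ
  let C : ∀ z : {g // Q g}, AdaptedChart 𝕜 K E (Subtype.val : {g // Q g} → G) := fun z =>
    adaptedChartOfSlice z (e z.1 z.2) (he z.1 z.2) (he' z.1 z.2) (hs z.1 z.2)
  have hC : ∀ z, z ∈ (C z).chart.source := fun z => hg z.1 z.2
  let := chartedSpaceOfAdaptedCharts C hC
  have hm : IsManifold 𝓘(𝕜, K) ∞ {g // Q g} := isManifold_ofAdaptedCharts C hC
  refine ⟨_, hm, ⟨⟨V, inferInstance, inferInstance, fun z => ?_⟩, .subtypeVal⟩,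
    hasLocalRetractions_ofAdaptedCharts C hC⟩
  -- The ambient chart must take values in the model space `E`, so `e` is followed by a linear
  -- identification of `V × K` with `E`.
  let A : (V × K) ≃L[𝕜] E := ContinuousLinearEquiv.ofFinrankEq
    (by rw [Module.finrank_prod, hdim z.1 z.2])
  let ψ := (e z.1 z.2).transHomeomorph A.toHomeomorph
  -- The factors are exchanged because the subset is `{0} × K` in the chart, whereas the normal form
  -- of an immersion is `k ↦ (k, 0)`.
  refine Manifold.IsImmersionAtOfComplement.mk_of_charts
    ((ContinuousLinearEquiv.prodComm 𝕜 K V).trans A) (C z).chart ψ (hC z) (hg z.1 z.2)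
    (StructureGroupoid.chart_mem_maximalAtlas _ z) ?_ (fun x hx => hx) ?_
  · refine ψ.mem_maximalAtlas_of_contMDiffOn ?_ ?_
    · exact A.contDiff.contMDiff.comp_contMDiffOn (he z.1 z.2)
    · exact (he' z.1 z.2).comp A.symm.contDiff.contMDiff.contMDiffOn fun x hx => hx
  · intro k hk
    have hk' : ((0 : V), k) ∈ (e z.1 z.2).target := by
      have hk₁ : k ∈ (C z).chart.target := by simpa using hk
      exact hk₁
    have h2 : Q ((e z.1 z.2).symm (0, k)) :=
      (hs z.1 z.2 _ ((e z.1 z.2).map_target hk')).2 (by rw [(e z.1 z.2).right_inv hk'])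
    have h3 : ((C z).chart.symm k).1 = (e z.1 z.2).symm (0, k) := by
      exact congrArg Subtype.val (dif_pos h2)
    change A (e z.1 z.2 ((C z).chart.symm k).1) = A (0, k)
    rw [h3, (e z.1 z.2).right_inv hk']

end Submanifolds

/-! ### Immersions: local retractions and local equations -/

section SliceFunctions

variable {𝕜 : Type*} [RCLike 𝕜] {E E' F : Type*}
  [NormedAddCommGroup E] [NormedSpace 𝕜 E] [NormedAddCommGroup E'] [NormedSpace 𝕜 E']
  [NormedAddCommGroup F] [NormedSpace 𝕜 F]
  {Z M : Type*} [TopologicalSpace Z] [ChartedSpace E Z]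
  [TopologicalSpace M] [ChartedSpace E' M]

theorem tmap_continuousLinearMap (L : E →L[𝕜] E') (x : E) : tmap 𝕜 E E' L x = L :=
  tmap_eq_fderiv.trans L.fderiv

/-- In immersion charts `j` is `v ↦ (v, 0)`; projecting to the first factor and applying the inverse
chart of `Z` is a retraction. -/
theorem Manifold.IsImmersionOfComplement.hasLocalRetractions [IsManifold 𝓘(𝕜, E) ∞ Z]
    [IsManifold 𝓘(𝕜, E') ∞ M] {j : Z → M}
    (h : Manifold.IsImmersionOfComplement F 𝓘(𝕜, E) 𝓘(𝕜, E') ∞ j) :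
    HasLocalRetractions 𝕜 E E' j := by
  refine ⟨h.contMDiff, fun z => ?_⟩
  have hz := h z
  have hev : ∀ᶠ z' in 𝓝 z, (hz.equiv.symm (hz.codChart (j z'))).1 = hz.domChart z' := by
    filter_upwards [hz.domChart.open_source.mem_nhds hz.mem_domChart_source] with z' hz'
    have hmem : hz.domChart z' ∈ (hz.domChart.extend 𝓘(𝕜, E)).target := by
      simpa using hz.domChart.map_source hz'
    have := hz.writtenInCharts hmem
    have hw : hz.codChart (j z') = hz.equiv (hz.domChart z', 0) := by
      simpa [OpenPartialHomeomorph.extend, hz.domChart.left_inv hz'] using this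
    rw [hw]; simp
  refine ⟨fun y => hz.domChart.symm (hz.equiv.symm (hz.codChart y)).1, ?_, ?_⟩
  · have h1 : ContMDiffAt 𝓘(𝕜, E') 𝓘(𝕜, E') ∞ hz.codChart (j z) :=
      contMDiffAt_of_mem_maximalAtlas hz.codChart_mem_maximalAtlas hz.mem_codChart_source
    have h2 : ContMDiffAt 𝓘(𝕜, E') 𝓘(𝕜, E) ∞
        (fun y => (hz.equiv.symm (hz.codChart y)).1) (j z) :=
      ((contDiff_fst.comp hz.equiv.symm.contDiff).contMDiff.contMDiffAt).comp (j z) h1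
    refine ContMDiffAt.comp (j z) ?_ h2
    rw [hev.self_of_nhds]
    exact contMDiffAt_symm_of_mem_maximalAtlas hz.domChart_mem_maximalAtlas
      (hz.domChart.map_source hz.mem_domChart_source)
  · filter_upwards [hev, hz.domChart.eventually_left_inverse hz.mem_domChart_source] with z' h1 h2
    rw [h1, h2]

/-- An embedded submanifold is locally the zero set of a submersion. -/
theorem exists_slice_function [IsManifold 𝓘(𝕜, E') ∞ M] {S : Set M} [ChartedSpace E S] {x : S}
    (h : Manifold.IsImmersionAtOfComplement F 𝓘(𝕜, E) 𝓘(𝕜, E') ∞ (Subtype.val : S → M) x) :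
    ∃ (O : Set M) (f : M → F), IsOpen O ∧ x.1 ∈ O ∧ ContMDiffOn 𝓘(𝕜, E') 𝓘(𝕜, F) ∞ f O ∧
      (∀ y ∈ O, y ∈ S ↔ f y = 0) ∧ Function.Surjective (tmap 𝕜 E' F f x.1) := by
  have hw : ∀ z ∈ h.domChart.source, h.codChart z.1 = h.equiv (h.domChart z, 0) := by
    intro z hz
    have hmem : h.domChart z ∈ (h.domChart.extend 𝓘(𝕜, E)).target := by
      simpa using h.domChart.map_source hz
    have := h.writtenInCharts hmem
    simpa [OpenPartialHomeomorph.extend, h.domChart.left_inv hz] using this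
  -- `S` carries the subspace topology, so the chart domain is cut out of `S` by an open set `W` of
  -- `M`. Inside `W` no other part of `S` comes near `x`, and the second coordinate vanishes exactly
  -- on `S`.
  obtain ⟨W, hW, hWs⟩ := isOpen_induced_iff.1 h.domChart.open_source
  let q : M → E × F := fun y => h.equiv.symm (h.codChart y)
  have hq : ContinuousOn q h.codChart.source :=
    h.equiv.symm.continuous.comp_continuousOn h.codChart.continuousOn
  have hsm : ContMDiffOn 𝓘(𝕜, E') 𝓘(𝕜, F) ∞ (fun y => (q y).2) h.codChart.source :=
    ((contDiff_snd.comp h.equiv.symm.contDiff).contMDiff).comp_contMDiffOn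
      (contMDiffOn_of_mem_maximalAtlas h.codChart_mem_maximalAtlas)
  have hxW : x.1 ∈ W := by
    have : x ∈ Subtype.val ⁻¹' W := by rw [hWs]; exact h.mem_domChart_source
    exact this
  refine ⟨(h.codChart.source ∩ q ⁻¹' (Prod.fst ⁻¹' h.domChart.target)) ∩ W, fun y => (q y).2,
    (hq.isOpen_inter_preimage h.codChart.open_source
      (h.domChart.open_target.preimage continuous_fst)).inter hW,
    ⟨⟨h.mem_codChart_source, ?_⟩, hxW⟩, hsm.mono fun y hy => hy.1.1, fun y hy => ⟨fun hyS => ?_,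
      fun hy0 => ?_⟩, ?_⟩
  · have := hw x h.mem_domChart_source
    simp only [mem_preimage, q, this, ContinuousLinearEquiv.symm_apply_apply]
    exact h.domChart.map_source h.mem_domChart_source
  · have hz : (⟨y, hyS⟩ : S) ∈ h.domChart.source := by rw [← hWs]; exact hy.2
    simp [q, hw _ hz]
  · have hu : (q y).1 ∈ h.domChart.target := hy.1.2
    have hz := h.domChart.map_target hu
    have h1 := hw _ hz
    rw [h.domChart.right_inv hu] at h1
    have h2 : h.codChart y = h.equiv ((q y).1, 0) := by
      have h3 : ((q y).1, (0 : F)) = q y := Prod.ext rfl hy0.symm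
      rw [h3]; simp [q]
    have h4 := h.codChart.injOn (h.source_subset_preimage_source hz) hy.1.1 (h1.trans h2.symm)
    rw [← h4]; exact Subtype.coe_prop _
  · have hc : MDifferentiableAt 𝓘(𝕜, E') 𝓘(𝕜, E') h.codChart x.1 :=
      (contMDiffAt_of_mem_maximalAtlas h.codChart_mem_maximalAtlas
        h.mem_codChart_source).mdifferentiableAt (by simp)
    have hc' : MDifferentiableAt 𝓘(𝕜, E') 𝓘(𝕜, E') h.codChart.symm (h.codChart x.1) :=
      (contMDiffAt_symm_of_mem_maximalAtlas h.codChart_mem_maximalAtlas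
        (h.codChart.map_source h.mem_codChart_source)).mdifferentiableAt (by simp)
    let L : E' →L[𝕜] F := (ContinuousLinearMap.snd 𝕜 E F).comp (h.equiv.symm : E' →L[𝕜] E × F)
    have hL : tmap 𝕜 E' F (L ∘ h.codChart) x.1 = L.comp (tmap 𝕜 E' E' h.codChart x.1) := by
      rw [tmap_comp rfl L.mdifferentiableAt hc, tmap_continuousLinearMap]
    change Function.Surjective (tmap 𝕜 E' F (L ∘ h.codChart) x.1)
    rw [hL]
    intro w
    refine ⟨tmap 𝕜 E' E' h.codChart.symm (h.codChart x.1) (h.equiv (0, w)), ?_⟩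
    rw [ContinuousLinearMap.comp_apply, tmap_leftInverse
      (h.codChart.left_inv h.mem_codChart_source) hc' hc
      (h.codChart.eventually_right_inverse (h.codChart.map_source h.mem_codChart_source))]
    simp [L]

end SliceFunctions

/-! ### Partial differentials on a product -/

section PartialTangentMaps

variable {𝕜 : Type*} [RCLike 𝕜] {E K E' : Type*}
  [NormedAddCommGroup E] [NormedSpace 𝕜 E] [NormedAddCommGroup E'] [NormedSpace 𝕜 E']
  [NormedAddCommGroup K] [NormedSpace 𝕜 K]
  {N : Type*} [TopologicalSpace N] [ChartedSpace E' N]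

theorem tmap_apply_inl {f : K × E → N} {k : K} {e : E}
    (hf : MDifferentiableAt 𝓘(𝕜, K × E) 𝓘(𝕜, E') f (k, e)) (v : K) :
    tmap 𝕜 (K × E) E' f (k, e) (v, 0) = tmap 𝕜 K E' (fun k' => f (k', e)) k v := by
  have h1 : HasFDerivAt (fun k' : K => (k', e)) (ContinuousLinearMap.inl 𝕜 K E) k :=
    (hasFDerivAt_id k).prodMk (hasFDerivAt_const e k)
  rw [tmap_comp_apply (g := f) (f := fun k' : K => (k', e)) rfl hf
    h1.differentiableAt.mdifferentiableAt, tmap_eq_fderiv, h1.fderiv]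
  rfl

theorem tmap_apply_inr {f : K × E → N} {k : K} {e : E}
    (hf : MDifferentiableAt 𝓘(𝕜, K × E) 𝓘(𝕜, E') f (k, e)) (v : E) :
    tmap 𝕜 (K × E) E' f (k, e) (0, v) = tmap 𝕜 E E' (fun e' => f (k, e')) e v := by
  have h1 : HasFDerivAt (fun e' : E => (k, e')) (ContinuousLinearMap.inr 𝕜 K E) e :=
    (hasFDerivAt_const k e).prodMk (hasFDerivAt_id e)
  rw [tmap_comp_apply (g := f) (f := fun e' : E => (k, e')) rfl hf
    h1.differentiableAt.mdifferentiableAt, tmap_eq_fderiv, h1.fderiv]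
  rfl

end PartialTangentMaps

/-! ### Lie groupoids: right translation and multiplicative forms -/

namespace Grpd

variable {𝕜 : Type v} [RCLike 𝕜] {E₁ E₀ : Type u}
  [NormedAddCommGroup E₁] [NormedSpace 𝕜 E₁] [NormedAddCommGroup E₀] [NormedSpace 𝕜 E₀]
  {G M : Type u} [TopologicalSpace G] [ChartedSpace E₁ G] [TopologicalSpace M] [ChartedSpace E₀ M]
  {𝒢 : Grpd G M}

namespace IsLie

theorem contMDiff_src (hL : 𝒢.IsLie 𝕜 E₁ E₀) : ContMDiff 𝓘(𝕜, E₁) 𝓘(𝕜, E₀) ∞ 𝒢.src :=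
  hL.src_submersion.1

theorem contMDiff_tgt (hL : 𝒢.IsLie 𝕜 E₁ E₀) : ContMDiff 𝓘(𝕜, E₁) 𝓘(𝕜, E₀) ∞ 𝒢.tgt :=
  hL.tgt_submersion.1

theorem surjective_tmap_src (hL : 𝒢.IsLie 𝕜 E₁ E₀) (g : G) :
    Function.Surjective (tmap 𝕜 E₁ E₀ 𝒢.src g) :=
  hL.src_submersion.2 g

theorem surjective_tmap_tgt (hL : 𝒢.IsLie 𝕜 E₁ E₀) (g : G) :
    Function.Surjective (tmap 𝕜 E₁ E₀ 𝒢.tgt g) :=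
  hL.tgt_submersion.2 g

theorem mdifferentiableAt_src (hL : 𝒢.IsLie 𝕜 E₁ E₀) (g : G) :
    MDifferentiableAt 𝓘(𝕜, E₁) 𝓘(𝕜, E₀) 𝒢.src g :=
  (hL.contMDiff_src g).mdifferentiableAt (by simp)

theorem mdifferentiableAt_tgt (hL : 𝒢.IsLie 𝕜 E₁ E₀) (g : G) :
    MDifferentiableAt 𝓘(𝕜, E₁) 𝓘(𝕜, E₀) 𝒢.tgt g :=
  (hL.contMDiff_tgt g).mdifferentiableAt (by simp)

theorem mdifferentiableAt_unit (hL : 𝒢.IsLie 𝕜 E₁ E₀) (x : M) :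
    MDifferentiableAt 𝓘(𝕜, E₀) 𝓘(𝕜, E₁) 𝒢.unit x :=
  (hL.unit_smooth x).mdifferentiableAt (by simp)

theorem tmap_tgt_unit (hL : 𝒢.IsLie 𝕜 E₁ E₀) (x : M) (w : E₀) :
    tmap 𝕜 E₁ E₀ 𝒢.tgt (𝒢.unit x) (tmap 𝕜 E₀ E₁ 𝒢.unit x w) = w :=
  tmap_leftInverse rfl (hL.mdifferentiableAt_unit x) (hL.mdifferentiableAt_tgt _)
    (Eventually.of_forall 𝒢.tgt_unit) w

theorem contMDiffOn_mul (hL : 𝒢.IsLie 𝕜 E₁ E₀) {F H : Type*} [NormedAddCommGroup F]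
    [NormedSpace 𝕜 F] [TopologicalSpace H]
    {I : ModelWithCorners 𝕜 F H} {N : Type*} [TopologicalSpace N] [ChartedSpace H N]
    {a b : N → G} {s : Set N} (ha : ContMDiffOn I 𝓘(𝕜, E₁) ∞ a s)
    (hb : ContMDiffOn I 𝓘(𝕜, E₁) ∞ b s) (hab : ∀ n ∈ s, 𝒢.src (a n) = 𝒢.tgt (b n)) :
    ContMDiffOn I 𝓘(𝕜, E₁) ∞ (fun n => 𝒢.mul (a n) (b n)) s :=
  hL.mul_smooth.comp (ha.prodMk hb) hab

theorem contMDiff_mul (hL : 𝒢.IsLie 𝕜 E₁ E₀) {F H : Type*} [NormedAddCommGroup F]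
    [NormedSpace 𝕜 F] [TopologicalSpace H]
    {I : ModelWithCorners 𝕜 F H} {N : Type*} [TopologicalSpace N] [ChartedSpace H N]
    {a b : N → G} (ha : ContMDiff I 𝓘(𝕜, E₁) ∞ a)
    (hb : ContMDiff I 𝓘(𝕜, E₁) ∞ b) (hab : ∀ n, 𝒢.src (a n) = 𝒢.tgt (b n)) :
    ContMDiff I 𝓘(𝕜, E₁) ∞ (fun n => 𝒢.mul (a n) (b n)) := by
  rw [← contMDiffOn_univ] at *
  exact hL.contMDiffOn_mul ha hb fun n _ => hab n

end IsLie

variable [FiniteDimensional 𝕜 E₁] [FiniteDimensional 𝕜 E₀] [IsManifold 𝓘(𝕜, E₁) ∞ G]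
  [IsManifold 𝓘(𝕜, E₀) ∞ M]

/-- A family of curves in the source fibres, through the units. -/
theorem IsLie.exists_source_fibre_family (hL : 𝒢.IsLie 𝕜 E₁ E₀) (x : M) :
    ∃ (K : Type u) (_ : NormedAddCommGroup K) (_ : NormedSpace 𝕜 K) (_ : FiniteDimensional 𝕜 K)
      (κ : E₁ →L[𝕜] K) (c : K × M → G) (O : Set (K × M)), IsOpen O ∧ (0, x) ∈ O ∧
      ContMDiffOn (𝓘(𝕜, K).prod 𝓘(𝕜, E₀)) 𝓘(𝕜, E₁) ∞ c O ∧
      (∀ q ∈ O, 𝒢.src (c q) = q.2) ∧ (∀ y, (0, y) ∈ O → c (0, y) = 𝒢.unit y) ∧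
      ∀ a, tmap 𝕜 E₁ E₀ 𝒢.src (𝒢.unit x) a = 0 →
        tmap 𝕜 K E₁ (fun k => c (k, x)) 0 (κ a) = a := by
  let χ := chartAt E₀ x
  have hxs : x ∈ χ.source := mem_chart_source E₀ x
  let f : G → E₀ := fun g => χ (𝒢.src g)
  let O₁ : Set G := 𝒢.src ⁻¹' χ.source
  have hO₁ : IsOpen O₁ := χ.open_source.preimage hL.contMDiff_src.continuous
  have hxO₁ : 𝒢.unit x ∈ O₁ := by
    change 𝒢.src (𝒢.unit x) ∈ χ.source; rw [𝒢.src_unit]; exact hxs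
  have hf : ContMDiffOn 𝓘(𝕜, E₁) 𝓘(𝕜, E₀) ∞ f O₁ :=
    (contMDiffOn_chart (I := 𝓘(𝕜, E₀)) (x := x)).comp hL.contMDiff_src.contMDiffOn
      fun g hg => hg
  have hfd : ∀ a, tmap 𝕜 E₁ E₀ f (𝒢.unit x) a =
      tmap 𝕜 E₀ E₀ χ x (tmap 𝕜 E₁ E₀ 𝒢.src (𝒢.unit x) a) := fun a =>
    tmap_comp_apply (𝒢.src_unit x) (mdifferentiableAt_chartAt hxs) (hL.mdifferentiableAt_src _) a
  have hsurj : Function.Surjective (tmap 𝕜 E₁ E₀ f (𝒢.unit x)) := by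
    intro w
    obtain ⟨a, ha⟩ := hL.surjective_tmap_src (𝒢.unit x) (tmap 𝕜 E₀ E₀ χ.symm (χ x) w)
    refine ⟨a, ?_⟩
    have h2 := tmap_chartAt_tmap_chartAt_symm (𝕜 := 𝕜) (mem_chart_target E₀ x) w
    rw [χ.left_inv hxs] at h2
    rw [hfd, ha]
    exact h2
  let K := LinearMap.ker (tmap 𝕜 E₁ E₀ f (𝒢.unit x)).toLinearMap
  have hK : Module.finrank 𝕜 E₀ + Module.finrank 𝕜 K = Module.finrank 𝕜 E₁ := by
    have h1 := LinearMap.finrank_range_add_finrank_ker (tmap 𝕜 E₁ E₀ f (𝒢.unit x)).toLinearMap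
    rwa [LinearMap.range_eq_top.2 hsurj, finrank_top] at h1
  obtain ⟨e, hxe, heO, hef, he, he'⟩ := exists_straightening_chart hO₁ hxO₁ hf hsurj hK
  have hexd : MDifferentiableAt 𝓘(𝕜, E₁) 𝓘(𝕜, E₀ × K) e (𝒢.unit x) :=
    (he.contMDiffAt (e.open_source.mem_nhds hxe)).mdifferentiableAt (by simp)
  have hexd' : MDifferentiableAt 𝓘(𝕜, E₀ × K) 𝓘(𝕜, E₁) e.symm (e (𝒢.unit x)) :=
    (he'.contMDiffAt (e.open_target.mem_nhds (e.map_source hxe))).mdifferentiableAt (by simp)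
  -- The first component of `e` is the source read in a chart. Moving the unit at `y` by `k` in the
  -- `K`-direction of `e` therefore stays in the source fibre of `y`.
  let b : K × M → E₀ × K := fun q => e (𝒢.unit q.2) + (0, q.1)
  let O₂ : Set (K × M) := Prod.snd ⁻¹' (𝒢.unit ⁻¹' e.source)
  have hO₂ : IsOpen O₂ :=
    (e.open_source.preimage hL.unit_smooth.continuous).preimage continuous_snd
  have hb : ContMDiffOn (𝓘(𝕜, K).prod 𝓘(𝕜, E₀)) 𝓘(𝕜, E₀ × K) ∞ b O₂ := by
    have h1 : ContMDiffOn (𝓘(𝕜, K).prod 𝓘(𝕜, E₀)) 𝓘(𝕜, E₀ × K) ∞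
        (fun q : K × M => e (𝒢.unit q.2)) O₂ :=
      he.comp (hL.unit_smooth.comp contMDiff_snd).contMDiffOn fun q hq => hq
    have h2 : ContMDiff (𝓘(𝕜, K).prod 𝓘(𝕜, E₀)) 𝓘(𝕜, E₀ × K) ∞
        (fun q : K × M => ((0 : E₀), q.1)) :=
      (ContDiff.contMDiff (by fun_prop : ContDiff 𝕜 ∞ fun k : K => ((0 : E₀), k))).comp
        contMDiff_fst
    exact h1.add h2.contMDiffOn
  let O := O₂ ∩ b ⁻¹' e.target
  refine ⟨K, inferInstance, inferInstance, inferInstance,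
    (ContinuousLinearMap.snd 𝕜 E₀ K).comp (tmap 𝕜 E₁ (E₀ × K) e (𝒢.unit x)),
    fun q => e.symm (b q), O, hb.continuousOn.isOpen_inter_preimage hO₂ e.open_target,
    ⟨hxe, ?_⟩, ?_, ?_, ?_, ?_⟩
  · change e (𝒢.unit x) + (0, 0) ∈ e.target
    rw [Prod.mk_zero_zero, add_zero]
    exact e.map_source hxe
  · exact he'.comp (hb.mono inter_subset_left) fun q hq => hq.2
  · intro q hq
    have h1 := e.map_target hq.2
    have h2 := hef _ h1
    rw [e.right_inv hq.2] at h2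
    have h3 : (b q).1 = f (𝒢.unit q.2) := by
      simp [b, hef _ hq.1]
    have h4 := χ.injOn (heO h1) (heO hq.1) (h2.symm.trans h3)
    rwa [𝒢.src_unit] at h4
  · intro y hy
    change e.symm (e (𝒢.unit y) + (0, 0)) = _
    rw [Prod.mk_zero_zero, add_zero, e.left_inv hy.1]
  · intro a ha
    have h1 : tmap 𝕜 E₁ (E₀ × K) e (𝒢.unit x) a =
        (0, (tmap 𝕜 E₁ (E₀ × K) e (𝒢.unit x) a).2) := by
      refine Prod.ext ?_ rfl
      have h2 : tmap 𝕜 E₁ E₀ (fun g => (e g).1) (𝒢.unit x) a =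
          (tmap 𝕜 E₁ (E₀ × K) e (𝒢.unit x) a).1 := by
        have := tmap_comp_apply (g := ContinuousLinearMap.fst 𝕜 E₀ K) (f := e)
          (x := 𝒢.unit x) rfl (ContinuousLinearMap.mdifferentiableAt _) hexd a
        rw [tmap_continuousLinearMap] at this
        exact this
      rw [← h2, tmap_congr (g := f), hfd, ha, map_zero]
      filter_upwards [e.open_source.mem_nhds hxe] with g hg using hef g hg
    have h3 : HasFDerivAt (fun k : K => e (𝒢.unit x) + (0, k))
        (ContinuousLinearMap.inr 𝕜 E₀ K) 0 :=
      ((ContinuousLinearMap.inr 𝕜 E₀ K).hasFDerivAt).const_add _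
    have h4 := tmap_comp_apply (g := e.symm) (f := fun k : K => e (𝒢.unit x) + (0, k))
      (x := 0) (y := e (𝒢.unit x)) (by simp) hexd' h3.differentiableAt.mdifferentiableAt
      (tmap 𝕜 E₁ (E₀ × K) e (𝒢.unit x) a).2
    refine h4.trans ?_
    rw [tmap_eq_fderiv, h3.fderiv, ContinuousLinearMap.inr_apply, ← h1]
    exact tmap_leftInverse rfl hexd hexd' (e.eventually_left_inverse hxe) a

/-- Multiplicativity of a 2-form, for families of composable pairs defined on an open subset of a
vector space. -/
theorem IsMultiplicative.pairing_eq (hL : 𝒢.IsLie 𝕜 E₁ E₀) {Ω : DForm 𝕜 E₁ G 2}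
    (hΩ : 𝒢.IsMultiplicative Ω)
    {V : Type u} [NormedAddCommGroup V] [NormedSpace 𝕜 V] [FiniteDimensional 𝕜 V]
    {W : Set V} (hW : IsOpen W) {a b : V → G} (ha : ContMDiffOn 𝓘(𝕜, V) 𝓘(𝕜, E₁) ∞ a W)
    (hb : ContMDiffOn 𝓘(𝕜, V) 𝓘(𝕜, E₁) ∞ b W) (hab : ∀ n ∈ W, 𝒢.src (a n) = 𝒢.tgt (b n))
    {x : V} (hx : x ∈ W) (v w : V) :
    (Ω.at' (𝒢.mul (a x) (b x))).pairing (tmap 𝕜 V E₁ (fun n => 𝒢.mul (a n) (b n)) x v)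
      (tmap 𝕜 V E₁ (fun n => 𝒢.mul (a n) (b n)) x w) =
    (Ω.at' (a x)).pairing (tmap 𝕜 V E₁ a x v) (tmap 𝕜 V E₁ a x w) +
      (Ω.at' (b x)).pairing (tmap 𝕜 V E₁ b x v) (tmap 𝕜 V E₁ b x w) := by
  have : ProperSpace V := FiniteDimensional.proper_rclike 𝕜 V
  -- Multiplicativity is stated for families over manifolds, so the open set `W` is made into one,
  -- with étale inclusion into `V`.
  obtain ⟨cs, hm, het⟩ := exists_manifold_of_isLocalHomeomorph (𝕜 := 𝕜) (E' := V)
    (p := (Subtype.val : W → V)) hW.isOpenEmbedding_subtypeVal.isLocalHomeomorph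
  have hval := het.contMDiff
  have hmem : ∀ n : W, n.1 ∈ W := fun n => n.2
  have hcomp : ∀ {c : V → G}, ContMDiffOn 𝓘(𝕜, V) 𝓘(𝕜, E₁) ∞ c W →
      ContMDiff 𝓘(𝕜, V) 𝓘(𝕜, E₁) ∞ (fun n : W => c n.1) := fun hc =>
    hc.comp_contMDiff hval hmem
  have key := congrFun (hΩ { carrier := W, model := V } _ _ (hcomp ha) (hcomp hb)
    fun n => hab n.1 n.2) ⟨x, hx⟩
  -- Tangent vectors to `V` are lifted through the differential of the inclusion of `W`, which is
  -- bijective.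
  obtain ⟨v', hv'⟩ := (het.bijective_tmap ⟨x, hx⟩).2 v
  obtain ⟨w', hw'⟩ := (het.bijective_tmap ⟨x, hx⟩).2 w
  have hch : ∀ {c : V → G}, ContMDiffOn 𝓘(𝕜, V) 𝓘(𝕜, E₁) ∞ c W → ∀ z,
      tmap 𝕜 V E₁ (fun n : W => c n.1) ⟨x, hx⟩ z =
        tmap 𝕜 V E₁ c x (tmap 𝕜 V V (Subtype.val : W → V) ⟨x, hx⟩ z) := fun hc z =>
    tmap_comp_apply rfl ((hc.contMDiffAt (hW.mem_nhds hx)).mdifferentiableAt (by simp))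
      ((hval _).mdifferentiableAt (by simp)) z
  have hm := hL.contMDiffOn_mul ha hb hab
  have key' := congrArg (fun α : V [⋀^Fin 2]→L[𝕜] 𝕜 => α.pairing v' w') key
  change ((Ω.at' (𝒢.mul (a x) (b x))).compContinuousLinearMap
      (tmap 𝕜 V E₁ (fun n : W => 𝒢.mul (a n.1) (b n.1)) ⟨x, hx⟩)).pairing v' w' =
    ((Ω.at' (a x)).compContinuousLinearMap
      (tmap 𝕜 V E₁ (fun n : W => a n.1) ⟨x, hx⟩)).pairing v' w' +
    ((Ω.at' (b x)).compContinuousLinearMap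
      (tmap 𝕜 V E₁ (fun n : W => b n.1) ⟨x, hx⟩)).pairing v' w' at key'
  rw [ContinuousAlternatingMap.pairing_comp, ContinuousAlternatingMap.pairing_comp,
    ContinuousAlternatingMap.pairing_comp, hch hm, hch hm, hch ha, hch ha, hch hb, hch hb,
    hv', hw'] at key'
  exact key'

/-- Right translation of the Lie algebroid to the source fibre through `g`. -/
theorem IsLie.exists_right_translation (hL : 𝒢.IsLie 𝕜 E₁ E₀) (g : G) :
    ∃ R : E₁ →L[𝕜] E₁, ∀ a, tmap 𝕜 E₁ E₀ 𝒢.src (𝒢.unit (𝒢.tgt g)) a = 0 →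
      tmap 𝕜 E₁ E₀ 𝒢.src g (R a) = 0 ∧
      tmap 𝕜 E₁ E₀ 𝒢.tgt g (R a) = tmap 𝕜 E₁ E₀ 𝒢.tgt (𝒢.unit (𝒢.tgt g)) a ∧
      (g = 𝒢.unit (𝒢.tgt g) → R a = a) ∧
      ∀ Ω : DForm 𝕜 E₁ G 2, 𝒢.IsMultiplicative Ω → ∀ b,
        (Ω.at' g).pairing (R a) b = (Ω.at' (𝒢.unit (𝒢.tgt g))).pairing a
          (tmap 𝕜 E₀ E₁ 𝒢.unit (𝒢.tgt g) (tmap 𝕜 E₁ E₀ 𝒢.tgt g b)) := by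
  set x := 𝒢.tgt g with hxdef
  obtain ⟨K, _, _, _, κ, c, O, hO, hxO, hc, hsrc, hunit, hκ⟩ := hL.exists_source_fibre_family x
  have hc0 : c (0, x) = 𝒢.unit x := hunit x hxO
  let O' : Set K := (fun k => (k, x)) ⁻¹' O
  have hO' : IsOpen O' := hO.preimage (by fun_prop)
  have hcx : ContMDiffOn 𝓘(𝕜, K) 𝓘(𝕜, E₁) ∞ (fun k => c (k, x)) O' :=
    hc.comp (contMDiff_id.prodMk contMDiff_const).contMDiffOn fun k hk => hk
  have hcxd : MDifferentiableAt 𝓘(𝕜, K) 𝓘(𝕜, E₁) (fun k => c (k, x)) 0 :=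
    (hcx.contMDiffAt (hO'.mem_nhds hxO)).mdifferentiableAt (by simp)
  have hm : ContMDiffOn 𝓘(𝕜, K) 𝓘(𝕜, E₁) ∞ (fun k => 𝒢.mul (c (k, x)) g) O' :=
    hL.contMDiffOn_mul hcx contMDiffOn_const fun k hk => hsrc _ hk
  have hmd : MDifferentiableAt 𝓘(𝕜, K) 𝓘(𝕜, E₁) (fun k => 𝒢.mul (c (k, x)) g) 0 :=
    (hm.contMDiffAt (hO'.mem_nhds hxO)).mdifferentiableAt (by simp)
  have hm0 : 𝒢.mul (c (0, x)) g = g := by rw [hc0]; exact 𝒢.unit_mul g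
  -- `R` is the differential of `k ↦ c(k, x) g`, where `c(·, x)` parametrizes the source fibre near
  -- the unit and `κ a` is the parameter velocity representing `a`.
  refine ⟨(tmap 𝕜 K E₁ (fun k => 𝒢.mul (c (k, x)) g) 0).comp κ, fun a ha => ⟨?_, ?_, ?_, ?_⟩⟩
  · rw [ContinuousLinearMap.comp_apply,
      ← tmap_comp_apply (f := fun k => 𝒢.mul (c (k, x)) g) hm0
        (hL.mdifferentiableAt_src _) hmd, tmap_congr (g := fun _ => 𝒢.src g),
      tmap_const]
    · rfl
    · filter_upwards [hO'.mem_nhds hxO] with k hk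
      exact 𝒢.src_mul _ _ (hsrc _ hk)
  · rw [ContinuousLinearMap.comp_apply,
      ← tmap_comp_apply (f := fun k => 𝒢.mul (c (k, x)) g) hm0
        (hL.mdifferentiableAt_tgt _) hmd,
      tmap_congr (g := fun k => 𝒢.tgt (c (k, x))),
      tmap_comp_apply (f := fun k => c (k, x)) hc0 (hL.mdifferentiableAt_tgt _) hcxd, hκ a ha]
    filter_upwards [hO'.mem_nhds hxO] with k hk
    exact 𝒢.tgt_mul _ _ (hsrc _ hk)
  · intro hg
    rw [ContinuousLinearMap.comp_apply, tmap_congr (g := fun k => c (k, x)), hκ a ha]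
    filter_upwards [hO'.mem_nhds hxO] with k hk
    have h1 : 𝒢.src (c (k, x)) = x := hsrc _ hk
    have h2 := 𝒢.mul_unit (c (k, x))
    rwa [h1, ← hg] at h2
  · intro Ω hΩ b
    let χ := chartAt E₁ g
    have hgs : g ∈ χ.source := mem_chart_source E₁ g
    have hgt : χ g ∈ χ.target := mem_chart_target E₁ g
    have hsymm : χ.symm (χ g) = g := χ.left_inv hgs
    -- For the pairing formula, multiplicativity is applied to the products `c(k, t h) h` with `h`
    -- near `g`. At `(0, g)` the `k`-derivative of the product is `R a`; at `k = 0` the product is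
    -- `h`, so its `h`-derivative is the identity.
    let τ : K × E₁ → K × M := fun q => (q.1, 𝒢.tgt (χ.symm q.2))
    have hχs : ContMDiffOn 𝓘(𝕜, K × E₁) 𝓘(𝕜, E₁) ∞ (fun q : K × E₁ => χ.symm q.2)
        (Prod.snd ⁻¹' χ.target) :=
      (contMDiffOn_chart_symm (I := 𝓘(𝕜, E₁)) (x := g)).comp
        contDiff_snd.contMDiff.contMDiffOn fun q hq => hq
    have hτ : ContMDiffOn 𝓘(𝕜, K × E₁) (𝓘(𝕜, K).prod 𝓘(𝕜, E₀)) ∞ τ (Prod.snd ⁻¹' χ.target) :=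
      contDiff_fst.contMDiff.contMDiffOn.prodMk (hL.contMDiff_tgt.comp_contMDiffOn hχs)
    let W : Set (K × E₁) := Prod.snd ⁻¹' χ.target ∩ τ ⁻¹' O
    have hW : IsOpen W := hτ.continuousOn.isOpen_inter_preimage
      (χ.open_target.preimage continuous_snd) hO
    have hτ0 : τ (0, χ g) = (0, x) := by simp [τ, hsymm, hxdef]
    have hxW : ((0 : K), χ g) ∈ W := ⟨hgt, by rw [mem_preimage, hτ0]; exact hxO⟩
    have hA : ContMDiffOn 𝓘(𝕜, K × E₁) 𝓘(𝕜, E₁) ∞ (fun q => c (τ q)) W :=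
      hc.comp (hτ.mono inter_subset_left) fun q hq => hq.2
    have hB : ContMDiffOn 𝓘(𝕜, K × E₁) 𝓘(𝕜, E₁) ∞ (fun q : K × E₁ => χ.symm q.2) W :=
      hχs.mono inter_subset_left
    have hAB : ∀ q ∈ W, 𝒢.src (c (τ q)) = 𝒢.tgt (χ.symm q.2) := fun q hq => hsrc _ hq.2
    have hmul := hL.contMDiffOn_mul hA hB hAB
    have hd : ∀ {f : K × E₁ → G}, ContMDiffOn 𝓘(𝕜, K × E₁) 𝓘(𝕜, E₁) ∞ f W →
        MDifferentiableAt 𝓘(𝕜, K × E₁) 𝓘(𝕜, E₁) f (0, χ g) := fun hf =>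
      (hf.contMDiffAt (hW.mem_nhds hxW)).mdifferentiableAt (by simp)
    -- In the pair of directions `(κ a, 0)` and `(0, b)` the factor `h` has zero derivative along
    -- the first, so only the term of `c(k, t h)` survives. Its derivatives are `a` and `u_* t_* b`.
    have key := hΩ.pairing_eq hL hW hA hB hAB hxW (κ a, 0) (0, tmap 𝕜 E₁ E₁ χ g b)
    simp only [hτ0, hc0, hsymm] at key
    have hug : 𝒢.mul (𝒢.unit x) g = g := 𝒢.unit_mul g
    have hBc : tmap 𝕜 K E₁ (fun k : K => χ.symm (k, χ g).2) 0 = 0 :=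
      tmap_const (0 : K) (χ.symm (χ g))
    rw [hug, tmap_apply_inl (hd hmul), tmap_apply_inr (hd hmul), tmap_apply_inl (hd hA),
      tmap_apply_inr (hd hA), tmap_apply_inl (hd hB), hBc] at key
    simp only [zero_apply, map_zero, LinearMap.zero_apply, add_zero] at key
    have e1 : (fun k : K => 𝒢.mul (c (τ (k, χ g))) (χ.symm (χ g))) =
        fun k => 𝒢.mul (c (k, x)) g := by
      funext k; simp [τ, hsymm, hxdef]
    have e2 : (fun k : K => c (τ (k, χ g))) = fun k => c (k, x) := by
      funext k; simp [τ, hsymm, hxdef]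
    have hev : ∀ᶠ y in 𝓝 (χ g), ((0 : K), y) ∈ W :=
      (Continuous.continuousAt (by fun_prop : Continuous fun y : E₁ => ((0 : K), y))).eventually
        (hW.mem_nhds hxW)
    have e3 : (fun y : E₁ => c (τ (0, y))) =ᶠ[𝓝 (χ g)] fun y => 𝒢.unit (𝒢.tgt (χ.symm y)) := by
      filter_upwards [hev] with y hy
      exact hunit _ hy.2
    have e4 : (fun y : E₁ => 𝒢.mul (c (τ (0, y))) (χ.symm y)) =ᶠ[𝓝 (χ g)] χ.symm := by
      filter_upwards [e3] with y hy
      rw [hy]; exact 𝒢.unit_mul _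
    have hχd := mdifferentiableAt_chartAt_symm (𝕜 := 𝕜) hgt
    have e5 : tmap 𝕜 E₁ E₁ (fun y : E₁ => 𝒢.unit (𝒢.tgt (χ.symm y))) (χ g)
        (tmap 𝕜 E₁ E₁ χ g b) = tmap 𝕜 E₀ E₁ 𝒢.unit x (tmap 𝕜 E₁ E₀ 𝒢.tgt g b) := by
      have htd : MDifferentiableAt 𝓘(𝕜, E₁) 𝓘(𝕜, E₀) (fun y => 𝒢.tgt (χ.symm y)) (χ g) :=
        (hL.mdifferentiableAt_tgt _).comp (χ g) hχd
      rw [tmap_comp_apply (g := 𝒢.unit) (y := x) (by simp [hsymm, hxdef])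
        (hL.mdifferentiableAt_unit _) htd,
        tmap_comp_apply hsymm (hL.mdifferentiableAt_tgt _) hχd,
        tmap_chartAt_symm_tmap_chartAt hgs]
    rw [e1, e2, tmap_congr e3, tmap_congr e4, hκ a ha, tmap_chartAt_symm_tmap_chartAt hgs,
      e5] at key
    exact key

/-- The translation formula at a unit, where right translation is the identity. Thus `i_a Ω` at a
unit is determined by the IM-form of `a`. -/
theorem IsMultiplicative.pairing_unit (hL : 𝒢.IsLie 𝕜 E₁ E₀) {Ω : DForm 𝕜 E₁ G 2}
    (hΩ : 𝒢.IsMultiplicative Ω) (x : M) {a : E₁}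
    (ha : tmap 𝕜 E₁ E₀ 𝒢.src (𝒢.unit x) a = 0) (b : E₁) :
    (Ω.at' (𝒢.unit x)).pairing a b = (Ω.at' (𝒢.unit x)).pairing a
      (tmap 𝕜 E₀ E₁ 𝒢.unit x (tmap 𝕜 E₁ E₀ 𝒢.tgt (𝒢.unit x) b)) := by
  obtain ⟨R, hR⟩ := hL.exists_right_translation (𝒢.unit x)
  rw [𝒢.tgt_unit] at hR
  obtain ⟨-, -, h3, h4⟩ := hR a ha
  rw [← h4 Ω hΩ b, h3 rfl]

section MultiplicativeForms

variable [T2Space G] [SecondCountableTopology G] [T2Space M] [SecondCountableTopology M]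

/-- From `u(x) u(x) = u(x)` one gets `u^*Ω = u^*Ω + u^*Ω`. -/
theorem IsMultiplicative.pullback_unit (hL : 𝒢.IsLie 𝕜 E₁ E₀) {Ω : DForm 𝕜 E₁ G 2}
    (hΩ : 𝒢.IsMultiplicative Ω) : (DForm.pullback 𝒢.unit Ω : DForm 𝕜 E₀ M 2) = 0 := by
  have h := hΩ { carrier := M, model := E₀ } 𝒢.unit 𝒢.unit hL.unit_smooth hL.unit_smooth
    fun x => (𝒢.src_unit x).trans (𝒢.tgt_unit x).symm
  have h1 : (fun n => 𝒢.mul (𝒢.unit n) (𝒢.unit n)) = 𝒢.unit := by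
    funext x
    have := 𝒢.mul_unit (𝒢.unit x)
    rwa [𝒢.src_unit] at this
  rw [h1] at h
  exact left_eq_add.1 h

/-- Multiplicativity along `g ↦ (g, g⁻¹)`, whose product is `u(t g)`; the pullback of `Ω` by units
vanishes. -/
theorem IsMultiplicative.pullback_inv (hL : 𝒢.IsLie 𝕜 E₁ E₀) {Ω : DForm 𝕜 E₁ G 2}
    (hΩ : 𝒢.IsMultiplicative Ω) : (DForm.pullback 𝒢.inv Ω : DForm 𝕜 E₁ G 2) = -Ω := by
  have h : (DForm.pullback (fun g => 𝒢.mul g (𝒢.inv g)) Ω : DForm 𝕜 E₁ G 2) =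
      DForm.pullback (fun g => g) Ω + DForm.pullback 𝒢.inv Ω :=
    hΩ { carrier := G, model := E₁ } (fun g => g) 𝒢.inv contMDiff_id hL.inv_smooth
      fun g => (𝒢.tgt_inv g).symm
  have h1 : (fun n => 𝒢.mul n (𝒢.inv n)) = fun g => 𝒢.unit (𝒢.tgt g) := funext 𝒢.mul_inv
  have h2 : (DForm.pullback (fun g => g) Ω : DForm 𝕜 E₁ G 2) = Ω := by
    refine DForm.ext_at fun g => ?_
    rw [DForm.pullback_at, tmap_id]; rfl
  have h3 : (DForm.pullback (fun g => 𝒢.unit (𝒢.tgt g)) Ω : DForm 𝕜 E₁ G 2) = 0 := by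
    rw [DForm.pullback_comp Ω (hL.unit_smooth.mdifferentiable (by simp))
      (hL.contMDiff_tgt.mdifferentiable (by simp)), hΩ.pullback_unit hL]
    rfl
  rw [h1, h2, h3] at h
  exact (neg_eq_of_add_eq_zero_right h.symm).symm

end MultiplicativeForms

end Grpd

/-! ### Smoothness of maps into embedded submanifolds -/

section

variable {𝕜 : Type*} [RCLike 𝕜] {E E' : Type*}
  [NormedAddCommGroup E] [NormedSpace 𝕜 E] [NormedAddCommGroup E'] [NormedSpace 𝕜 E']
  {Z G : Type*} [TopologicalSpace Z] [ChartedSpace E Z] [TopologicalSpace G] [ChartedSpace E' G]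
  {F H : Type*} [NormedAddCommGroup F] [NormedSpace 𝕜 F] [TopologicalSpace H]
  {I : ModelWithCorners 𝕜 F H} {N : Type*} [TopologicalSpace N] [ChartedSpace H N]

theorem HasLocalRetractions.contMDiffOn_of_isInducing {j : Z → G}
    (h : HasLocalRetractions 𝕜 E E' j) (hj : Topology.IsInducing j) {f : N → Z} {s : Set N}
    (hf : ContMDiffOn I 𝓘(𝕜, E') ∞ (fun y => j (f y)) s) : ContMDiffOn I 𝓘(𝕜, E) ∞ f s :=
  h.contMDiffOn (hj.continuousOn_iff.2 hf.continuousOn) hf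

theorem HasLocalRetractions.contMDiff_of_isInducing {j : Z → G}
    (h : HasLocalRetractions 𝕜 E E' j) (hj : Topology.IsInducing j) {f : N → Z}
    (hf : ContMDiff I 𝓘(𝕜, E') ∞ (fun y => j (f y))) : ContMDiff I 𝓘(𝕜, E) ∞ f :=
  h.contMDiff_of_comp (hj.continuous_iff.2 hf.continuous) hf

theorem HasLocalRetractions.contMDiffAt_of_isInducing {j : Z → G}
    (h : HasLocalRetractions 𝕜 E E' j) (hj : Topology.IsInducing j) {f : N → Z} {x : N}
    (hf : ContMDiffAt I 𝓘(𝕜, E') ∞ (fun y => j (f y)) x) : ContMDiffAt I 𝓘(𝕜, E) ∞ f x := by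
  rw [← contMDiffWithinAt_univ] at hf ⊢
  exact h.contMDiffWithinAt ((hj.continuousAt_iff.2
    (contMDiffWithinAt_univ.1 hf).continuousAt).continuousWithinAt) hf

theorem tmap_prodMk {f : Z → E'} {g : Z → F} {z : Z}
    (hf : MDifferentiableAt 𝓘(𝕜, E) 𝓘(𝕜, E') f z) (hg : MDifferentiableAt 𝓘(𝕜, E) 𝓘(𝕜, F) g z)
    (a : E) :
    tmap 𝕜 E (E' × F) (fun z => (f z, g z)) z a = (tmap 𝕜 E E' f z a, tmap 𝕜 E F g z a) := by
  have h := hf.prodMk_space hg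
  refine Prod.ext ?_ ?_
  · have := tmap_comp_apply (g := ContinuousLinearMap.fst 𝕜 E' F) (f := fun z => (f z, g z))
      (x := z) rfl (ContinuousLinearMap.mdifferentiableAt _) h a
    rw [tmap_continuousLinearMap] at this
    exact this.symm
  · have := tmap_comp_apply (g := ContinuousLinearMap.snd 𝕜 E' F) (f := fun z => (f z, g z))
      (x := z) rfl (ContinuousLinearMap.mdifferentiableAt _) h a
    rw [tmap_continuousLinearMap] at this
    exact this.symm

end

/-! ### Transversality along the slice and the submanifold of restricted arrows -/

namespace Grpd

variable {𝕜 : Type v} [RCLike 𝕜] {E₁ E₀ E_S F : Type u}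
  [NormedAddCommGroup E₁] [NormedSpace 𝕜 E₁] [FiniteDimensional 𝕜 E₁]
  [NormedAddCommGroup E₀] [NormedSpace 𝕜 E₀] [FiniteDimensional 𝕜 E₀]
  [NormedAddCommGroup E_S] [NormedSpace 𝕜 E_S] [FiniteDimensional 𝕜 E_S]
  [NormedAddCommGroup F] [NormedSpace 𝕜 F] [FiniteDimensional 𝕜 F]
  {G M : Type u} [TopologicalSpace G] [ChartedSpace E₁ G] [IsManifold 𝓘(𝕜, E₁) ∞ G]
  [TopologicalSpace M] [ChartedSpace E₀ M] [IsManifold 𝓘(𝕜, E₀) ∞ M]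
  {𝒢 : Grpd G M} {S : Set M} [ChartedSpace E_S S] [IsManifold 𝓘(𝕜, E_S) ∞ S]

/-- Lift `p` through the submersion `s`, then correct the lift by a right-translated algebroid
vector. The correction has zero source component, and its target component is an anchor value, which
by transversality can be any vector modulo `TS`. This is joint transversality of `(s, t)` away from
the units. -/
theorem IsAdmissibleGlobalSlice.exists_tangent (hL : 𝒢.IsLie 𝕜 E₁ E₀)
    (hS : 𝒢.IsAdmissibleGlobalSlice 𝕜 E₁ E₀ E_S S) {g : G} (hg : 𝒢.tgt g ∈ S) (p q : E₀) :
    ∃ (z : E₁) (y : E_S), tmap 𝕜 E₁ E₀ 𝒢.src g z = p ∧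
      tmap 𝕜 E₁ E₀ 𝒢.tgt g z = q + tmap 𝕜 E_S E₀ (Subtype.val : S → M) ⟨𝒢.tgt g, hg⟩ y := by
  obtain ⟨z₀, hz₀⟩ := hL.surjective_tmap_src g p
  obtain ⟨y, a, ha, hw⟩ := hS.transverse ⟨𝒢.tgt g, hg⟩ (tmap 𝕜 E₁ E₀ 𝒢.tgt g z₀ - q : E₀)
  obtain ⟨R, hR⟩ := hL.exists_right_translation g
  obtain ⟨h1, h2, -, -⟩ := hR a ha
  refine ⟨z₀ - R a, y, ?_, ?_⟩
  · rw [map_sub, h1, hz₀, sub_zero]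
  · have hw' : tmap 𝕜 E₁ E₀ 𝒢.tgt g z₀ - q =
        tmap 𝕜 E_S E₀ (Subtype.val : S → M) ⟨𝒢.tgt g, hg⟩ y +
          tmap 𝕜 E₁ E₀ 𝒢.tgt (𝒢.unit (𝒢.tgt g)) a := hw
    rw [map_sub, h2, sub_eq_iff_eq_add, add_assoc, ← hw']
    abel

/-- Both endpoints of `g` are points of `S` on one orbit. -/
theorem IsAdmissibleGlobalSlice.tgt_eq_src (hS : 𝒢.IsAdmissibleGlobalSlice 𝕜 E₁ E₀ E_S S)
    {g : G} (h : 𝒢.src g ∈ S) (h' : 𝒢.tgt g ∈ S) : 𝒢.tgt g = 𝒢.src g :=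
  (hS.meets_once (𝒢.src g)).unique ⟨h', g, rfl, rfl⟩
    ⟨h, 𝒢.unit (𝒢.src g), 𝒢.src_unit _, 𝒢.tgt_unit _⟩

/-- A function defining the slice near one of its points. -/
theorem exists_slice_function_tangent
    (hF : Manifold.IsImmersionOfComplement F 𝓘(𝕜, E_S) 𝓘(𝕜, E₀) ∞ (Subtype.val : S → M)) (x : S) :
    ∃ (O : Set M) (f : M → F), IsOpen O ∧ x.1 ∈ O ∧ ContMDiffOn 𝓘(𝕜, E₀) 𝓘(𝕜, F) ∞ f O ∧
      (∀ y ∈ O, y ∈ S ↔ f y = 0) ∧ Function.Surjective (tmap 𝕜 E₀ F f x.1) ∧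
      ∀ y : E_S, tmap 𝕜 E₀ F f x.1 (tmap 𝕜 E_S E₀ (Subtype.val : S → M) x y) = 0 := by
  obtain ⟨O, f, hO, hx, hf, hSf, hs⟩ := exists_slice_function (hF x)
  refine ⟨O, f, hO, hx, hf, hSf, hs, fun y => ?_⟩
  rw [← tmap_comp_apply rfl ((hf.contMDiffAt (hO.mem_nhds hx)).mdifferentiableAt (by simp))
    ((hF.contMDiff x).mdifferentiableAt (by simp)), tmap_congr (g := fun _ => (0 : F)), tmap_const]
  · rfl
  · filter_upwards [continuous_subtype_val.continuousAt.eventually (hO.mem_nhds hx)] with z hz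
    exact (hSf _ hz).1 z.2

/-- Local sections of the source map with target in the slice. -/
theorem IsAdmissibleGlobalSlice.exists_section (hL : 𝒢.IsLie 𝕜 E₁ E₀)
    (hS : 𝒢.IsAdmissibleGlobalSlice 𝕜 E₁ E₀ E_S S)
    (hF : Manifold.IsImmersionOfComplement F 𝓘(𝕜, E_S) 𝓘(𝕜, E₀) ∞ (Subtype.val : S → M))
    {g : G} (hg : 𝒢.tgt g ∈ S) :
    ∃ (U : Set M) (σ : M → G), IsOpen U ∧ 𝒢.src g ∈ U ∧ ContMDiffOn 𝓘(𝕜, E₀) 𝓘(𝕜, E₁) ∞ σ U ∧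
      σ (𝒢.src g) = g ∧ ∀ y ∈ U, 𝒢.src (σ y) = y ∧ 𝒢.tgt (σ y) ∈ S := by
  obtain ⟨O, φ, hO, hxO, hφ, hSφ, hφs, hφ0⟩ := exists_slice_function_tangent hF ⟨𝒢.tgt g, hg⟩
  let χ := chartAt E₀ (𝒢.src g)
  have hxs : 𝒢.src g ∈ χ.source := mem_chart_source E₀ _
  have hχ : ContMDiffOn 𝓘(𝕜, E₀) 𝓘(𝕜, E₀) ∞ χ χ.source :=
    contMDiffOn_chart (I := 𝓘(𝕜, E₀)) (x := 𝒢.src g)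
  let O' : Set G := 𝒢.src ⁻¹' χ.source ∩ 𝒢.tgt ⁻¹' O
  have hO' : IsOpen O' := (χ.open_source.preimage hL.contMDiff_src.continuous).inter
    (hO.preimage hL.contMDiff_tgt.continuous)
  have hgO' : g ∈ O' := ⟨hxs, hxO⟩
  let f : G → E₀ × F := fun h => (χ (𝒢.src h), φ (𝒢.tgt h))
  have hf1 : ContMDiffOn 𝓘(𝕜, E₁) 𝓘(𝕜, E₀) ∞ (fun h => χ (𝒢.src h)) O' :=
    hχ.comp hL.contMDiff_src.contMDiffOn fun h hh => hh.1
  have hf2 : ContMDiffOn 𝓘(𝕜, E₁) 𝓘(𝕜, F) ∞ (fun h => φ (𝒢.tgt h)) O' :=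
    hφ.comp hL.contMDiff_tgt.contMDiffOn fun h hh => hh.2
  have hφd : MDifferentiableAt 𝓘(𝕜, E₀) 𝓘(𝕜, F) φ (𝒢.tgt g) :=
    (hφ.contMDiffAt (hO.mem_nhds hxO)).mdifferentiableAt (by simp)
  have hfd : ∀ z, tmap 𝕜 E₁ (E₀ × F) f g z = (tmap 𝕜 E₀ E₀ χ (𝒢.src g) (tmap 𝕜 E₁ E₀ 𝒢.src g z),
      tmap 𝕜 E₀ F φ (𝒢.tgt g) (tmap 𝕜 E₁ E₀ 𝒢.tgt g z)) := fun z => by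
    rw [← tmap_comp_apply rfl (mdifferentiableAt_chartAt hxs) (hL.mdifferentiableAt_src g),
      ← tmap_comp_apply rfl hφd (hL.mdifferentiableAt_tgt g)]
    exact tmap_prodMk ((hf1.contMDiffAt (hO'.mem_nhds hgO')).mdifferentiableAt (by simp))
      ((hf2.contMDiffAt (hO'.mem_nhds hgO')).mdifferentiableAt (by simp)) z
  have hsurj : Function.Surjective (tmap 𝕜 E₁ (E₀ × F) f g) := by
    rintro ⟨p, q⟩
    obtain ⟨q', hq'⟩ := hφs q
    obtain ⟨z, y, h1, h2⟩ := hS.exists_tangent hL hg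
      (tmap 𝕜 E₀ E₀ χ.symm (χ (𝒢.src g)) p) q'
    refine ⟨z, ?_⟩
    have h3 := tmap_chartAt_tmap_chartAt_symm (𝕜 := 𝕜) (mem_chart_target E₀ (𝒢.src g)) p
    rw [χ.left_inv hxs] at h3
    rw [hfd, h1, h2, map_add]
    refine Prod.ext h3 ?_
    have h4 := hφ0 y
    simp only at h4
    change tmap 𝕜 E₀ F φ (𝒢.tgt g) q' + _ = q
    rw [h4, add_zero]
    exact hq'
  let K := LinearMap.ker (tmap 𝕜 E₁ (E₀ × F) f g).toLinearMap
  have hK : Module.finrank 𝕜 (E₀ × F) + Module.finrank 𝕜 K = Module.finrank 𝕜 E₁ := by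
    have h1 := LinearMap.finrank_range_add_finrank_ker (tmap 𝕜 E₁ (E₀ × F) f g).toLinearMap
    rwa [LinearMap.range_eq_top.2 hsurj, finrank_top] at h1
  obtain ⟨e, hge, heO, hef, he, he'⟩ :=
    exists_straightening_chart hO' hgO' (hf1.prodMk_space hf2) hsurj hK
  -- In the chart `e` the first components are `s`, read in `χ`, and the equation of `S` at the
  -- target. Prescribing the first to be `χ y` and the second to be `0` gives an arrow from `y` into
  -- `S`; the remaining coordinate is frozen at its value at `g`.
  let b : M → (E₀ × F) × K := fun y => ((χ y, 0), (e g).2)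
  have hb : ContMDiffOn 𝓘(𝕜, E₀) 𝓘(𝕜, (E₀ × F) × K) ∞ b χ.source :=
    (hχ.prodMk_space contMDiffOn_const).prodMk_space contMDiffOn_const
  have hbg : b (𝒢.src g) = e g := by
    refine Prod.ext ?_ rfl
    rw [hef g hge]
    exact Prod.ext rfl ((hSφ _ hxO).1 hg).symm
  refine ⟨χ.source ∩ b ⁻¹' e.target, fun y => e.symm (b y),
    hb.continuousOn.isOpen_inter_preimage χ.open_source e.open_target,
    ⟨hxs, by rw [mem_preimage, hbg]; exact e.map_source hge⟩,
    he'.comp (hb.mono inter_subset_left) fun y hy => hy.2, ?_, fun y hy => ?_⟩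
  · simp only [hbg, e.left_inv hge]
  · have h1 := e.map_target hy.2
    have h2 := hef _ h1
    rw [e.right_inv hy.2] at h2
    have h3 : χ y = χ (𝒢.src (e.symm (b y))) := congrArg Prod.fst h2
    have h4 : 0 = φ (𝒢.tgt (e.symm (b y))) := congrArg Prod.snd h2
    exact ⟨(χ.injOn hy.1 (heO h1).1 h3).symm, (hSφ _ (heO h1).2).2 h4.symm⟩

/-- The restriction of a Lie groupoid to a slice is an embedded submanifold. -/
theorem IsAdmissibleGlobalSlice.exists_restrict_manifold (hL : 𝒢.IsLie 𝕜 E₁ E₀)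
    (hdim : Module.finrank 𝕜 E₁ = 2 * Module.finrank 𝕜 E₀)
    (hS : 𝒢.IsAdmissibleGlobalSlice 𝕜 E₁ E₀ E_S S)
    (hF : Manifold.IsImmersionOfComplement F 𝓘(𝕜, E_S) 𝓘(𝕜, E₀) ∞ (Subtype.val : S → M)) :
    ∃ (_ : ChartedSpace (E_S × E_S) (𝒢.RestrictArrows S))
      (_ : IsManifold 𝓘(𝕜, E_S × E_S) ∞ (𝒢.RestrictArrows S)),
      Manifold.IsSmoothEmbedding 𝓘(𝕜, E_S × E_S) 𝓘(𝕜, E₁) ∞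
        (Subtype.val : 𝒢.RestrictArrows S → G) ∧
      HasLocalRetractions 𝕜 (E_S × E_S) E₁ (Subtype.val : 𝒢.RestrictArrows S → G) := by
  refine exists_embedded_submanifold (V := F × F) fun g hg => ?_
  -- `dim M = dim S + dim F` is read off from the immersion chart, and `dim 𝒢 = 2 dim M` then leaves
  -- dimension `2 dim S`, that of `E_S × E_S`.
  have hd : Module.finrank 𝕜 (F × F) + Module.finrank 𝕜 (E_S × E_S) = Module.finrank 𝕜 E₁ := by
    have := (hF ⟨𝒢.src g, hg.1⟩).equiv.toLinearEquiv.finrank_eq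
    rw [Module.finrank_prod] at this
    rw [Module.finrank_prod, Module.finrank_prod, hdim]
    omega
  refine ⟨hd, ?_⟩
  obtain ⟨O, φ, hO, hxO, hφ, hSφ, hφs, -⟩ := exists_slice_function_tangent hF ⟨𝒢.src g, hg.1⟩
  obtain ⟨O', φ', hO', hxO', hφ', hSφ', hφs', hφ0'⟩ :=
    exists_slice_function_tangent hF ⟨𝒢.tgt g, hg.2⟩
  let W : Set G := 𝒢.src ⁻¹' O ∩ 𝒢.tgt ⁻¹' O'
  have hW : IsOpen W := (hO.preimage hL.contMDiff_src.continuous).inter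
    (hO'.preimage hL.contMDiff_tgt.continuous)
  have hgW : g ∈ W := ⟨hxO, hxO'⟩
  have hf1 : ContMDiffOn 𝓘(𝕜, E₁) 𝓘(𝕜, F) ∞ (fun h => φ (𝒢.src h)) W :=
    hφ.comp hL.contMDiff_src.contMDiffOn fun h hh => hh.1
  have hf2 : ContMDiffOn 𝓘(𝕜, E₁) 𝓘(𝕜, F) ∞ (fun h => φ' (𝒢.tgt h)) W :=
    hφ'.comp hL.contMDiff_tgt.contMDiffOn fun h hh => hh.2
  have hφd : MDifferentiableAt 𝓘(𝕜, E₀) 𝓘(𝕜, F) φ (𝒢.src g) :=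
    (hφ.contMDiffAt (hO.mem_nhds hxO)).mdifferentiableAt (by simp)
  have hφd' : MDifferentiableAt 𝓘(𝕜, E₀) 𝓘(𝕜, F) φ' (𝒢.tgt g) :=
    (hφ'.contMDiffAt (hO'.mem_nhds hxO')).mdifferentiableAt (by simp)
  let f : G → F × F := fun h => (φ (𝒢.src h), φ' (𝒢.tgt h))
  have hfd : ∀ z, tmap 𝕜 E₁ (F × F) f g z = (tmap 𝕜 E₀ F φ (𝒢.src g) (tmap 𝕜 E₁ E₀ 𝒢.src g z),
      tmap 𝕜 E₀ F φ' (𝒢.tgt g) (tmap 𝕜 E₁ E₀ 𝒢.tgt g z)) := fun z => by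
    rw [← tmap_comp_apply rfl hφd (hL.mdifferentiableAt_src g),
      ← tmap_comp_apply rfl hφd' (hL.mdifferentiableAt_tgt g)]
    exact tmap_prodMk ((hf1.contMDiffAt (hW.mem_nhds hgW)).mdifferentiableAt (by simp))
      ((hf2.contMDiffAt (hW.mem_nhds hgW)).mdifferentiableAt (by simp)) z
  have hsurj : Function.Surjective (tmap 𝕜 E₁ (F × F) f g) := by
    rintro ⟨p, q⟩
    obtain ⟨p', hp'⟩ := hφs p
    obtain ⟨q', hq'⟩ := hφs' q
    obtain ⟨z, y, h1, h2⟩ := hS.exists_tangent hL hg.2 p' q'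
    refine ⟨z, ?_⟩
    rw [hfd, h1, h2, map_add]
    refine Prod.ext hp' ?_
    have h4 := hφ0' y
    simp only at h4
    change tmap 𝕜 E₀ F φ' (𝒢.tgt g) q' + _ = q
    rw [h4, add_zero]
    exact hq'
  obtain ⟨e, hge, heW, hef, he, he'⟩ :=
    exists_straightening_chart hW hgW (hf1.prodMk_space hf2) hsurj hd
  refine ⟨e, hge, he, he', fun h hh => ?_⟩
  rw [hef h hh, Prod.mk_eq_zero, ← hSφ _ (heW hh).1, ← hSφ' _ (heW hh).2]

end Grpd

/-! ### The restriction to the slice as a symplectic groupoid -/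

namespace Grpd

theorem restrict_mul_val {G M : Type u} {𝒢 : Grpd G M} {S : Set M}
    {g h : 𝒢.RestrictArrows S} (c : 𝒢.src g.1 = 𝒢.tgt h.1) :
    ((𝒢.restrict S).mul g h).1 = 𝒢.mul g.1 h.1 := by
  simp only [restrict, dif_pos c]

section Nondegeneracy

variable {𝕜 : Type v} [RCLike 𝕜] {E₁ E₀ : Type u}
  [NormedAddCommGroup E₁] [NormedSpace 𝕜 E₁] [FiniteDimensional 𝕜 E₁]
  [NormedAddCommGroup E₀] [NormedSpace 𝕜 E₀] [FiniteDimensional 𝕜 E₀]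
  {G M : Type u} [TopologicalSpace G] [ChartedSpace E₁ G] [IsManifold 𝓘(𝕜, E₁) ∞ G]
  [TopologicalSpace M] [ChartedSpace E₀ M] [IsManifold 𝓘(𝕜, E₀) ∞ M]
  {𝒢 : Grpd G M}

/-- On a groupoid with equal source and target, a multiplicative form with injective IM-form is
non-degenerate. -/
theorem IsMultiplicative.nondegenerate (hL : 𝒢.IsLie 𝕜 E₁ E₀) (hst : 𝒢.src = 𝒢.tgt)
    (hdim : Module.finrank 𝕜 E₁ = 2 * Module.finrank 𝕜 E₀) {Ω : DForm 𝕜 E₁ G 2}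
    (hΩ : 𝒢.IsMultiplicative Ω)
    (hinj : ∀ (x : M) (a : E₁), tmap 𝕜 E₁ E₀ 𝒢.src (𝒢.unit x) a = 0 →
      (∀ w, (Ω.at' (𝒢.unit x)).pairing a (tmap 𝕜 E₀ E₁ 𝒢.unit x w) = 0) → a = 0)
    (g : G) {v : E₁} (hv : ∀ b, (Ω.at' g).pairing v b = 0) : v = 0 := by
  obtain ⟨R, hR⟩ := hL.exists_right_translation g
  set x := 𝒢.tgt g
  have hker : ∀ h : G, Module.finrank 𝕜 (LinearMap.ker (tmap 𝕜 E₁ E₀ 𝒢.src h).toLinearMap) =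
      Module.finrank 𝕜 E₀ := fun h => by
    have h1 := LinearMap.finrank_range_add_finrank_ker (tmap 𝕜 E₁ E₀ 𝒢.src h).toLinearMap
    rw [LinearMap.range_eq_top.2 (hL.surjective_tmap_src h), finrank_top] at h1
    omega
  let N := LinearMap.ker (tmap 𝕜 E₁ E₀ 𝒢.src (𝒢.unit x)).toLinearMap
  let σ : N →ₗ[𝕜] Module.Dual 𝕜 E₀ :=
    (LinearMap.lcomp 𝕜 𝕜 (tmap 𝕜 E₀ E₁ 𝒢.unit x).toLinearMap ∘ₗ
      (Ω.at' (𝒢.unit x)).pairing) ∘ₗ N.subtype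
  have hσi : Function.Injective σ := by
    rw [injective_iff_map_eq_zero]
    intro a ha
    exact Subtype.ext (hinj x a.1 a.2 fun w => LinearMap.congr_fun ha w)
  -- The IM-form at `x` is injective between spaces of equal dimension: the algebroid has rank `dim
  -- G - dim M = dim M`.
  have hσs : Function.Surjective σ :=
    (LinearMap.injective_iff_surjective_of_finrank_eq_finrank
      ((hker _).trans Subspace.dual_finrank_eq.symm)).1 hσi
  -- Every covector is some `σ(a)`, and `σ(a)(t_* v) = Ω(R a, v) = 0` because `v` is in the kernel.
  have htv : tmap 𝕜 E₁ E₀ 𝒢.tgt g v = 0 := by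
    rw [← Module.forall_dual_apply_eq_zero_iff 𝕜]
    intro ξ
    obtain ⟨a, rfl⟩ := hσs ξ
    obtain ⟨-, -, -, h4⟩ := hR a.1 a.2
    have := h4 Ω hΩ v
    rw [ContinuousAlternatingMap.pairing_swap, hv, neg_zero] at this
    exact this.symm
  have hsv : tmap 𝕜 E₁ E₀ 𝒢.src g v = 0 := by rw [hst]; exact htv
  have hzero : ∀ a : N, (∀ b, (Ω.at' g).pairing (R a.1) b = 0) → a = 0 := fun a ha => by
    refine Subtype.ext (hinj x a.1 a.2 fun w => ?_)
    obtain ⟨b, rfl⟩ := hL.surjective_tmap_tgt g w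
    rw [← (hR a.1 a.2).2.2.2 Ω hΩ b, ha]
  -- Right translation is injective from the algebroid fibre to the kernel of `s_*` at `g`, hence
  -- bijective by dimension. So `v`, which is killed by `s_*`, is some `R a`, and `σ(a) = 0` forces
  -- `a = 0`.
  let ρ : N →ₗ[𝕜] LinearMap.ker (tmap 𝕜 E₁ E₀ 𝒢.src g).toLinearMap :=
    (R.toLinearMap ∘ₗ N.subtype).codRestrict _ fun a => (hR a.1 a.2).1
  have hρi : Function.Injective ρ := by
    rw [injective_iff_map_eq_zero]
    intro a ha
    have h1 : R a.1 = 0 := congrArg Subtype.val ha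
    exact hzero a fun b => by rw [h1, map_zero, LinearMap.zero_apply]
  obtain ⟨a, ha⟩ := (LinearMap.injective_iff_surjective_of_finrank_eq_finrank
      ((hker _).trans (hker _).symm)).1 hρi ⟨v, hsv⟩
  have ha' : R a.1 = v := congrArg Subtype.val ha
  rw [← ha', hzero a fun b => by rw [ha', hv]]
  exact map_zero R

end Nondegeneracy

variable {𝕜 : Type v} [RCLike 𝕜] {E₁ E₀ E_S E_A F : Type u}
  [NormedAddCommGroup E₁] [NormedSpace 𝕜 E₁] [FiniteDimensional 𝕜 E₁]
  [NormedAddCommGroup E₀] [NormedSpace 𝕜 E₀] [FiniteDimensional 𝕜 E₀]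
  [NormedAddCommGroup E_S] [NormedSpace 𝕜 E_S] [FiniteDimensional 𝕜 E_S]
  [NormedAddCommGroup E_A] [NormedSpace 𝕜 E_A] [FiniteDimensional 𝕜 E_A]
  [NormedAddCommGroup F] [NormedSpace 𝕜 F] [FiniteDimensional 𝕜 F]
  {G M : Type u} [TopologicalSpace G] [ChartedSpace E₁ G] [IsManifold 𝓘(𝕜, E₁) ∞ G]
  [TopologicalSpace M] [ChartedSpace E₀ M] [IsManifold 𝓘(𝕜, E₀) ∞ M]
  {𝒢 : Grpd G M} {S : Set M} [ChartedSpace E_S S] [IsManifold 𝓘(𝕜, E_S) ∞ S]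
  [ChartedSpace E_A (𝒢.RestrictArrows S)] [IsManifold 𝓘(𝕜, E_A) ∞ (𝒢.RestrictArrows S)]

theorem IsAdmissibleGlobalSlice.restrict_src_eq_tgt
    (hS : 𝒢.IsAdmissibleGlobalSlice 𝕜 E₁ E₀ E_S S) :
    (𝒢.restrict S).src = (𝒢.restrict S).tgt :=
  funext fun g => Subtype.ext (hS.tgt_eq_src g.2.1 g.2.2).symm

theorem IsAdmissibleGlobalSlice.isAbelian_restrict
    (hS : 𝒢.IsAdmissibleGlobalSlice 𝕜 E₁ E₀ E_S S) : (𝒢.restrict S).IsAbelian := by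
  refine ⟨hS.restrict_src_eq_tgt, fun x g h h1 h2 h3 h4 => Subtype.ext ?_⟩
  have h1' : 𝒢.src g.1 = x := congrArg Subtype.val h1
  have h2' : 𝒢.tgt g.1 = x := congrArg Subtype.val h2
  have h3' : 𝒢.src h.1 = x := congrArg Subtype.val h3
  have h4' : 𝒢.tgt h.1 = x := congrArg Subtype.val h4
  rw [restrict_mul_val (h1'.trans h4'.symm), restrict_mul_val (h3'.trans h2'.symm)]
  exact hS.abelian x x.2 _ _ h1' h2' h3' h4'

/-- The restriction of a Lie groupoid to a slice is a Lie groupoid. -/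
theorem IsAdmissibleGlobalSlice.isLie_restrict (hL : 𝒢.IsLie 𝕜 E₁ E₀)
    (hS : 𝒢.IsAdmissibleGlobalSlice 𝕜 E₁ E₀ E_S S)
    (hF : Manifold.IsImmersionOfComplement F 𝓘(𝕜, E_S) 𝓘(𝕜, E₀) ∞ (Subtype.val : S → M))
    (hj : HasLocalRetractions 𝕜 E_A E₁ (Subtype.val : 𝒢.RestrictArrows S → G)) :
    (𝒢.restrict S).IsLie 𝕜 E_A E_S := by
  have hi := hF.hasLocalRetractions
  have hsrc : ContMDiff 𝓘(𝕜, E_A) 𝓘(𝕜, E_S) ∞ (𝒢.restrict S).src :=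
    hi.contMDiff_of_isInducing .subtypeVal (hL.contMDiff_src.comp hj.contMDiff)
  have hsub : IsSubmersionMap 𝕜 E_A E_S (𝒢.restrict S).src := by
    refine ⟨hsrc, fun g => ?_⟩
    obtain ⟨U, σ, hU, hgU, hσ, hσg, hσU⟩ := hS.exists_section hL hF g.2.2
    classical
    -- A section of `s` with targets in `S`, restricted to base points in `S`, takes values in the
    -- restricted arrows; it is a local section of the restricted source through `g`. The default
    -- `g` does not occur near the base point.
    let τ : S → 𝒢.RestrictArrows S := fun y =>
      if h : 𝒢.src (σ y) ∈ S ∧ 𝒢.tgt (σ y) ∈ S then ⟨σ y, h⟩ else g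
    let x := (𝒢.restrict S).src g
    have hev : ∀ᶠ y : S in 𝓝 x, (τ y).1 = σ y ∧ 𝒢.src (σ y) = y := by
      filter_upwards [continuous_subtype_val.continuousAt.eventually (hU.mem_nhds hgU)] with y hy
      have h1 : 𝒢.src (σ y) ∈ S ∧ 𝒢.tgt (σ y) ∈ S :=
        ⟨by rw [(hσU y hy).1]; exact y.2, (hσU y hy).2⟩
      exact ⟨by simp only [τ, dif_pos h1], (hσU y hy).1⟩
    have hτ : ContMDiffAt 𝓘(𝕜, E_S) 𝓘(𝕜, E_A) ∞ τ x := by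
      refine hj.contMDiffAt_of_isInducing .subtypeVal ?_
      have h1 : ContMDiffAt 𝓘(𝕜, E_S) 𝓘(𝕜, E₁) ∞ (fun y : S => σ y.1) x :=
        (hσ.contMDiffAt (hU.mem_nhds hgU)).comp x (hi.contMDiff x)
      exact h1.congr_of_eventuallyEq (hev.mono fun y hy => hy.1)
    have hτx : τ x = g := Subtype.ext (hev.self_of_nhds.1.trans hσg)
    intro w
    exact ⟨tmap 𝕜 E_S E_A τ x w, tmap_leftInverse hτx (hτ.mdifferentiableAt (by simp))
      ((hsrc g).mdifferentiableAt (by simp))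
      (hev.mono fun y hy => Subtype.ext ((congrArg 𝒢.src hy.1).trans hy.2)) w⟩
  refine ⟨hsub, hS.restrict_src_eq_tgt ▸ hsub,
    hj.contMDiff_of_isInducing .subtypeVal (hL.unit_smooth.comp hi.contMDiff),
    hj.contMDiff_of_isInducing .subtypeVal (hL.inv_smooth.comp hj.contMDiff),
    hj.contMDiffOn_of_isInducing .subtypeVal ?_⟩
  refine (hL.contMDiffOn_mul (hj.contMDiff.comp contMDiff_fst).contMDiffOn
    (hj.contMDiff.comp contMDiff_snd).contMDiffOn fun p hp => congrArg Subtype.val hp).congr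
    fun p hp => restrict_mul_val (congrArg Subtype.val hp)

theorem IsMultiplicative.restrict (hL' : (𝒢.restrict S).IsLie 𝕜 E_A E_S)
    (hj : HasLocalRetractions 𝕜 E_A E₁ (Subtype.val : 𝒢.RestrictArrows S → G))
    {Ω : DForm 𝕜 E₁ G 2} (hΩ : 𝒢.IsMultiplicative Ω) :
    (𝒢.restrict S).IsMultiplicative
      (DForm.pullback (Subtype.val : 𝒢.RestrictArrows S → G) Ω : DForm 𝕜 E_A _ 2) := by
  intro N a b ha hb hab
  have hjd := hj.contMDiff.mdifferentiable (by simp)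
  rw [← DForm.pullback_comp Ω hjd ((hL'.contMDiff_mul ha hb hab).mdifferentiable (by simp)),
    ← DForm.pullback_comp Ω hjd (ha.mdifferentiable (by simp)),
    ← DForm.pullback_comp Ω hjd (hb.mdifferentiable (by simp)),
    ← hΩ N (fun n => (a n).1) (fun n => (b n).1) (hj.contMDiff.comp ha) (hj.contMDiff.comp hb)
      fun n => congrArg Subtype.val (hab n)]
  congr 1
  funext n
  exact restrict_mul_val (congrArg Subtype.val (hab n))

/-- The IM-form of the restriction to a slice is injective. -/
theorem IsQuasiSymplectic.imForm_restrict_injective {Ω : DForm 𝕜 E₁ G 2} {φ : DForm 𝕜 E₀ M 3}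
    (hG : 𝒢.IsQuasiSymplectic Ω φ) (hS : 𝒢.IsAdmissibleGlobalSlice 𝕜 E₁ E₀ E_S S)
    (hi : HasLocalRetractions 𝕜 E_S E₀ (Subtype.val : S → M))
    (hL' : (𝒢.restrict S).IsLie 𝕜 E_A E_S)
    (hj : HasLocalRetractions 𝕜 E_A E₁ (Subtype.val : 𝒢.RestrictArrows S → G))
    (x : S) (a : E_A) (ha : tmap 𝕜 E_A E_S (𝒢.restrict S).src ((𝒢.restrict S).unit x) a = 0)
    (h : ∀ w, ((DForm.pullback (Subtype.val : 𝒢.RestrictArrows S → G) Ω :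
        DForm 𝕜 E_A _ 2).at' ((𝒢.restrict S).unit x)).pairing a
        (tmap 𝕜 E_S E_A (𝒢.restrict S).unit x w) = 0) : a = 0 := by
  have hL := hG.isLie
  have hjd := hj.contMDiff.mdifferentiable (by simp)
  have hid := hi.contMDiff.mdifferentiable (by simp)
  set e := (𝒢.restrict S).unit x
  have he : e.1 = 𝒢.unit x.1 := rfl
  set a' : E₁ := tmap 𝕜 E_A E₁ (Subtype.val : 𝒢.RestrictArrows S → G) e a with ha'
  have hs : tmap 𝕜 E₁ E₀ 𝒢.src (𝒢.unit x.1) a' = 0 := by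
    rw [ha', ← tmap_comp_apply he (hL.mdifferentiableAt_src _) (hjd e)]
    have := tmap_comp_apply (g := (Subtype.val : S → M)) (f := (𝒢.restrict S).src) (x := e) rfl
      (hid _) (hL'.mdifferentiableAt_src e) a
    rw [ha, map_zero] at this
    exact this
  -- The restricted target is the restricted source, so `a'` is killed by `t_*` as well.
  have ht : tmap 𝕜 E₁ E₀ 𝒢.tgt (𝒢.unit x.1) a' = 0 := by
    rw [ha', ← tmap_comp_apply he (hL.mdifferentiableAt_tgt _) (hjd e)]
    have := tmap_comp_apply (g := (Subtype.val : S → M)) (f := (𝒢.restrict S).tgt) (x := e) rfl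
      (hid _) (hL'.mdifferentiableAt_tgt e) a
    rw [← hS.restrict_src_eq_tgt, ha, map_zero] at this
    rw [hS.restrict_src_eq_tgt] at this
    exact this
  refine hj.injective_tmap e ?_
  rw [map_zero]
  suffices hb : ∀ b : E₁, (Ω.at' (𝒢.unit x.1)).pairing a' b = 0 from
    hG.nondegenerate x.1 a' hb hs ht
  intro b
  -- The pairing of `a'` with `b` depends only on `t_* b`, which splits as a vector `y` of `TS` plus
  -- an anchor value `ρ(c)`. The first part vanishes by hypothesis; the second is `Ω(a', c) = -Ω(c,
  -- u_* t_* a') = 0`.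
  rw [hG.multiplicative.pairing_unit hL x.1 hs]
  obtain ⟨y, c, hc, hy⟩ : ∃ (y : E_S) (c : E₁), tmap 𝕜 E₁ E₀ 𝒢.src (𝒢.unit x.1) c = 0 ∧
      tmap 𝕜 E₁ E₀ 𝒢.tgt (𝒢.unit x.1) b =
        tmap 𝕜 E_S E₀ (Subtype.val : S → M) x y + tmap 𝕜 E₁ E₀ 𝒢.tgt (𝒢.unit x.1) c :=
    hS.transverse x (tmap 𝕜 E₁ E₀ 𝒢.tgt (𝒢.unit x.1) b)
  rw [hy, map_add, map_add, ← hG.multiplicative.pairing_unit hL x.1 hs,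
    ContinuousAlternatingMap.pairing_swap _ a' c, hG.multiplicative.pairing_unit hL x.1 hc, ht,
    map_zero, map_zero, neg_zero, add_zero]
  have h1 := h y
  rw [DForm.pullback_at, ContinuousAlternatingMap.pairing_comp,
    ← tmap_comp_apply (f := (𝒢.restrict S).unit) rfl (hjd e) (hL'.mdifferentiableAt_unit x)] at h1
  rw [← tmap_comp_apply (f := (Subtype.val : S → M)) rfl (hL.mdifferentiableAt_unit x.1) (hid x)]
  exact h1

/-- The restriction of a quasi-symplectic groupoid to a slice is symplectic. -/
theorem IsQuasiSymplectic.isSymplectic_restrict {Ω : DForm 𝕜 E₁ G 2} {φ : DForm 𝕜 E₀ M 3}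
    (hG : 𝒢.IsQuasiSymplectic Ω φ) (hS : 𝒢.IsAdmissibleGlobalSlice 𝕜 E₁ E₀ E_S S)
    (hi : HasLocalRetractions 𝕜 E_S E₀ (Subtype.val : S → M))
    (hL' : (𝒢.restrict S).IsLie 𝕜 E_A E_S)
    (hj : HasLocalRetractions 𝕜 E_A E₁ (Subtype.val : 𝒢.RestrictArrows S → G))
    (hdim : Module.finrank 𝕜 E_A = 2 * Module.finrank 𝕜 E_S) :
    (𝒢.restrict S).IsSymplectic E_S
      (DForm.pullback (Subtype.val : 𝒢.RestrictArrows S → G) Ω : DForm 𝕜 E_A _ 2) := by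
  have hm := hG.multiplicative.restrict hL' hj
  have hnd := hm.nondegenerate hL' hS.restrict_src_eq_tgt hdim
    (hG.imForm_restrict_injective hS hi hL' hj)
  refine ⟨⟨hL', hG.smooth_two.pullback hj.contMDiff, DForm.isSmooth_zero, hm, ?_, DForm.d_zero,
    hdim, fun x a ha _ _ => hnd _ ha⟩, fun g a ha => hnd g ha⟩
  have hjd := hj.contMDiff.mdifferentiable (by simp)
  -- The differential of the restricted form is the restriction of `s^*φ - t^*φ`, and `s = t` there.
  rw [DForm.d_pullback hj.contMDiff hG.smooth_two, hG.d_two, DForm.pullback_sub,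
    ← DForm.pullback_comp φ (hG.isLie.contMDiff_src.mdifferentiable (by simp)) hjd,
    ← DForm.pullback_comp φ (hG.isLie.contMDiff_tgt.mdifferentiable (by simp)) hjd,
    DForm.pullback_zero, DForm.pullback_zero, sub_self]
  have : (fun g : 𝒢.RestrictArrows S => 𝒢.src g.1) = fun g => 𝒢.tgt g.1 :=
    funext fun g => (hS.tgt_eq_src g.2.1 g.2.2).symm
  rw [this, sub_self]

end Grpd

/-! ### Pullback groupoids along étale maps -/

namespace Grpd

section Algebra

variable {G M X : Type u} (𝒢 : Grpd G M)

theorem inv_mul_cancel_left {g h : G} (c : 𝒢.src g = 𝒢.tgt h) :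
    𝒢.mul (𝒢.inv g) (𝒢.mul g h) = h := by
  rw [← 𝒢.mul_assoc _ _ _ (𝒢.src_inv g) c, 𝒢.inv_mul, c, 𝒢.unit_mul]

theorem mul_inv_cancel_left {g h : G} (c : 𝒢.tgt g = 𝒢.tgt h) :
    𝒢.mul g (𝒢.mul (𝒢.inv g) h) = h := by
  rw [← 𝒢.mul_assoc _ _ _ (𝒢.tgt_inv g).symm ((𝒢.src_inv g).trans c), 𝒢.mul_inv, c, 𝒢.unit_mul]

theorem mul_inv_cancel_right {g h : G} (c : 𝒢.src g = 𝒢.tgt h) :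
    𝒢.mul (𝒢.mul g h) (𝒢.inv h) = g := by
  rw [𝒢.mul_assoc _ _ _ c (𝒢.tgt_inv h).symm, 𝒢.mul_inv, ← c, 𝒢.mul_unit]

theorem inv_mul_cancel_right {g h : G} (c : 𝒢.src g = 𝒢.src h) :
    𝒢.mul (𝒢.mul g (𝒢.inv h)) h = g := by
  rw [𝒢.mul_assoc _ _ _ (c.trans (𝒢.tgt_inv h).symm) (𝒢.src_inv h), 𝒢.inv_mul, ← c, 𝒢.mul_unit]

open Classical in
/-- The pullback of a groupoid along a map to its objects. -/
noncomputable def pullbackGrpd (p : X → M) : Grpd (𝒢.pullbackArrows p) X where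
  src q := q.1.1
  tgt q := q.1.2.2
  unit x := ⟨(x, 𝒢.unit (p x), x), (𝒢.src_unit _).symm, 𝒢.tgt_unit _⟩
  inv q := ⟨(q.1.2.2, 𝒢.inv q.1.2.1, q.1.1), q.2.2.symm.trans (𝒢.src_inv _).symm,
    (𝒢.tgt_inv _).trans q.2.1.symm⟩
  mul q r := if c : q.1.1 = r.1.2.2 then
    ⟨(r.1.1, 𝒢.mul q.1.2.1 r.1.2.1, q.1.2.2),
      have c' : 𝒢.src q.1.2.1 = 𝒢.tgt r.1.2.1 := by rw [← q.2.1, r.2.2, c]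
      ⟨r.2.1.trans (𝒢.src_mul _ _ c').symm, (𝒢.tgt_mul _ _ c').trans q.2.2⟩⟩ else q
  src_unit x := rfl
  tgt_unit x := rfl
  src_inv q := rfl
  tgt_inv q := rfl
  src_mul q r c := by simp only [dif_pos c]
  tgt_mul q r c := by simp only [dif_pos c]
  mul_assoc q r s c₁ c₂ := by
    have c₁' : 𝒢.src q.1.2.1 = 𝒢.tgt r.1.2.1 := by rw [← q.2.1, r.2.2, c₁]
    have c₂' : 𝒢.src r.1.2.1 = 𝒢.tgt s.1.2.1 := by rw [← r.2.1, s.2.2, c₂]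
    apply Subtype.ext
    simp only [dif_pos c₁, dif_pos c₂]
    exact Prod.ext rfl (Prod.ext (𝒢.mul_assoc _ _ _ c₁' c₂') rfl)
  mul_unit q := by
    apply Subtype.ext
    simp only [dif_pos]
    refine Prod.ext rfl (Prod.ext ?_ rfl)
    change 𝒢.mul q.1.2.1 (𝒢.unit (p q.1.1)) = _
    rw [q.2.1, 𝒢.mul_unit]
  unit_mul q := by
    apply Subtype.ext
    simp only [dif_pos]
    refine Prod.ext rfl (Prod.ext ?_ rfl)
    change 𝒢.mul (𝒢.unit (p q.1.2.2)) q.1.2.1 = _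
    rw [← q.2.2, 𝒢.unit_mul]
  mul_inv q := by
    apply Subtype.ext
    simp only [dif_pos]
    refine Prod.ext rfl (Prod.ext ?_ rfl)
    change 𝒢.mul q.1.2.1 (𝒢.inv q.1.2.1) = 𝒢.unit (p q.1.2.2)
    rw [← q.2.2, 𝒢.mul_inv]
  inv_mul q := by
    apply Subtype.ext
    simp only [dif_pos]
    refine Prod.ext rfl (Prod.ext ?_ rfl)
    change 𝒢.mul (𝒢.inv q.1.2.1) q.1.2.1 = 𝒢.unit (p q.1.1)
    rw [q.2.1, 𝒢.inv_mul]

/-- The morphism from the pullback groupoid on arrows. -/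
def pullbackArrow (p : X → M) (q : 𝒢.pullbackArrows p) : G := q.1.2.1

theorem pullbackGrpd_mul_val {p : X → M} {q r : 𝒢.pullbackArrows p} (c : q.1.1 = r.1.2.2) :
    ((𝒢.pullbackGrpd p).mul q r).1 = (r.1.1, 𝒢.mul q.1.2.1 r.1.2.1, q.1.2.2) := by
  simp only [pullbackGrpd, dif_pos c]

theorem src_pullbackArrow (p : X → M) (q : 𝒢.pullbackArrows p) :
    𝒢.src (𝒢.pullbackArrow p q) = p ((𝒢.pullbackGrpd p).src q) := q.2.1.symm

theorem tgt_pullbackArrow (p : X → M) (q : 𝒢.pullbackArrows p) :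
    𝒢.tgt (𝒢.pullbackArrow p q) = p ((𝒢.pullbackGrpd p).tgt q) := q.2.2

theorem pullbackArrow_mul {p : X → M} {q r : 𝒢.pullbackArrows p} (c : q.1.1 = r.1.2.2) :
    𝒢.pullbackArrow p ((𝒢.pullbackGrpd p).mul q r) =
      𝒢.mul (𝒢.pullbackArrow p q) (𝒢.pullbackArrow p r) :=
  congrArg (fun s : X × G × X => s.2.1) (𝒢.pullbackGrpd_mul_val c)

end Algebra

section Topology

variable {G M X : Type u} [TopologicalSpace G] [TopologicalSpace M] [TopologicalSpace X]
  {𝒢 : Grpd G M} {p : X → M}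

/-- Near a given point the endpoints in `X` are recovered from the arrow by local inverses of `p`,
applied to its source and target. This makes the pullback groupoid a manifold étale over `G`,
without constructing a fibre product. -/
theorem isLocalHomeomorph_pullbackArrow (hp : IsLocalHomeomorph p) (hs : Continuous 𝒢.src)
    (ht : Continuous 𝒢.tgt) : IsLocalHomeomorph (𝒢.pullbackArrow p) := by
  classical
  intro z
  obtain ⟨e, hze, he⟩ := hp z.1.1
  obtain ⟨e', hze', he'⟩ := hp z.1.2.2
  have hmem : ∀ g, 𝒢.src g ∈ e.target ∧ 𝒢.tgt g ∈ e'.target →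
      (e.symm (𝒢.src g), g, e'.symm (𝒢.tgt g)) ∈ 𝒢.pullbackArrows p := fun g hg =>
    ⟨by rw [he]; exact e.right_inv hg.1, by rw [he']; exact (e'.right_inv hg.2).symm⟩
  let r : G → 𝒢.pullbackArrows p := fun g =>
    if h : 𝒢.src g ∈ e.target ∧ 𝒢.tgt g ∈ e'.target then ⟨_, hmem g h⟩ else z
  have hr : ∀ g, 𝒢.src g ∈ e.target ∧ 𝒢.tgt g ∈ e'.target →
      (r g).1 = (e.symm (𝒢.src g), g, e'.symm (𝒢.tgt g)) := fun g hg => by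
    simp only [r, dif_pos hg]
  have hsrc : ∀ q : 𝒢.pullbackArrows p, 𝒢.src q.1.2.1 = e q.1.1 := fun q => by
    rw [← he]; exact q.2.1.symm
  have htgt : ∀ q : 𝒢.pullbackArrows p, 𝒢.tgt q.1.2.1 = e' q.1.2.2 := fun q => by
    rw [← he']; exact q.2.2
  have hto : ∀ q : 𝒢.pullbackArrows p, q.1.1 ∈ e.source ∧ q.1.2.2 ∈ e'.source →
      𝒢.src q.1.2.1 ∈ e.target ∧ 𝒢.tgt q.1.2.1 ∈ e'.target := fun q hq => by
    rw [hsrc, htgt]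
    exact ⟨e.map_source hq.1, e'.map_source hq.2⟩
  refine ⟨⟨⟨⟨𝒢.pullbackArrow p, r, {q | q.1.1 ∈ e.source ∧ q.1.2.2 ∈ e'.source},
    {g | 𝒢.src g ∈ e.target ∧ 𝒢.tgt g ∈ e'.target}, hto, fun g hg => ?_, fun q hq => ?_,
    fun g hg => ?_⟩, ?_, ?_⟩, ?_, ?_⟩, ⟨hze, hze'⟩, rfl⟩
  · change (r g).1.1 ∈ e.source ∧ (r g).1.2.2 ∈ e'.source
    rw [hr g hg]
    exact ⟨e.map_target hg.1, e'.map_target hg.2⟩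
  · apply Subtype.ext
    refine (hr _ (hto q hq)).trans ?_
    refine Prod.ext ?_ (Prod.ext rfl ?_)
    · change e.symm (𝒢.src q.1.2.1) = _
      rw [hsrc, e.left_inv hq.1]
    · change e'.symm (𝒢.tgt q.1.2.1) = _
      rw [htgt, e'.left_inv hq.2]
  · change (r g).1.2.1 = g
    rw [hr g hg]
  · have h1 : Continuous fun q : 𝒢.pullbackArrows p => q.1.2.1 := by fun_prop
    exact h1.continuousOn
  · rw [Topology.IsInducing.subtypeVal.continuousOn_iff]
    refine ContinuousOn.congr ?_ hr
    exact (e.continuousOn_symm.comp hs.continuousOn fun g hg => hg.1).prodMk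
      (continuousOn_id.prodMk (e'.continuousOn_symm.comp ht.continuousOn fun g hg => hg.2))
  · exact (e.open_source.preimage (by fun_prop)).inter (e'.open_source.preimage (by fun_prop))
  · exact (e.open_target.preimage hs).inter (e'.open_target.preimage ht)

end Topology

section Lie

variable {𝕜 : Type v} [RCLike 𝕜] {E₁ E₀ : Type u}
  [NormedAddCommGroup E₁] [NormedSpace 𝕜 E₁] [NormedAddCommGroup E₀] [NormedSpace 𝕜 E₀]
  {G M X : Type u} [TopologicalSpace G] [ChartedSpace E₁ G] [TopologicalSpace M]
  [ChartedSpace E₀ M] [TopologicalSpace X] [ChartedSpace E₀ X]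
  {𝒢 : Grpd G M} {p : X → M} [ChartedSpace E₁ (𝒢.pullbackArrows p)]

/-- The differential of `s'` is that of `s` up to the isomorphisms given by the two étale maps.
Stated for a general `s` to serve for both source and target. -/
theorem pullbackGrpd_isSubmersionMap (hp : IsEtaleMap 𝕜 E₀ E₀ p)
    (hq : IsEtaleMap 𝕜 E₁ E₁ (𝒢.pullbackArrow p)) {s : G → M} (hs : IsSubmersionMap 𝕜 E₁ E₀ s)
    {s' : 𝒢.pullbackArrows p → X} (hs' : Continuous s')
    (h : ∀ q, s (𝒢.pullbackArrow p q) = p (s' q)) : IsSubmersionMap 𝕜 E₁ E₀ s' := by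
  have h1 : (fun q => p (s' q)) = fun q => s (𝒢.pullbackArrow p q) := funext fun q => (h q).symm
  have hs'' : ContMDiff 𝓘(𝕜, E₁) 𝓘(𝕜, E₀) ∞ s' :=
    hp.hasLocalRetractions.contMDiff_of_comp hs' (by rw [h1]; exact hs.1.comp hq.contMDiff)
  refine ⟨hs'', fun q w => ?_⟩
  obtain ⟨b, hb⟩ := hs.2 (𝒢.pullbackArrow p q) (tmap 𝕜 E₀ E₀ p (s' q) w)
  obtain ⟨a, rfl⟩ := (hq.bijective_tmap q).2 b
  refine ⟨a, (hp.bijective_tmap (s' q)).1 ?_⟩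
  have h2 := tmap_comp_apply (g := p) (f := s') (x := q) rfl
    ((hp.contMDiff _).mdifferentiableAt (by simp)) ((hs'' q).mdifferentiableAt (by simp)) a
  have h3 := tmap_comp_apply (g := s) (f := 𝒢.pullbackArrow p) (x := q) rfl
    ((hs.1 _).mdifferentiableAt (by simp)) ((hq.contMDiff q).mdifferentiableAt (by simp)) a
  rw [h1] at h2
  exact (h2.symm.trans h3).trans hb

/-- The pullback of a Lie groupoid along an étale map is a Lie groupoid. -/
theorem IsLie.pullbackGrpd (hL : 𝒢.IsLie 𝕜 E₁ E₀) (hp : IsEtaleMap 𝕜 E₀ E₀ p)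
    (hq : IsEtaleMap 𝕜 E₁ E₁ (𝒢.pullbackArrow p)) :
    (𝒢.pullbackGrpd p).IsLie 𝕜 E₁ E₀ := by
  have hpc := hp.contMDiff.continuous
  have hu := hL.unit_smooth.continuous
  have hi := hL.inv_smooth.continuous
  have hr := hq.hasLocalRetractions
  have hm : ContMDiffOn (𝓘(𝕜, E₁).prod 𝓘(𝕜, E₁)) 𝓘(𝕜, E₁) ∞
      (fun r : 𝒢.pullbackArrows p × 𝒢.pullbackArrows p =>
        𝒢.mul (𝒢.pullbackArrow p r.1) (𝒢.pullbackArrow p r.2))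
      {r | (𝒢.pullbackGrpd p).src r.1 = (𝒢.pullbackGrpd p).tgt r.2} :=
    hL.contMDiffOn_mul (hq.contMDiff.comp contMDiff_fst).contMDiffOn
      (hq.contMDiff.comp contMDiff_snd).contMDiffOn fun r hr => by
        rw [src_pullbackArrow, tgt_pullbackArrow, hr]
  refine ⟨pullbackGrpd_isSubmersionMap hp hq hL.src_submersion
    (continuous_fst.comp continuous_subtype_val) (𝒢.src_pullbackArrow p),
    pullbackGrpd_isSubmersionMap hp hq hL.tgt_submersion
    ((continuous_snd.comp continuous_snd).comp continuous_subtype_val) (𝒢.tgt_pullbackArrow p),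
    hr.contMDiff_of_comp ?_ (hL.unit_smooth.comp hp.contMDiff),
    hr.contMDiff_of_comp ?_ (hL.inv_smooth.comp hq.contMDiff),
    hr.contMDiffOn ?_ (hm.congr fun r hr => 𝒢.pullbackArrow_mul hr)⟩
  · exact Topology.IsInducing.subtypeVal.continuous_iff.2
      (continuous_id.prodMk ((hu.comp hpc).prodMk continuous_id))
  · refine Topology.IsInducing.subtypeVal.continuous_iff.2 ?_
    change Continuous fun q : 𝒢.pullbackArrows p => (q.1.2.2, 𝒢.inv q.1.2.1, q.1.1)
    fun_prop
  · refine Topology.IsInducing.subtypeVal.continuousOn_iff.2 ?_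
    refine ContinuousOn.congr ?_ fun r hr => 𝒢.pullbackGrpd_mul_val hr
    exact (Continuous.continuousOn (by fun_prop)).prodMk
      (hm.continuousOn.prodMk (Continuous.continuousOn (by fun_prop)))

-- The comparison map to the arrows of `p^*𝒢` is the inclusion of the underlying subset, so its
-- inverse is tautological, extended by a default off that subset.
open Classical in
theorem isMoritaMorphism_pullbackArrow (hp : IsEtaleMap 𝕜 E₀ E₀ p)
    (hsurj : Function.Surjective p) (hq : IsEtaleMap 𝕜 E₁ E₁ (𝒢.pullbackArrow p)) :
    IsMoritaMorphism 𝕜 E₁ E₀ E₁ E₀ (𝒢.pullbackGrpd p) 𝒢 (𝒢.pullbackArrow p) p := by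
  refine ⟨⟨hq.contMDiff, hp.contMDiff, 𝒢.src_pullbackArrow p, 𝒢.tgt_pullbackArrow p,
    fun h k c => 𝒢.pullbackArrow_mul c⟩, hsurj,
    ⟨hp.contMDiff, fun x => (hp.bijective_tmap x).2⟩,
    fun q => if h : q ∈ 𝒢.pullbackArrows p then ⟨q, h⟩ else
      (𝒢.pullbackGrpd p).unit q.1, ?_, fun h => dif_pos h.2, fun q hq => ?_⟩
  · refine hq.hasLocalRetractions.contMDiffOn ?_ ?_
    · refine Topology.IsInducing.subtypeVal.continuousOn_iff.2 (continuousOn_id.congr ?_)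
      intro q hq
      simp [hq]
    · refine ContMDiff.contMDiffOn (contMDiff_fst.comp contMDiff_snd) |>.congr ?_
      intro q hq
      simp only [dif_pos hq]
      rfl
  · simp only [dif_pos hq]
    rfl

end Lie

end Grpd

/-! ### Étale covers that carry sections into the slice -/

theorem isLocalHomeomorph_sigma_subtypeVal {ι M : Type*} [TopologicalSpace M] {U : ι → Set M}
    (hU : ∀ i, IsOpen (U i)) : IsLocalHomeomorph fun q : (i : ι) × U i => q.2.1 := by
  refine IsLocalHomeomorph.mk _ ?_
  rintro ⟨i, y⟩
  have : Nonempty (U i) := ⟨y⟩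
  let e := (IsOpenEmbedding.sigmaMk (σ := fun i => U i) (i := i)).toOpenPartialHomeomorph
  let e' := (hU i).isOpenEmbedding_subtypeVal.toOpenPartialHomeomorph
  refine ⟨e.symm.trans e', ?_, ?_⟩
  · simp [e, e']
  · rintro q hq
    rw [OpenPartialHomeomorph.trans_source] at hq
    obtain ⟨y', rfl⟩ : ∃ y', e y' = q := ⟨e.symm q, e.right_inv hq.1⟩
    change (e y').2.1 = (e.symm (e y')).1
    rw [e.left_inv (by simp [e])]
    rfl

/-- Local sections of a submersion. -/
theorem exists_local_section {𝕜 : Type*} [RCLike 𝕜] {E E' : Type*}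
    [NormedAddCommGroup E] [NormedSpace 𝕜 E] [FiniteDimensional 𝕜 E]
    [NormedAddCommGroup E'] [NormedSpace 𝕜 E'] [FiniteDimensional 𝕜 E']
    {G M : Type*} [TopologicalSpace G] [ChartedSpace E G] [IsManifold 𝓘(𝕜, E) ∞ G]
    [TopologicalSpace M] [ChartedSpace E' M] [IsManifold 𝓘(𝕜, E') ∞ M]
    {f : G → M} (hf : ContMDiff 𝓘(𝕜, E) 𝓘(𝕜, E') ∞ f) {g : G}
    (hs : Function.Surjective (tmap 𝕜 E E' f g)) :
    ∃ τ : M → G, ContMDiffAt 𝓘(𝕜, E') 𝓘(𝕜, E) ∞ τ (f g) ∧ τ (f g) = g ∧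
      ∀ᶠ y in 𝓝 (f g), f (τ y) = y := by
  let χ := chartAt E' (f g)
  have hxs : f g ∈ χ.source := mem_chart_source E' _
  have hχ : ContMDiffOn 𝓘(𝕜, E') 𝓘(𝕜, E') ∞ χ χ.source :=
    contMDiffOn_chart (I := 𝓘(𝕜, E')) (x := f g)
  have hO : IsOpen (f ⁻¹' χ.source) := χ.open_source.preimage hf.continuous
  have hfO : ContMDiffOn 𝓘(𝕜, E) 𝓘(𝕜, E') ∞ (fun h => χ (f h)) (f ⁻¹' χ.source) :=
    hχ.comp hf.contMDiffOn fun h hh => hh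
  have hsurj : Function.Surjective (tmap 𝕜 E E' (fun h => χ (f h)) g) := by
    intro w
    obtain ⟨z, hz⟩ := hs (tmap 𝕜 E' E' χ.symm (χ (f g)) w)
    refine ⟨z, ?_⟩
    rw [tmap_comp_apply rfl (mdifferentiableAt_chartAt hxs) ((hf g).mdifferentiableAt (by simp)),
      hz]
    have h3 := tmap_chartAt_tmap_chartAt_symm (𝕜 := 𝕜) (mem_chart_target E' (f g)) w
    rwa [χ.left_inv hxs] at h3
  let K := LinearMap.ker (tmap 𝕜 E E' (fun h => χ (f h)) g).toLinearMap
  have hK : Module.finrank 𝕜 E' + Module.finrank 𝕜 K = Module.finrank 𝕜 E := by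
    have h1 := LinearMap.finrank_range_add_finrank_ker
      (tmap 𝕜 E E' (fun h => χ (f h)) g).toLinearMap
    rwa [LinearMap.range_eq_top.2 hsurj, finrank_top] at h1
  obtain ⟨e, hge, heO, hef, he, he'⟩ := exists_straightening_chart hO hxs hfO hsurj hK
  let b : M → E' × K := fun y => (χ y, (e g).2)
  have hbg : b (f g) = e g := Prod.ext (hef g hge).symm rfl
  have hb : ContMDiffAt 𝓘(𝕜, E') 𝓘(𝕜, E' × K) ∞ b (f g) :=
    (hχ.contMDiffAt (χ.open_source.mem_nhds hxs)).prodMk_space contMDiffAt_const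
  have hbt : b (f g) ∈ e.target := by rw [hbg]; exact e.map_source hge
  refine ⟨fun y => e.symm (b y),
    (he'.contMDiffAt (e.open_target.mem_nhds hbt)).comp (f g) hb, ?_, ?_⟩
  · simp only [hbg, e.left_inv hge]
  · filter_upwards [hb.continuousAt.eventually (e.open_target.mem_nhds hbt),
      χ.open_source.mem_nhds hxs] with y hy hyχ
    have h1 := e.map_target hy
    have h2 := hef _ h1
    rw [e.right_inv hy] at h2
    exact (χ.injOn hyχ (heO h1) h2).symm

namespace Grpd

variable {𝕜 : Type v} [RCLike 𝕜] {E₁ E₀ E_S F : Type u}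
  [NormedAddCommGroup E₁] [NormedSpace 𝕜 E₁] [FiniteDimensional 𝕜 E₁]
  [NormedAddCommGroup E₀] [NormedSpace 𝕜 E₀] [FiniteDimensional 𝕜 E₀]
  [NormedAddCommGroup E_S] [NormedSpace 𝕜 E_S] [FiniteDimensional 𝕜 E_S]
  [NormedAddCommGroup F] [NormedSpace 𝕜 F] [FiniteDimensional 𝕜 F]
  {G M : Type u} [TopologicalSpace G] [ChartedSpace E₁ G] [IsManifold 𝓘(𝕜, E₁) ∞ G]
  [TopologicalSpace M] [T2Space M] [SecondCountableTopology M]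
  [ChartedSpace E₀ M] [IsManifold 𝓘(𝕜, E₀) ∞ M]
  {𝒢 : Grpd G M} {S : Set M} [ChartedSpace E_S S] [IsManifold 𝓘(𝕜, E_S) ∞ S]

/-- After an étale base change, there is a global section of the source map with target in the
slice. -/
theorem IsAdmissibleGlobalSlice.exists_etale_section (hL : 𝒢.IsLie 𝕜 E₁ E₀)
    (hS : 𝒢.IsAdmissibleGlobalSlice 𝕜 E₁ E₀ E_S S)
    (hF : Manifold.IsImmersionOfComplement F 𝓘(𝕜, E_S) 𝓘(𝕜, E₀) ∞ (Subtype.val : S → M)) :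
    ∃ (X : Type u) (_ : TopologicalSpace X) (_ : T2Space X) (_ : SecondCountableTopology X)
      (_ : ChartedSpace E₀ X) (_ : IsManifold 𝓘(𝕜, E₀) ∞ X) (p : X → M) (σ : X → G),
      IsLocalHomeomorph p ∧ IsEtaleMap 𝕜 E₀ E₀ p ∧ Function.Surjective p ∧
      ContMDiff 𝓘(𝕜, E₀) 𝓘(𝕜, E₁) ∞ σ ∧ (∀ x, 𝒢.src (σ x) = p x) ∧ ∀ x, 𝒢.tgt (σ x) ∈ S := by
  -- Some arrow joins `y` to a point of `S`; a local section of `s` passes through it.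
  have hloc : ∀ y : M, ∃ (U : Set M) (σ : M → G), IsOpen U ∧ y ∈ U ∧
      ContMDiffOn 𝓘(𝕜, E₀) 𝓘(𝕜, E₁) ∞ σ U ∧ ∀ z ∈ U, 𝒢.src (σ z) = z ∧ 𝒢.tgt (σ z) ∈ S := by
    intro y
    obtain ⟨x, ⟨hx, g, rfl, rfl⟩, -⟩ := hS.meets_once y
    obtain ⟨U, σ, h1, h2, h3, -, h4⟩ := hS.exists_section hL hF hx
    exact ⟨U, σ, h1, h2, h3, h4⟩
  choose U σ hU hyU hσ hσU using hloc
  -- A countable subcover keeps the disjoint union second countable.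
  obtain ⟨s, hs, hcov⟩ := TopologicalSpace.countable_cover_nhds fun y => (hU y).mem_nhds (hyU y)
  have : Countable s := hs
  let X := (i : s) × U i.1
  let p : X → M := fun q => q.2.1
  have hp : IsLocalHomeomorph p := isLocalHomeomorph_sigma_subtypeVal fun i => hU i.1
  obtain ⟨cs, hm, het⟩ := exists_manifold_of_isLocalHomeomorph (𝕜 := 𝕜) (E' := E₀) hp
  refine ⟨X, inferInstance, inferInstance, inferInstance, cs, hm, p, fun q => σ q.1 q.2.1, hp, het,
    fun y => ?_, ?_, fun q => (hσU _ _ q.2.2).1, fun q => (hσU _ _ q.2.2).2⟩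
  · have hy : y ∈ ⋃ x ∈ s, U x := hcov ▸ mem_univ y
    obtain ⟨i, hi, hyi⟩ := mem_iUnion₂.1 hy
    exact ⟨⟨⟨i, hi⟩, ⟨y, hyi⟩⟩, rfl⟩
  · rintro ⟨i, y⟩
    have h1 : ContMDiffAt 𝓘(𝕜, E₀) 𝓘(𝕜, E₁) ∞ (fun q => σ i (p q)) ⟨i, y⟩ :=
      ContMDiffAt.comp (f := p) (x := ⟨i, y⟩) ((hσ i).contMDiffAt ((hU i).mem_nhds y.2))
        (het.contMDiff _)
    refine h1.congr_of_eventuallyEq ?_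
    filter_upwards [(isOpen_range_sigmaMk (σ := fun i : s => U i.1) (i := i)).mem_nhds ⟨y, rfl⟩]
    rintro _ ⟨z, rfl⟩
    rfl

end Grpd

/-! ### The conjugation morphism to the slice groupoid -/

namespace Grpd

/-- A family `σ` of arrows, with sources given by `p` and targets in `S`. -/
structure IsSliceSection {G M X : Type u} (𝒢 : Grpd G M) (S : Set M) (p : X → M) (σ : X → G) :
    Prop where
  src_eq : ∀ x, 𝒢.src (σ x) = p x
  tgt_mem : ∀ x, 𝒢.tgt (σ x) ∈ S

namespace IsSliceSection

section Algebra

variable {G M X : Type u} {𝒢 : Grpd G M} {S : Set M} {p : X → M} {σ : X → G}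

/-- The map on objects given by the targets. -/
def base (h : 𝒢.IsSliceSection S p σ) (x : X) : S := ⟨𝒢.tgt (σ x), h.tgt_mem x⟩

theorem composable_left (h : 𝒢.IsSliceSection S p σ) (q : 𝒢.pullbackArrows p) :
    𝒢.src (σ q.1.2.2) = 𝒢.tgt q.1.2.1 := (h.src_eq _).trans q.2.2.symm

theorem composable_right (h : 𝒢.IsSliceSection S p σ) (q : 𝒢.pullbackArrows p) :
    𝒢.src q.1.2.1 = 𝒢.tgt (𝒢.inv (σ q.1.1)) := by
  rw [𝒢.tgt_inv, h.src_eq]; exact q.2.1.symm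

theorem composable (h : 𝒢.IsSliceSection S p σ) (q : 𝒢.pullbackArrows p) :
    𝒢.src (𝒢.mul (σ q.1.2.2) q.1.2.1) = 𝒢.tgt (𝒢.inv (σ q.1.1)) :=
  (𝒢.src_mul _ _ (h.composable_left q)).trans (h.composable_right q)

theorem src_conj (h : 𝒢.IsSliceSection S p σ) (q : 𝒢.pullbackArrows p) :
    𝒢.src (𝒢.mul (𝒢.mul (σ q.1.2.2) q.1.2.1) (𝒢.inv (σ q.1.1))) = 𝒢.tgt (σ q.1.1) :=
  (𝒢.src_mul _ _ (h.composable q)).trans (𝒢.src_inv _)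

theorem tgt_conj (h : 𝒢.IsSliceSection S p σ) (q : 𝒢.pullbackArrows p) :
    𝒢.tgt (𝒢.mul (𝒢.mul (σ q.1.2.2) q.1.2.1) (𝒢.inv (σ q.1.1))) = 𝒢.tgt (σ q.1.2.2) :=
  (𝒢.tgt_mul _ _ (h.composable q)).trans (𝒢.tgt_mul _ _ (h.composable_left q))

/-- The map on arrows given by conjugation. -/
def arrow (h : 𝒢.IsSliceSection S p σ) (q : 𝒢.pullbackArrows p) : 𝒢.RestrictArrows S :=
  ⟨𝒢.mul (𝒢.mul (σ q.1.2.2) q.1.2.1) (𝒢.inv (σ q.1.1)),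
    by rw [h.src_conj]; exact h.tgt_mem _, by rw [h.tgt_conj]; exact h.tgt_mem _⟩

theorem src_arrow (h : 𝒢.IsSliceSection S p σ) (q : 𝒢.pullbackArrows p) :
    (𝒢.restrict S).src (h.arrow q) = h.base ((𝒢.pullbackGrpd p).src q) :=
  Subtype.ext (h.src_conj q)

theorem tgt_arrow (h : 𝒢.IsSliceSection S p σ) (q : 𝒢.pullbackArrows p) :
    (𝒢.restrict S).tgt (h.arrow q) = h.base ((𝒢.pullbackGrpd p).tgt q) :=
  Subtype.ext (h.tgt_conj q)

theorem arrow_unit (h : 𝒢.IsSliceSection S p σ) (x : X) :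
    h.arrow ((𝒢.pullbackGrpd p).unit x) = (𝒢.restrict S).unit (h.base x) := by
  apply Subtype.ext
  change 𝒢.mul (𝒢.mul (σ x) (𝒢.unit (p x))) (𝒢.inv (σ x)) = 𝒢.unit (𝒢.tgt (σ x))
  rw [← h.src_eq, 𝒢.mul_unit, 𝒢.mul_inv]

theorem arrow_mul (h : 𝒢.IsSliceSection S p σ) {q r : 𝒢.pullbackArrows p} (c : q.1.1 = r.1.2.2) :
    h.arrow ((𝒢.pullbackGrpd p).mul q r) = (𝒢.restrict S).mul (h.arrow q) (h.arrow r) := by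
  have hqr : 𝒢.src (h.arrow q).1 = 𝒢.tgt (h.arrow r).1 :=
    (h.src_conj q).trans ((congrArg (fun x => 𝒢.tgt (σ x)) c).trans (h.tgt_conj r).symm)
  have hc : 𝒢.src q.1.2.1 = 𝒢.tgt r.1.2.1 := by rw [← q.2.1, r.2.2, c]
  apply Subtype.ext
  rw [restrict_mul_val hqr]
  change 𝒢.mul (𝒢.mul (σ ((𝒢.pullbackGrpd p).mul q r).1.2.2)
      ((𝒢.pullbackGrpd p).mul q r).1.2.1) (𝒢.inv (σ ((𝒢.pullbackGrpd p).mul q r).1.1)) =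
    𝒢.mul (𝒢.mul (𝒢.mul (σ q.1.2.2) q.1.2.1) (𝒢.inv (σ q.1.1)))
      (𝒢.mul (𝒢.mul (σ r.1.2.2) r.1.2.1) (𝒢.inv (σ r.1.1)))
  rw [𝒢.pullbackGrpd_mul_val c]
  have h1 := h.composable q
  have h2 := h.composable r
  have h3 := h.composable_left q
  have h4 := h.composable_left r
  have h5 := h.composable_right r
  simp only [c] at h1 ⊢
  -- The inner factors `σ⁻¹ σ` at the common middle object cancel; the rest is reassociation.
  rw [𝒢.mul_assoc _ _ _ h1 (by rw [𝒢.src_inv, 𝒢.tgt_mul _ _ h2, 𝒢.tgt_mul _ _ h4]),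
    ← 𝒢.mul_assoc _ _ _ (by rw [𝒢.src_inv, 𝒢.tgt_mul _ _ h4]) h2,
    𝒢.inv_mul_cancel_left h4, ← 𝒢.mul_assoc _ _ _ (by rw [𝒢.src_mul _ _ h3, hc]) h5,
    𝒢.mul_assoc _ _ _ h3 hc]

theorem mem_pullbackArrows (h : 𝒢.IsSliceSection S p σ) {q : X × 𝒢.RestrictArrows S × X}
    (hq : q ∈ (𝒢.restrict S).pullbackArrows h.base) :
    (q.1, 𝒢.mul (𝒢.mul (𝒢.inv (σ q.2.2)) q.2.1.1) (σ q.1), q.2.2) ∈ 𝒢.pullbackArrows p := by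
  have h1 : 𝒢.tgt (σ q.1) = 𝒢.src q.2.1.1 := congrArg Subtype.val hq.1
  have h2 : 𝒢.tgt q.2.1.1 = 𝒢.tgt (σ q.2.2) := congrArg Subtype.val hq.2
  have h3 : 𝒢.src (𝒢.inv (σ q.2.2)) = 𝒢.tgt q.2.1.1 := (𝒢.src_inv _).trans h2.symm
  have h4 : 𝒢.src (𝒢.mul (𝒢.inv (σ q.2.2)) q.2.1.1) = 𝒢.tgt (σ q.1) :=
    (𝒢.src_mul _ _ h3).trans h1.symm
  constructor
  · change p q.1 = _
    rw [𝒢.src_mul _ _ h4, h.src_eq]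
  · change _ = p q.2.2
    rw [𝒢.tgt_mul _ _ h4, 𝒢.tgt_mul _ _ h3, 𝒢.tgt_inv, h.src_eq]

theorem conj_inv_conj (h : 𝒢.IsSliceSection S p σ) (q : 𝒢.pullbackArrows p) :
    𝒢.mul (𝒢.mul (𝒢.inv (σ q.1.2.2)) (h.arrow q).1) (σ q.1.1) = q.1.2.1 := by
  change 𝒢.mul (𝒢.mul (𝒢.inv (σ q.1.2.2))
    (𝒢.mul (𝒢.mul (σ q.1.2.2) q.1.2.1) (𝒢.inv (σ q.1.1)))) (σ q.1.1) = q.1.2.1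
  have h1 := h.composable_left q
  have h2 := h.composable_right q
  rw [← 𝒢.mul_assoc _ _ _ (by rw [𝒢.src_inv, 𝒢.tgt_mul _ _ h1]) (h.composable q),
    𝒢.inv_mul_cancel_left h1, 𝒢.inv_mul_cancel_right (h2.trans (𝒢.tgt_inv _))]

theorem conj_conj_inv (h : 𝒢.IsSliceSection S p σ) {q : X × 𝒢.RestrictArrows S × X}
    (hq : q ∈ (𝒢.restrict S).pullbackArrows h.base) :
    h.arrow ⟨_, h.mem_pullbackArrows hq⟩ = q.2.1 := by
  have h1 : 𝒢.tgt (σ q.1) = 𝒢.src q.2.1.1 := congrArg Subtype.val hq.1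
  have h2 : 𝒢.tgt q.2.1.1 = 𝒢.tgt (σ q.2.2) := congrArg Subtype.val hq.2
  have h3 : 𝒢.src (𝒢.inv (σ q.2.2)) = 𝒢.tgt q.2.1.1 := (𝒢.src_inv _).trans h2.symm
  have h4 : 𝒢.src (𝒢.mul (𝒢.inv (σ q.2.2)) q.2.1.1) = 𝒢.tgt (σ q.1) :=
    (𝒢.src_mul _ _ h3).trans h1.symm
  apply Subtype.ext
  change 𝒢.mul (𝒢.mul (σ q.2.2) (𝒢.mul (𝒢.mul (𝒢.inv (σ q.2.2)) q.2.1.1) (σ q.1)))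
    (𝒢.inv (σ q.1)) = q.2.1.1
  rw [← 𝒢.mul_assoc _ _ _ (by rw [𝒢.tgt_mul _ _ h3, 𝒢.tgt_inv]) h4,
    𝒢.mul_inv_cancel_left h2.symm, 𝒢.mul_inv_cancel_right h1.symm]

end Algebra

variable {𝕜 : Type v} [RCLike 𝕜] {E₁ E₀ E_S E_A : Type u}
  [NormedAddCommGroup E₁] [NormedSpace 𝕜 E₁] [FiniteDimensional 𝕜 E₁]
  [NormedAddCommGroup E₀] [NormedSpace 𝕜 E₀] [FiniteDimensional 𝕜 E₀]
  [NormedAddCommGroup E_S] [NormedSpace 𝕜 E_S] [FiniteDimensional 𝕜 E_S]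
  [NormedAddCommGroup E_A] [NormedSpace 𝕜 E_A] [FiniteDimensional 𝕜 E_A]
  {G M X : Type u} [TopologicalSpace G] [ChartedSpace E₁ G] [IsManifold 𝓘(𝕜, E₁) ∞ G]
  [TopologicalSpace M] [ChartedSpace E₀ M] [IsManifold 𝓘(𝕜, E₀) ∞ M]
  [TopologicalSpace X] [ChartedSpace E₀ X] [IsManifold 𝓘(𝕜, E₀) ∞ X]
  {𝒢 : Grpd G M} {S : Set M} [ChartedSpace E_S S] [IsManifold 𝓘(𝕜, E_S) ∞ S]
  [ChartedSpace E_A (𝒢.RestrictArrows S)] [IsManifold 𝓘(𝕜, E_A) ∞ (𝒢.RestrictArrows S)]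
  {p : X → M} {σ : X → G}
  [ChartedSpace E₁ (𝒢.pullbackArrows p)] [IsManifold 𝓘(𝕜, E₁) ∞ (𝒢.pullbackArrows p)]

theorem contMDiff_base (hL : 𝒢.IsLie 𝕜 E₁ E₀)
    (hi : HasLocalRetractions 𝕜 E_S E₀ (Subtype.val : S → M))
    (hσ : ContMDiff 𝓘(𝕜, E₀) 𝓘(𝕜, E₁) ∞ σ) (h : 𝒢.IsSliceSection S p σ) :
    ContMDiff 𝓘(𝕜, E₀) 𝓘(𝕜, E_S) ∞ h.base :=
  hi.contMDiff_of_isInducing .subtypeVal (hL.contMDiff_tgt.comp hσ)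

/-- A local right inverse of the base map is `y ↦ r(s(τ y))`, with `τ` a local section of `t`
through `σ(x)` and `r` a local inverse of `p`. Indeed `τ y` joins `s(τ y)` to `y`, while `σ` joins
the same point to its base value; both ends lie in `S` on one orbit, so they coincide. -/
theorem isSubmersionMap_base (hL : 𝒢.IsLie 𝕜 E₁ E₀)
    (hS : 𝒢.IsAdmissibleGlobalSlice 𝕜 E₁ E₀ E_S S)
    (hi : HasLocalRetractions 𝕜 E_S E₀ (Subtype.val : S → M)) (hp : IsEtaleMap 𝕜 E₀ E₀ p)
    (hσ : ContMDiff 𝓘(𝕜, E₀) 𝓘(𝕜, E₁) ∞ σ) (h : 𝒢.IsSliceSection S p σ) :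
    IsSubmersionMap 𝕜 E₀ E_S h.base := by
  have hb := h.contMDiff_base hL hi hσ
  refine ⟨hb, fun x w => ?_⟩
  obtain ⟨r, hr, hr1, hr2⟩ := hp.exists_inverse x
  obtain ⟨τ, hτ, hτ1, hτ2⟩ := exists_local_section hL.contMDiff_tgt (hL.surjective_tmap_tgt (σ x))
  have hsτ : 𝒢.src (τ (𝒢.tgt (σ x))) = p x := by rw [hτ1, h.src_eq]
  have h1 : ContMDiffAt 𝓘(𝕜, E_S) 𝓘(𝕜, E₀) ∞ (fun y : S => 𝒢.src (τ y.1)) (h.base x) :=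
    (hL.contMDiff_src _).comp (h.base x)
      (ContMDiffAt.comp (h.base x) (g := τ) hτ (hi.contMDiff (h.base x)))
  have h1x : 𝒢.src (τ (h.base x).1) = p x := hsτ
  have h2 : ContMDiffAt 𝓘(𝕜, E_S) 𝓘(𝕜, E₀) ∞ (fun y : S => r (𝒢.src (τ y.1))) (h.base x) :=
    ContMDiffAt.comp (h.base x) (g := r) (by rw [h1x]; exact hr) h1
  have h3 : r (𝒢.src (τ (h.base x).1)) = x := by
    change r (𝒢.src (τ (𝒢.tgt (σ x)))) = x
    rw [hsτ]; exact hr1.self_of_nhds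
  have hc := h1.continuousAt
  rw [ContinuousAt, h1x] at hc
  have hc' : Tendsto (Subtype.val : S → M) (𝓝 (h.base x)) (𝓝 (𝒢.tgt (σ x))) :=
    continuous_subtype_val.continuousAt
  refine ⟨tmap 𝕜 E_S E₀ (fun y : S => r (𝒢.src (τ y.1))) (h.base x) w,
    tmap_leftInverse (f := fun y : S => r (𝒢.src (τ y.1))) h3 (h2.mdifferentiableAt (by simp))
      ((hb x).mdifferentiableAt (by simp)) ?_ w⟩
  filter_upwards [hc.eventually hr2, hc'.eventually hτ2] with y hy1 hy2
  refine Subtype.ext ((hS.meets_once (𝒢.src (τ y.1))).unique ⟨h.tgt_mem _, _, ?_, rfl⟩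
    ⟨y.2, _, rfl, hy2⟩)
  rw [h.src_eq, hy1]

/-- If `x` lies over a point `y` of `S`, then `σ(x)` has both endpoints in `S`, so its target is
`y`. -/
theorem surjective_base (hS : 𝒢.IsAdmissibleGlobalSlice 𝕜 E₁ E₀ E_S S)
    (hp : Function.Surjective p) (h : 𝒢.IsSliceSection S p σ) : Function.Surjective h.base := by
  intro y
  obtain ⟨x, hx⟩ := hp y.1
  have h1 : 𝒢.src (σ x) = y.1 := (h.src_eq x).trans hx
  exact ⟨x, Subtype.ext ((hS.tgt_eq_src (by rw [h1]; exact y.2) (h.tgt_mem x)).trans h1)⟩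

theorem contMDiff_arrow (hL : 𝒢.IsLie 𝕜 E₁ E₀) (hL' : (𝒢.pullbackGrpd p).IsLie 𝕜 E₁ E₀)
    (hj : HasLocalRetractions 𝕜 E_A E₁ (Subtype.val : 𝒢.RestrictArrows S → G))
    (hq : IsEtaleMap 𝕜 E₁ E₁ (𝒢.pullbackArrow p)) (hσ : ContMDiff 𝓘(𝕜, E₀) 𝓘(𝕜, E₁) ∞ σ)
    (h : 𝒢.IsSliceSection S p σ) : ContMDiff 𝓘(𝕜, E₁) 𝓘(𝕜, E_A) ∞ h.arrow :=
  hj.contMDiff_of_isInducing .subtypeVal (hL.contMDiff_mul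
    (hL.contMDiff_mul (hσ.comp hL'.contMDiff_tgt) hq.contMDiff h.composable_left)
    (hL.inv_smooth.comp (hσ.comp hL'.contMDiff_src)) h.composable)

/-- Conjugation is invertible once the endpoints `x, x'` in `X` are known: `a ↦ σ(x')⁻¹ a σ(x)` is
smooth and inverse to it. -/
theorem isMoritaMorphism_arrow (hL : 𝒢.IsLie 𝕜 E₁ E₀)
    (hS : 𝒢.IsAdmissibleGlobalSlice 𝕜 E₁ E₀ E_S S)
    (hi : HasLocalRetractions 𝕜 E_S E₀ (Subtype.val : S → M))
    (hj : HasLocalRetractions 𝕜 E_A E₁ (Subtype.val : 𝒢.RestrictArrows S → G))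
    (hp : IsEtaleMap 𝕜 E₀ E₀ p) (hps : Function.Surjective p)
    (hq : IsEtaleMap 𝕜 E₁ E₁ (𝒢.pullbackArrow p)) (hσ : ContMDiff 𝓘(𝕜, E₀) 𝓘(𝕜, E₁) ∞ σ)
    (h : 𝒢.IsSliceSection S p σ) :
    IsMoritaMorphism 𝕜 E₁ E₀ E_A E_S (𝒢.pullbackGrpd p) (𝒢.restrict S) h.arrow h.base := by
  classical
  refine ⟨⟨h.contMDiff_arrow hL (hL.pullbackGrpd hp hq) hj hq hσ, h.contMDiff_base hL hi hσ,
    h.src_arrow, h.tgt_arrow, fun q r c => h.arrow_mul c⟩, h.surjective_base hS hps,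
    h.isSubmersionMap_base hL hS hi hp hσ,
    fun q => if hq : q ∈ (𝒢.restrict S).pullbackArrows h.base then
      ⟨_, h.mem_pullbackArrows hq⟩ else (𝒢.pullbackGrpd p).unit q.1, ?_, fun q => ?_,
    fun q hq => ?_⟩
  · have hm : ContMDiffOn (𝓘(𝕜, E₀).prod (𝓘(𝕜, E_A).prod 𝓘(𝕜, E₀))) 𝓘(𝕜, E₁) ∞
        (fun q : X × 𝒢.RestrictArrows S × X =>
          𝒢.mul (𝒢.mul (𝒢.inv (σ q.2.2)) q.2.1.1) (σ q.1))
        ((𝒢.restrict S).pullbackArrows h.base) := by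
      have h3 : ∀ q ∈ (𝒢.restrict S).pullbackArrows h.base,
          𝒢.src (𝒢.inv (σ q.2.2)) = 𝒢.tgt q.2.1.1 := fun q hq =>
        (𝒢.src_inv _).trans (congrArg Subtype.val hq.2).symm
      refine hL.contMDiffOn_mul (hL.contMDiffOn_mul (ContMDiff.contMDiffOn ?_)
        (ContMDiff.contMDiffOn ?_) h3) (ContMDiff.contMDiffOn ?_) fun q hq => ?_
      · exact hL.inv_smooth.comp (hσ.comp (contMDiff_snd.comp contMDiff_snd))
      · exact hj.contMDiff.comp (contMDiff_fst.comp contMDiff_snd)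
      · exact hσ.comp contMDiff_fst
      · rw [𝒢.src_mul _ _ (h3 q hq)]
        exact (congrArg Subtype.val hq.1).symm
    refine hq.hasLocalRetractions.contMDiffOn ?_ (hm.congr fun q hq => ?_)
    · refine Topology.IsInducing.subtypeVal.continuousOn_iff.2 (ContinuousOn.congr
        (continuous_fst.continuousOn.prodMk (hm.continuousOn.prodMk
          (continuous_snd.comp continuous_snd).continuousOn)) fun q hq => ?_)
      simp only [Function.comp_apply, dif_pos hq]
    · simp only [dif_pos hq]
      rfl
  · have hq : ((𝒢.pullbackGrpd p).src q, h.arrow q, (𝒢.pullbackGrpd p).tgt q) ∈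
        (𝒢.restrict S).pullbackArrows h.base := ⟨(h.src_arrow q).symm, h.tgt_arrow q⟩
    refine (dif_pos hq).trans ?_
    exact Subtype.ext (Prod.ext rfl (Prod.ext (h.conj_inv_conj q) rfl))
  · simp only [dif_pos hq]
    exact Prod.ext rfl (Prod.ext (h.conj_conj_inv hq) rfl)

end IsSliceSection

end Grpd

/-! ### The Lagrangian correspondence -/

namespace Grpd

namespace IsSliceSection

variable {𝕜 : Type v} [RCLike 𝕜] {E₁ E₀ E_S E_A : Type u}
  [NormedAddCommGroup E₁] [NormedSpace 𝕜 E₁] [FiniteDimensional 𝕜 E₁]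
  [NormedAddCommGroup E₀] [NormedSpace 𝕜 E₀] [FiniteDimensional 𝕜 E₀]
  [NormedAddCommGroup E_S] [NormedSpace 𝕜 E_S] [FiniteDimensional 𝕜 E_S]
  [NormedAddCommGroup E_A] [NormedSpace 𝕜 E_A] [FiniteDimensional 𝕜 E_A]
  {G M X : Type u}
  [TopologicalSpace G] [T2Space G] [SecondCountableTopology G]
  [ChartedSpace E₁ G] [IsManifold 𝓘(𝕜, E₁) ∞ G]
  [TopologicalSpace M] [T2Space M] [SecondCountableTopology M]
  [ChartedSpace E₀ M] [IsManifold 𝓘(𝕜, E₀) ∞ M]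
  [TopologicalSpace X] [T2Space X] [SecondCountableTopology X]
  [ChartedSpace E₀ X] [IsManifold 𝓘(𝕜, E₀) ∞ X]
  {𝒢 : Grpd G M} {S : Set M} [ChartedSpace E_S S] [IsManifold 𝓘(𝕜, E_S) ∞ S]
  [ChartedSpace E_A (𝒢.RestrictArrows S)] [IsManifold 𝓘(𝕜, E_A) ∞ (𝒢.RestrictArrows S)]
  {p : X → M} {σ : X → G}
  [ChartedSpace E₁ (𝒢.pullbackArrows p)] [IsManifold 𝓘(𝕜, E₁) ∞ (𝒢.pullbackArrows p)]

/-- The pullback of a multiplicative form by the conjugation map. -/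
theorem pullback_arrow (hL : 𝒢.IsLie 𝕜 E₁ E₀) (hL' : (𝒢.pullbackGrpd p).IsLie 𝕜 E₁ E₀)
    (hj : HasLocalRetractions 𝕜 E_A E₁ (Subtype.val : 𝒢.RestrictArrows S → G))
    (hq : IsEtaleMap 𝕜 E₁ E₁ (𝒢.pullbackArrow p)) (hσ : ContMDiff 𝓘(𝕜, E₀) 𝓘(𝕜, E₁) ∞ σ)
    (h : 𝒢.IsSliceSection S p σ) {Ω : DForm 𝕜 E₁ G 2} (hΩ : 𝒢.IsMultiplicative Ω) :
    (DForm.pullback h.arrow (DForm.pullback (Subtype.val : 𝒢.RestrictArrows S → G) Ω :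
        DForm 𝕜 E_A _ 2) : DForm 𝕜 E₁ _ 2) =
      DForm.pullback (𝒢.pullbackGrpd p).tgt (DForm.pullback σ Ω : DForm 𝕜 E₀ X 2) +
        DForm.pullback (𝒢.pullbackArrow p) Ω -
        DForm.pullback (𝒢.pullbackGrpd p).src (DForm.pullback σ Ω : DForm 𝕜 E₀ X 2) := by
  let H : Mfld.{v, u} 𝕜 := { carrier := 𝒢.pullbackArrows p, model := E₁ }
  have hσd := hσ.mdifferentiable (by simp)
  have hsd := hL'.contMDiff_src.mdifferentiable (by simp)
  have htd := hL'.contMDiff_tgt.mdifferentiable (by simp)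
  have hσt := hσ.comp hL'.contMDiff_tgt
  have hσs := hσ.comp hL'.contMDiff_src
  have h1 := hΩ H (fun q => σ ((𝒢.pullbackGrpd p).tgt q)) (𝒢.pullbackArrow p) hσt hq.contMDiff
    h.composable_left
  have h2 := hΩ H (fun q => 𝒢.mul (σ ((𝒢.pullbackGrpd p).tgt q)) (𝒢.pullbackArrow p q))
    (fun q => 𝒢.inv (σ ((𝒢.pullbackGrpd p).src q)))
    (hL.contMDiff_mul hσt hq.contMDiff h.composable_left) (hL.inv_smooth.comp hσs) h.composable
  -- Inversion reverses the sign of a multiplicative form, so the factor `σ⁻¹` at the source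
  -- contributes negatively.
  rw [h1, DForm.pullback_comp (g := 𝒢.inv) (f := fun q => σ ((𝒢.pullbackGrpd p).src q)) Ω
    (hL.inv_smooth.mdifferentiable (by simp)) (hσs.mdifferentiable (by simp)),
    hΩ.pullback_inv hL, DForm.pullback_comp (f := (𝒢.pullbackGrpd p).tgt) Ω hσd htd] at h2
  rw [← DForm.pullback_comp (f := h.arrow) Ω (hj.contMDiff.mdifferentiable (by simp))
    ((h.contMDiff_arrow hL hL' hj hq hσ).mdifferentiable (by simp)),
    ← DForm.pullback_comp (f := (𝒢.pullbackGrpd p).src) Ω hσd hsd, sub_eq_add_neg]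
  exact h2

/-- The term `σ^*Ω` of `δ` produces the identity of 2-forms, and the `γ`-term, being pulled back
from the objects of a groupoid with `s = t`, drops out of it. The `γ`-term is there for the 3-forms:
it cancels the contribution of `t^*φ` to `d(σ^*Ω)`. -/
theorem isLagrangianCorrespondence {Ω : DForm 𝕜 E₁ G 2} {φ : DForm 𝕜 E₀ M 3}
    (hG : 𝒢.IsQuasiSymplectic Ω φ)
    (hS : 𝒢.IsAdmissibleGlobalSlice 𝕜 E₁ E₀ E_S S)
    (hi : HasLocalRetractions 𝕜 E_S E₀ (Subtype.val : S → M))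
    (hA : (𝒢.restrict S).IsLie 𝕜 E_A E_S)
    (hj : HasLocalRetractions 𝕜 E_A E₁ (Subtype.val : 𝒢.RestrictArrows S → G))
    (hp : IsEtaleMap 𝕜 E₀ E₀ p) (hps : Function.Surjective p)
    (hq : IsEtaleMap 𝕜 E₁ E₁ (𝒢.pullbackArrow p)) (hσ : ContMDiff 𝓘(𝕜, E₀) 𝓘(𝕜, E₁) ∞ σ)
    (h : 𝒢.IsSliceSection S p σ) {γ : DForm 𝕜 E_S S 2} (hγ : γ.IsSmooth)
    (hφ : DForm.pullback (Subtype.val : S → M) φ = γ.d) :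
    IsLagrangianCorrespondence E₁ (𝒢.pullbackGrpd p) (𝒢.restrict S)
      (DForm.pullback (Subtype.val : 𝒢.RestrictArrows S → G) Ω : DForm 𝕜 E_A _ 2)
      (0 : DForm 𝕜 E_S S 3) 𝒢 Ω φ h.arrow h.base (𝒢.pullbackArrow p) p
      (DForm.pullback σ Ω + DForm.pullback h.base γ : DForm 𝕜 E₀ X 2) := by
  have hL := hG.isLie
  have hL' := hL.pullbackGrpd hp hq
  have hm₁ := h.isMoritaMorphism_arrow hL hS hi hj hp hps hq hσ
  have hm₂ := isMoritaMorphism_pullbackArrow hp hps hq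
  have hb := hm₁.morphism.objects_smooth
  have hbd := hb.mdifferentiable (by simp)
  have hσd := hσ.mdifferentiable (by simp)
  have hbs : (fun q => h.base ((𝒢.pullbackGrpd p).tgt q)) =
      fun q => h.base ((𝒢.pullbackGrpd p).src q) := funext fun q => by
    rw [← h.src_arrow, ← h.tgt_arrow, hS.restrict_src_eq_tgt]
  have htwo : (DForm.pullback h.arrow (DForm.pullback (Subtype.val : 𝒢.RestrictArrows S → G) Ω :
        DForm 𝕜 E_A _ 2) - DForm.pullback (𝒢.pullbackArrow p) Ω : DForm 𝕜 E₁ _ 2) =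
      DForm.pullback (𝒢.pullbackGrpd p).tgt
        (DForm.pullback σ Ω + DForm.pullback h.base γ : DForm 𝕜 E₀ X 2) -
      DForm.pullback (𝒢.pullbackGrpd p).src
        (DForm.pullback σ Ω + DForm.pullback h.base γ : DForm 𝕜 E₀ X 2) := by
    rw [h.pullback_arrow hL hL' hj hq hσ hG.multiplicative, DForm.pullback_add, DForm.pullback_add,
      ← DForm.pullback_comp γ hbd (hL'.contMDiff_src.mdifferentiable (by simp)),
      ← DForm.pullback_comp γ hbd (hL'.contMDiff_tgt.mdifferentiable (by simp)), hbs]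
    abel
  refine ⟨hL', hm₁.morphism, hm₂.morphism,
    (hG.smooth_two.pullback hσ).add (hγ.pullback hb), htwo, ?_, ?_⟩
  · rw [DForm.d_add (hG.smooth_two.pullback hσ) (hγ.pullback hb),
      DForm.d_pullback hσ hG.smooth_two, DForm.d_pullback hb hγ, hG.d_two, ← hφ,
      DForm.pullback_sub,
      ← DForm.pullback_comp φ (hL.contMDiff_src.mdifferentiable (by simp)) hσd,
      ← DForm.pullback_comp φ (hL.contMDiff_tgt.mdifferentiable (by simp)) hσd,
      ← DForm.pullback_comp φ (hi.contMDiff.mdifferentiable (by simp)) hbd, DForm.pullback_zero,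
      zero_sub, neg_inj]
    -- What remains is `p^*φ = (σ^*s^*φ - σ^*t^*φ) + σ^*t^*φ`.
    have h1 : (fun x => 𝒢.src (σ x)) = p := funext h.src_eq
    have h2 : (fun x => (h.base x).1) = fun x => 𝒢.tgt (σ x) := rfl
    rw [h1, h2, sub_add_cancel]
  -- The condition is restated with model spaces in place of tangent spaces, so that the chain rule
  -- for `tmap` applies.
  · suffices hnd : ∀ (x : X) (y : E₀) (a₁ : E_A) (a₂ : E₁),
        tmap 𝕜 E_A E_S (𝒢.restrict S).src ((𝒢.restrict S).unit (h.base x)) a₁ = 0 →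
        tmap 𝕜 E₁ E₀ 𝒢.src (𝒢.unit (p x)) a₂ = 0 →
        tmap 𝕜 E₀ E₀ p x y = tmap 𝕜 E₁ E₀ 𝒢.tgt (𝒢.unit (p x)) a₂ →
        (∀ w : E₀, ((DForm.pullback σ Ω + DForm.pullback h.base γ : DForm 𝕜 E₀ X 2).at' x).pairing
            y w = ((DForm.pullback (Subtype.val : 𝒢.RestrictArrows S → G) Ω :
              DForm 𝕜 E_A _ 2).at' ((𝒢.restrict S).unit (h.base x))).pairing a₁
              (tmap 𝕜 E_S E_A (𝒢.restrict S).unit (h.base x) (tmap 𝕜 E₀ E_S h.base x w)) -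
            (Ω.at' (𝒢.unit (p x))).pairing a₂
              (tmap 𝕜 E₀ E₁ 𝒢.unit (p x) (tmap 𝕜 E₀ E₀ p x w))) →
        ∃! b : E₁,
          tmap 𝕜 E₁ E₀ (𝒢.pullbackGrpd p).src ((𝒢.pullbackGrpd p).unit x) b = 0 ∧
          tmap 𝕜 E₁ E₀ (𝒢.pullbackGrpd p).tgt ((𝒢.pullbackGrpd p).unit x) b = y ∧
          tmap 𝕜 E₁ E_A h.arrow ((𝒢.pullbackGrpd p).unit x) b = a₁ ∧
          tmap 𝕜 E₁ E₁ (𝒢.pullbackArrow p) ((𝒢.pullbackGrpd p).unit x) b = a₂ from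
      fun x y a₁ a₂ h1 h2 _ h4 h5 => hnd x y a₁ a₂ h1 h2 h4 h5
    intro x y a₁ a₂ ha₁ ha₂ hy hw
    set e := (𝒢.pullbackGrpd p).unit x with he
    have hqd := hq.contMDiff.mdifferentiable (by simp)
    have hpd := hp.contMDiff.mdifferentiable (by simp)
    have had := hm₁.morphism.arrows_smooth.mdifferentiable (by simp)
    -- The projection to `G` is étale, so `a₂` determines `b`. Its source and target components are
    -- checked after the injective `p_*`.
    obtain ⟨b, hb⟩ := (hq.bijective_tmap e).2 a₂
    have hsrc : tmap 𝕜 E₁ E₀ (𝒢.pullbackGrpd p).src e b = 0 := by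
      refine (hp.bijective_tmap x).1 ?_
      rw [← tmap_comp_apply (f := (𝒢.pullbackGrpd p).src) (y := x) rfl (hpd x)
        (hL'.mdifferentiableAt_src e), ← funext (𝒢.src_pullbackArrow p),
        tmap_comp_apply (f := 𝒢.pullbackArrow p) (y := 𝒢.unit (p x)) rfl
        (hL.mdifferentiableAt_src _) (hqd e), hb, ha₂, map_zero]
    have htgt : tmap 𝕜 E₁ E₀ (𝒢.pullbackGrpd p).tgt e b = y := by
      refine (hp.bijective_tmap x).1 ?_
      rw [← tmap_comp_apply (f := (𝒢.pullbackGrpd p).tgt) (y := x) rfl (hpd x)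
        (hL'.mdifferentiableAt_tgt e), ← funext (𝒢.tgt_pullbackArrow p),
        tmap_comp_apply (f := 𝒢.pullbackArrow p) (y := 𝒢.unit (p x)) rfl
        (hL.mdifferentiableAt_tgt _) (hqd e), hb, hy]
    have hae : h.arrow e = (𝒢.restrict S).unit (h.base x) := h.arrow_unit x
    -- Both sides lie in the algebroid of the restriction, so it suffices that their IM-forms agree;
    -- every vector of `TS` is the image of some `w`, the base map being a submersion.
    have harr : tmap 𝕜 E₁ E_A h.arrow e b = a₁ := by
      rw [← sub_eq_zero]
      refine hG.imForm_restrict_injective hS hi hA hj (h.base x) _ ?_ fun w' => ?_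
      · rw [map_sub, ha₁, sub_zero, ← tmap_comp_apply (f := h.arrow) hae
          (hA.mdifferentiableAt_src _) (had e), funext h.src_arrow,
          tmap_comp_apply (f := (𝒢.pullbackGrpd p).src) (y := x) rfl (hbd x)
          (hL'.mdifferentiableAt_src e), hsrc, map_zero]
      · obtain ⟨w, rfl⟩ : ∃ w, tmap 𝕜 E₀ E_S h.base x w = w' := hm₁.submersion.2 x w'
        -- The identity of 2-forms is evaluated on `b` and `u_* w`. The source term vanishes as `s_*
        -- b = 0`, and the target term is `δ(y, w)`; comparison with the hypothesis on `i_y δ`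
        -- leaves the equality of IM-forms.
        have h1 := congrArg (fun α : DForm 𝕜 E₁ (𝒢.pullbackArrows p) 2 =>
          (α.at' e).pairing b (tmap 𝕜 E₀ E₁ (𝒢.pullbackGrpd p).unit x w)) htwo
        change ((DForm.pullback h.arrow (DForm.pullback (Subtype.val : 𝒢.RestrictArrows S → G) Ω :
            DForm 𝕜 E_A _ 2) : DForm 𝕜 E₁ _ 2).at' e).pairing b _ -
            ((DForm.pullback (𝒢.pullbackArrow p) Ω : DForm 𝕜 E₁ _ 2).at' e).pairing b _ =
          ((DForm.pullback (𝒢.pullbackGrpd p).tgt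
            (DForm.pullback σ Ω + DForm.pullback h.base γ : DForm 𝕜 E₀ X 2) :
              DForm 𝕜 E₁ _ 2).at' e).pairing b _ -
          ((DForm.pullback (𝒢.pullbackGrpd p).src
            (DForm.pullback σ Ω + DForm.pullback h.base γ : DForm 𝕜 E₀ X 2) :
              DForm 𝕜 E₁ _ 2).at' e).pairing b _ at h1
        rw [DForm.pullback_at h.arrow, DForm.pullback_at (𝒢.pullbackArrow p),
          DForm.pullback_at (𝒢.pullbackGrpd p).tgt, DForm.pullback_at (𝒢.pullbackGrpd p).src,
          ContinuousAlternatingMap.pairing_comp, ContinuousAlternatingMap.pairing_comp,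
          ContinuousAlternatingMap.pairing_comp, ContinuousAlternatingMap.pairing_comp, hsrc, htgt,
          map_zero, LinearMap.zero_apply, sub_zero, hL'.tmap_tgt_unit, hb,
          ← tmap_comp_apply (f := (𝒢.pullbackGrpd p).unit) he.symm (had e)
            (hL'.mdifferentiableAt_unit x), funext h.arrow_unit,
          ← tmap_comp_apply (f := (𝒢.pullbackGrpd p).unit) he.symm (hqd e)
            (hL'.mdifferentiableAt_unit x),
          tmap_comp_apply (f := h.base) rfl (hA.mdifferentiableAt_unit _) (hbd x), hae] at h1
        have h2 : tmap 𝕜 E₀ E₁ (fun z => 𝒢.pullbackArrow p ((𝒢.pullbackGrpd p).unit z)) x w =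
            tmap 𝕜 E₀ E₁ 𝒢.unit (p x) (tmap 𝕜 E₀ E₀ p x w) :=
          tmap_comp_apply (f := p) rfl (hL.mdifferentiableAt_unit _) (hpd x) w
        have h3 := hw w
        rw [h2] at h1
        rw [map_sub, LinearMap.sub_apply, sub_eq_zero]
        exact sub_left_injective (h1.trans h3)
    exact ⟨b, ⟨hsrc, htgt, harr, hb⟩, fun b' hb' =>
      (hq.bijective_tmap e).1 (hb'.2.2.2.trans hb.symm)⟩

end IsSliceSection

end Grpd


/-- The complement in an immersion into a finite-dimensional manifold can be taken
finite-dimensional. -/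
theorem Manifold.IsImmersion.exists_finiteDimensional_complement {𝕜 : Type v} [RCLike 𝕜]
    {E E' : Type u} [NormedAddCommGroup E] [NormedSpace 𝕜 E]
    [NormedAddCommGroup E'] [NormedSpace 𝕜 E'] [FiniteDimensional 𝕜 E']
    {Z M : Type u} [TopologicalSpace Z] [ChartedSpace E Z] [TopologicalSpace M]
    [ChartedSpace E' M] {f : Z → M} (hf : Manifold.IsImmersion 𝓘(𝕜, E) 𝓘(𝕜, E') ∞ f) :
    ∃ (F : Type u) (_ : NormedAddCommGroup F) (_ : NormedSpace 𝕜 F) (_ : FiniteDimensional 𝕜 F),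
      Manifold.IsImmersionOfComplement F 𝓘(𝕜, E) 𝓘(𝕜, E') ∞ f := by
  obtain ⟨F, _, _, hF⟩ := hf
  rcases isEmpty_or_nonempty Z with hZ | ⟨⟨z⟩⟩
  -- With no points there is no condition on the complement, and the given one need not be
  -- finite-dimensional.
  · exact ⟨PUnit, inferInstance, inferInstance, inferInstance, fun z => hZ.elim z⟩
  · refine ⟨F, inferInstance, inferInstance, ?_, hF⟩
    have e := (hF z).equiv.toLinearEquiv
    exact Module.Finite.of_injective (e.toLinearMap ∘ₗ LinearMap.inr 𝕜 E F)
      (e.injective.comp LinearMap.inr_injective)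

/-! ### The abelianization -/

theorem mainTheorem7 {𝕜 : Type v} [RCLike 𝕜]
    {E₁ E₀ : Type u} [NormedAddCommGroup E₁] [NormedSpace 𝕜 E₁] [FiniteDimensional 𝕜 E₁]
    [NormedAddCommGroup E₀] [NormedSpace 𝕜 E₀] [FiniteDimensional 𝕜 E₀]
    {G M : Type u}
    [TopologicalSpace G] [T2Space G] [SecondCountableTopology G]
    [ChartedSpace E₁ G] [IsManifold 𝓘(𝕜, E₁) ∞ G]
    [TopologicalSpace M] [T2Space M] [SecondCountableTopology M]
    [ChartedSpace E₀ M] [IsManifold 𝓘(𝕜, E₀) ∞ M]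
    (𝒢 : Grpd G M) (Ω : DForm 𝕜 E₁ G 2) (φ : DForm 𝕜 E₀ M 3)
    (hG : 𝒢.IsQuasiSymplectic Ω φ)
    {E_S : Type u} [NormedAddCommGroup E_S] [NormedSpace 𝕜 E_S] [FiniteDimensional 𝕜 E_S]
    (S : Set M) [ChartedSpace E_S S] [IsManifold 𝓘(𝕜, E_S) ∞ S]
    (hS : 𝒢.IsAdmissibleGlobalSlice 𝕜 E₁ E₀ E_S S)
    (γ : DForm 𝕜 E_S S 2) (hγ : γ.IsSmooth)
    (hφ : DForm.pullback (Subtype.val : S → M) φ = γ.d) :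
    ∃ (E_A : Type u) (_ : NormedAddCommGroup E_A) (_ : NormedSpace 𝕜 E_A)
      (_ : FiniteDimensional 𝕜 E_A) (_ : ChartedSpace E_A (𝒢.RestrictArrows S))
      (_ : IsManifold 𝓘(𝕜, E_A) ∞ (𝒢.RestrictArrows S)),
      Manifold.IsSmoothEmbedding 𝓘(𝕜, E_A) 𝓘(𝕜, E₁) ∞
        (Subtype.val : 𝒢.RestrictArrows S → G) ∧
      (𝒢.restrict S).IsAbelianization E_S
        (DForm.pullback (Subtype.val : 𝒢.RestrictArrows S → G) Ω
            - DForm.pullback (𝒢.restrict S).src γ + DForm.pullback (𝒢.restrict S).tgt γ :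
          DForm 𝕜 E_A (𝒢.RestrictArrows S) 2)
        𝒢 Ω φ := by
  have hL := hG.isLie
  obtain ⟨F, _, _, _, hF⟩ := hS.embedded.isImmersion.exists_finiteDimensional_complement
  have hi := hF.hasLocalRetractions
  obtain ⟨csA, hmA, hemb, hj⟩ := hS.exists_restrict_manifold hL hG.dim_eq hF
  refine ⟨E_S × E_S, inferInstance, inferInstance, inferInstance, csA, hmA, hemb, ?_⟩
  -- The `γ`-terms cancel on the restriction, where `s = t`.
  rw [← hS.restrict_src_eq_tgt, sub_add_cancel]
  have hA : (𝒢.restrict S).IsLie 𝕜 (E_S × E_S) E_S := hS.isLie_restrict hL hF hj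
  have hdim : Module.finrank 𝕜 (E_S × E_S) = 2 * Module.finrank 𝕜 E_S := by
    rw [Module.finrank_prod, two_mul]
  refine ⟨hG.isSymplectic_restrict hS hi hA hj hdim, hS.isAbelian_restrict, ?_⟩
  obtain ⟨X, _, _, _, _, _, p, σ, hp, hpe, hps, hσ, hσs, hσt⟩ := hS.exists_etale_section hL hF
  have h : 𝒢.IsSliceSection S p σ := ⟨hσs, hσt⟩
  obtain ⟨csH, hmH, hq⟩ := exists_manifold_of_isLocalHomeomorph (𝕜 := 𝕜) (E' := E₁)
    (Grpd.isLocalHomeomorph_pullbackArrow (𝒢 := 𝒢) hp hL.contMDiff_src.continuous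
      hL.contMDiff_tgt.continuous)
  -- The omitted 2-form is `δ = σ^*Ω + (t ∘ σ)^*γ`, fixed by the last component.
  exact ⟨{ carrier := 𝒢.pullbackArrows p, model := E₁ }, { carrier := X, model := E₀ },
    𝒢.pullbackGrpd p, h.arrow, h.base, 𝒢.pullbackArrow p, p, _,
    h.isMoritaMorphism_arrow hL hS hi hj hpe hps hq hσ,
    Grpd.isMoritaMorphism_pullbackArrow hpe hps hq,
    h.isLagrangianCorrespondence hG hS hi hA hj hpe hps hq hσ hγ hφ⟩
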